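/- **Setting.** Let $D,k_0,\ell\ge 1$, $r_0\ge 0$, and consider $n=(2L+1)^D$ qubits on the lattice $\Lambda=[-L,L]^D$ (open or periodic boundary conditions, maximum distance), possibly with a finite-dimensional ancilla at each site. For $x=(x_j)_{j\in\Lambda}\in[-1,1]^m$, $x_j\in[-1,1]^\ell$, $m=n\ell$, let $\mathcal L(x)=\sum_j\mathcal L_j(x_j)$, where $\mathcal L_j(y)$ depends affinely on $y$ and, for each $y\in[-1,1]^\ell$, is a Lindbladian supported on the ball $b_j(r_0)$ with $\|\mathcal L_j(y)\|_{1\to1,cb}\le J$. Let $\mathcal L'=\sum_j\mathcal L'_j$ be a local Lindbladian of the same kind, and for $R\subseteq\Lambda$ let $\mathcal L_R(x)$ consist of the terms $\mathcal L_j(x_j)$ with $b_j(r_0)\subseteq R$ and of the terms $\mathcal L'_j$ for all other $j$. The family is a *steady-state phase* with reference states $\rho^*$ (qubits), $\omega^*$ (ancillas), rate $g>0$ and polynomial prefactors $a(\cdot)^\kappa$ if for all $x\in[-1,1]^m$: 1. for every $R\subseteq\Lambda$, $\lim_{t\to\infty}e^{t\mathcal L_R(x)}(\rho^*\otimes\omega^*)=\rho_\infty^R(x)\otimes\omega_\infty^R(x)$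 for some density matrices, with $\rho_\infty^\emptyset(x)=\rho^*$; write $\rho_\infty(x)=\rho_\infty^\Lambda(x)$, $\omega_\infty(x)=\omega_\infty^\Lambda(x)$; 2. $\rho_\infty(x)\otimes\omega_\infty(x)$ is the unique steady state of $\mathcal L(x)$: $e^{t\mathcal L(x)}(\rho)$ converges to it for every density matrix $\rho$; 3. $\|e^{t\mathcal L(x)}(\rho^*\otimes\omega^*)-\rho_\infty(x)\otimes\omega_\infty(x)\|_1\le a\,n^\kappa e^{-gt}$ for $t\ge0$, and some local Lindbladian of range $r_0$ and strength $J$ (with its own ancillas) drives $\rho_\infty(x)$ back to $\rho^*$ with the same bound; 4. (compatibility) for $A\subseteq R\subseteq\Lambda$ with $A$ not meeting the boundary of $R$, and for every $W\supseteq R$ such that $R$ does not meet the boundary of $W$, as well as for $W=\emptyset$, the reduction of $e^{t\mathcal L_R(x)}(\rho_\infty^W(x)\otimes\omega^*)-\rho_\infty^R(x)\otimes\omega_\infty^R(x)$ to the qubits in $A$ has trace norm at most $a|R|^\kappa e^{-gt}$ for $t\ge0$. **Samples and estimator.** A sample is a pair $(Y,\tilde\rho)$: $Y$ is uniform on $[-1,1]^m$,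 and $\tilde\rho=\bigotimes_j(3|z_j\rangle\langle z_j|-1)$ is the classical shadow obtained by measuring every qubit of one copy of $\rho_\infty(Y)$ in an independent uniformly random Pauli basis, with resulting eigenstates $|z_j\rangle$. Let $(Y_1,\tilde\rho_1),\dots,(Y_N,\tilde\rho_N)$ be independent samples. Let $O=\sum_{i=1}^MO_i$ with $O_i$ Hermitian and supported on $S_i\subseteq\Lambda$, where each $S_i$ lies in a cube with $k_0$ sites along each axis. For $r\in\mathbb N$ let $x|_{S_i(r)}$ be the list of those $x_j$ for which $b_j(r_0)$ meets $S_i(r)=\{u:\operatorname{dist}(u,S_i)\le r\}$. Set $$\tilde f_O(x)=\sum_{i=1}^M\frac1{|\Gamma_i(x)|}\sum_{k\in\Gamma_i(x)}\operatorname{tr}[O_i\tilde\rho_k],\qquad \Gamma_i(x)=\{k:\|x|_{S_i(r)}-Y_k|_{S_i(r)}\|_\infty\le\gamma\}.$$ **Theorem (Learning steady-state phases).** There are constants $\xi,c'>0$, depending only on $D,r_0,k_0,\ell,J,a,\kappa,g$, such that for every $L$, every steady-state phase as above, all $O_i,S_i$ as above, and all $\epsilon,\delta,\delta'\in(0,1)$,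 the following holds with $$r=\Big\lceil2\xi\log\Big(\frac{4c'k_0^DJ(D-1)!(2\xi)^{D-1}D^{D-1}}{\epsilon\,e^{1/2\xi}(1-e^{-1/2\xi})}\Big)\Big\rceil,\quad \gamma=\frac{\epsilon}{2[2(r+k_0)]^DJ\ell},\quad q=\frac{8\cdot12^{k_0}}{3\epsilon^2}\log\Big(\frac{n^{k_0}2^{k_0+1}}{\delta'}\Big)$$ (where a negative value of $r$ is replaced by $0$). If the number of samples satisfies $$N\ \ge\ N_0:=q\Big(\frac\gamma2\Big)^{-[2(r+r_0+k_0)]^D\ell}\Big(\log\frac M\delta+\log\Big(\frac2\gamma\Big)^{[2(r+r_0+k_0)]^D\ell}\Big),$$ then with probability at least $(1-\delta)(1-\delta')$, $$\sup_{x\in[-1,1]^m}\big|\operatorname{tr}[O\rho_\infty(x)]-\tilde f_O(x)\big|\le\epsilon\sum_{i=1}^M\|O_i\|_\infty .$$ Moreover $N_0=O\big(\log(n/\delta')\log(M/\delta)\,e^{\operatorname{polylog}(1/\epsilon)}\big)$: there are $C,p$ depending only on the same constants with $N_0\le C\log(n/\delta')\log(M/\delta)\exp\big(C(1+\log(1/\epsilon))^p\big)$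 for all $n=(2L+1)^D$, $M\ge1$, $\epsilon\in(0,1)$ and $\delta,\delta'\in(0,1/2]$. -/

import Mathlib

open scoped Kronecker Topology ComplexOrder

noncomputable section

namespace SteadyPhase

/-! ### Lattice geometry -/

/-- The sites of the lattice `[-L, L]^D`; every axis carries `2 L + 1` points. -/
abbrev Site (D L : ℕ) : Type := Fin D → Fin (2 * L + 1)

/-- Distance of two points of one axis: `|a - b|` for open boundary conditions (`per = false`), and
the distance on the cycle of length `2 L + 1` for periodic ones (`per = true`). -/
def axisDist {L : ℕ} (per : Bool) (a b : Fin (2 * L + 1)) : ℕ :=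
  if per then min (((a : ℤ) - (b : ℤ)).natAbs) (2 * L + 1 - ((a : ℤ) - (b : ℤ)).natAbs)
  else ((a : ℤ) - (b : ℤ)).natAbs

/-- The maximum distance on the lattice. -/
def siteDist {D L : ℕ} (per : Bool) (u v : Site D L) : ℕ :=
  Finset.univ.sup fun i => axisDist per (u i) (v i)

/-- The ball `b_u(r)`. -/
def ball {D L : ℕ} (per : Bool) (u : Site D L) (r : ℕ) : Set (Site D L) :=
  {v | siteDist per u v ≤ r}

/-- The enlargement `S(r)` of a region: all sites at distance at most `r` from `S`. -/
def enlarge {D L : ℕ} (per : Bool) (S : Set (Site D L)) (r : ℕ) : Set (Site D L) :=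
  {u | ∃ v ∈ S, siteDist per u v ≤ r}

/-- The sites of `R` that are not on the boundary of `R` (no neighbour lies outside `R`). -/
def bulk {D L : ℕ} (per : Bool) (R : Set (Site D L)) : Set (Site D L) :=
  {u | ∀ v, siteDist per u v ≤ 1 → v ∈ R}

/-- `S` is contained in a ball (for the maximum distance: a cube) of diameter `k`, that is, with
`k` sites along each axis. -/
def FitsInCube {D L : ℕ} (per : Bool) (k : ℕ) (S : Set (Site D L)) : Prop :=
  ∃ c : Site D L, ∀ u ∈ S, ∀ i, ∃ s < k,
    (u i : ℕ) = if per then ((c i : ℕ) + s) % (2 * L + 1) else (c i : ℕ) + s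

/-! ### Matrices, states, norms -/

/-- Computational basis of the `n` qubits. -/
abbrev Conf (D L : ℕ) : Type := Site D L → Fin 2

/-- Basis of an ancillary system with a `b j`-dimensional ancilla located at each site `j`
(`b j = 1`: no ancilla at `j`). -/
abbrev Anc {D L : ℕ} (b : Site D L → ℕ) : Type := ∀ j, Fin (b j)

/-- Basis of the joint system. -/
abbrev Joint {D L : ℕ} (b : Site D L → ℕ) : Type := Conf D L × Anc b

/-- The local degrees of freedom (qubit and ancilla) of a joint basis vector. -/
def Joint.coord {D L : ℕ} {b : Site D L → ℕ} (s : Joint b) (j : Site D L) : Fin 2 × Fin (b j) :=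
  (s.1 j, s.2 j)

/-- `A = A_S ⊗ 1` for some `A_S` acting on the sites of `S`. The map `c` reads off the local degrees
of freedom of a basis vector. -/
def SupportedOn {V I : Type*} {α : V → Type*} (c : I → ∀ v, α v) (S : Set V)
    (A : Matrix I I ℂ) : Prop :=
  (∀ σ τ, (∃ v, v ∉ S ∧ c σ v ≠ c τ v) → A σ τ = 0) ∧
  ∀ σ τ σ' τ', (∀ v ∈ S, c σ v = c σ' v) → (∀ v ∈ S, c τ v = c τ' v) →
    (∀ v, v ∉ S → c σ v = c τ v) → (∀ v, v ∉ S → c σ' v = c τ' v) → A σ τ = A σ' τ'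

/-- An operator on the qubits that acts only on the sites of `S`. -/
def QubitSupportedOn {D L : ℕ} (S : Set (Site D L)) (A : Matrix (Conf D L) (Conf D L) ℂ) : Prop :=
  SupportedOn (fun s : Conf D L => s) S A

/-- Density matrices. -/
def IsDensity {I : Type*} [Fintype I] (ρ : Matrix I I ℂ) : Prop :=
  ρ.PosSemidef ∧ ρ.trace = 1

/-- The Schatten norm `‖X‖₁`, the sum of the singular values. -/
def traceNorm {I : Type*} [Fintype I] [DecidableEq I] (X : Matrix I I ℂ) : ℝ :=
  ∑ i, √((Matrix.isHermitian_conjTranspose_mul_self X).eigenvalues i)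

/-- The operator norm `‖X‖_∞`. -/
def opNorm {I : Type*} [Fintype I] [DecidableEq I] (X : Matrix I I ℂ) : ℝ :=
  ‖Matrix.toEuclideanCLM (n := I) (𝕜 := ℂ) X‖

/-! ### Superoperators and Lindbladians -/

/-- Superoperators. -/
abbrev SuperOp (I : Type*) : Type _ := Matrix I I ℂ →ₗ[ℂ] Matrix I I ℂ

/-- `T ⊗ id` on matrices with an additional `k`-dimensional factor. -/
def amplify {I : Type*} (T : SuperOp I) (k : ℕ) (X : Matrix (I × Fin k) (I × Fin k) ℂ) :
    Matrix (I × Fin k) (I × Fin k) ℂ :=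
  Matrix.of fun p q => T (Matrix.of fun i j => X (i, p.2) (j, q.2)) p.1 q.1

/-- `‖T‖_{1 → 1, cb} ≤ J`. -/
def CbNormLE {I : Type*} [Fintype I] [DecidableEq I] (T : SuperOp I) (J : ℝ) : Prop :=
  ∀ (k : ℕ) (X : Matrix (I × Fin k) (I × Fin k) ℂ),
    traceNorm (amplify T k X) ≤ J * traceNorm X

/-- `T` is a Lindbladian `ρ ↦ i[ρ, H] + ∑ₖ (Kₖ ρ Kₖ* - ½ {Kₖ* Kₖ, ρ})` on the joint system, whose
Hamiltonian and Lindblad operators act only on the sites of `S`. -/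
def IsLindbladianOn {D L : ℕ} {b : Site D L → ℕ} (S : Set (Site D L))
    (T : SuperOp (Joint b)) : Prop :=
  ∃ (H : Matrix (Joint b) (Joint b) ℂ) (p : ℕ) (K : Fin p → Matrix (Joint b) (Joint b) ℂ),
    H.IsHermitian ∧ SupportedOn Joint.coord S H ∧ (∀ k, SupportedOn Joint.coord S (K k)) ∧
    ∀ ρ, T ρ = Complex.I • (ρ * H - H * ρ) +
      ∑ k, (K k * ρ * (K k).conjTranspose -
        (1 / 2 : ℂ) • ((K k).conjTranspose * K k * ρ + ρ * ((K k).conjTranspose * K k)))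

/-- A local term at `j`: a Lindbladian on the ball `b_j(r₀)` of strength at most `J`. -/
def IsLocalTerm {D L : ℕ} {b : Site D L → ℕ} (per : Bool) (r₀ : ℕ) (J : ℝ) (j : Site D L)
    (T : SuperOp (Joint b)) : Prop :=
  IsLindbladianOn (ball per j r₀) T ∧ CbNormLE T J

/-- The evolution `e^{tT}(X)`, as its (always convergent) exponential series. -/
def evolve {I : Type*} (T : SuperOp I) (t : ℝ) (X : Matrix I I ℂ) : Matrix I I ℂ :=
  ∑' k : ℕ, ((t ^ k / (k.factorial : ℝ) : ℝ) : ℂ) • (T ^ k) X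

/-- `σ` is the unique steady state: every initial density matrix converges to it. -/
def HasUniqueSteadyState {I : Type*} [Fintype I] (T : SuperOp I) (σ : Matrix I I ℂ) : Prop :=
  ∀ ρ, IsDensity ρ → Filter.Tendsto (fun t : ℝ => evolve T t ρ) Filter.atTop (𝓝 σ)

/-- `T` drives `ρ₀` fast to `ρ₁`, with ancillas going from `ω₀` to `ω₁`:
`‖e^{tT}(ρ₀ ⊗ ω₀) - ρ₁ ⊗ ω₁‖₁ ≤ a n^κ e^{-g t}`. -/
def DrivesFast {D L : ℕ} {b : Site D L → ℕ} (a : ℝ) (κ : ℕ) (g : ℝ) (T : SuperOp (Joint b))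
    (ρ₀ : Matrix (Conf D L) (Conf D L) ℂ) (ω₀ : Matrix (Anc b) (Anc b) ℂ)
    (ρ₁ : Matrix (Conf D L) (Conf D L) ℂ) (ω₁ : Matrix (Anc b) (Anc b) ℂ) : Prop :=
  ∀ t : ℝ, 0 ≤ t → traceNorm (evolve T t (ρ₀ ⊗ₖ ω₀) - ρ₁ ⊗ₖ ω₁) ≤
    a * (Fintype.card (Site D L) : ℝ) ^ κ * Real.exp (-g * t)

/-! ### Steady-state phases -/

/-- Parameters: `x j ∈ ℝ^ℓ` for each site `j`. -/
abbrev Param (D L ℓ : ℕ) : Type := Site D L → Fin ℓ → ℝ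

/-- The parameter space `[-1, 1]^m`, `m = n ℓ`. -/
def cube (D L ℓ : ℕ) : Set (Param D L ℓ) := Set.Icc (-1) 1

/-- The data of a parameterised family of local Lindbladians with a reference point. -/
structure Family (D L ℓ : ℕ) where
  /-- boundary conditions: periodic or open -/
  per : Bool
  /-- dimensions of the ancillas -/
  b : Site D L → ℕ
  /-- constant part of the local term at `j` -/
  base : Site D L → SuperOp (Joint b)
  /-- the linear dependence of the local term at `j` on its `ℓ` parameters -/
  dir : Site D L → Fin ℓ → SuperOp (Joint b)
  /-- local terms of the Lindbladian `L'` whose steady state is the reference state -/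
  refTerm : Site D L → SuperOp (Joint b)
  /-- reference state of the qubits -/
  refState : Matrix (Conf D L) (Conf D L) ℂ
  /-- reference state of the ancillas -/
  refAnc : Matrix (Anc b) (Anc b) ℂ
  /-- `ρ_∞^R(x)`, the qubit part of the limit of the evolution with parameters `x` inside `R` -/
  limState : Set (Site D L) → Param D L ℓ → Matrix (Conf D L) (Conf D L) ℂ
  /-- the ancilla part of that limit -/
  limAnc : Set (Site D L) → Param D L ℓ → Matrix (Anc b) (Anc b) ℂ

namespace Family

variable {D L ℓ : ℕ} (P : Family D L ℓ)

/-- The local term `L_j(y)`, `y ∈ [-1, 1]^ℓ`. -/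
def term (j : Site D L) (y : Fin ℓ → ℝ) : SuperOp (Joint P.b) :=
  P.base j + ∑ i, ((y i : ℝ) : ℂ) • P.dir j i

/-- The Lindbladian `L(x) = ∑_j L_j(x_j)`. -/
def gen (x : Param D L ℓ) : SuperOp (Joint P.b) := ∑ j, P.term j (x j)

open Classical in
/-- The Lindbladian `L_R(x)`: the terms of `L(x)` supported in `R`, and the terms of `L'`
elsewhere. -/
def mixedGen (r₀ : ℕ) (R : Set (Site D L)) (x : Param D L ℓ) : SuperOp (Joint P.b) :=
  ∑ j, if ball P.per j r₀ ⊆ R then P.term j (x j) else P.refTerm j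

/-- The steady states `ρ_∞(x)` of the phase. -/
def steady (x : Param D L ℓ) : Matrix (Conf D L) (Conf D L) ℂ := P.limState Set.univ x

/-- The family describes a steady-state phase, with interaction range `r₀`, strength `J`,
mixing rate `g` and polynomial prefactors `a (·)^κ`. -/
structure IsSteadyStatePhase (r₀ : ℕ) (J a : ℝ) (κ : ℕ) (g : ℝ) : Prop where
  /-- the reference states are states -/
  density_ref : IsDensity P.refState ∧ IsDensity P.refAnc
  /-- `L(x)` is a local Lindbladian -/
  local_term : ∀ j, ∀ y ∈ Set.Icc (-1 : Fin ℓ → ℝ) 1, IsLocalTerm P.per r₀ J j (P.term j y)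
  /-- `L'` is a local Lindbladian -/
  local_ref : ∀ j, IsLocalTerm P.per r₀ J j (P.refTerm j)
  /-- `limState` and `limAnc` are states -/
  density_lim : ∀ R, ∀ x ∈ cube D L ℓ, IsDensity (P.limState R x) ∧ IsDensity (P.limAnc R x)
  /-- `lim e^{t L_R(x)}(ρ* ⊗ ω*) = ρ_∞^R(x) ⊗ ω_∞^R(x)` -/
  tendsto_lim : ∀ R, ∀ x ∈ cube D L ℓ,
    Filter.Tendsto (fun t : ℝ => evolve (P.mixedGen r₀ R x) t (P.refState ⊗ₖ P.refAnc))
      Filter.atTop (𝓝 (P.limState R x ⊗ₖ P.limAnc R x))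
  /-- the reference state is the steady state of `L'` (`R = ∅`) -/
  lim_empty : ∀ x ∈ cube D L ℓ, P.limState ∅ x = P.refState
  /-- `ρ_∞(x)` (with its ancillas) is the unique steady state of `L(x)` -/
  unique_steady : ∀ x ∈ cube D L ℓ,
    HasUniqueSteadyState (P.gen x) (P.steady x ⊗ₖ P.limAnc Set.univ x)
  /-- the reference state is driven fast to `ρ_∞(x)` by `L(x)` -/
  drives_to : ∀ x ∈ cube D L ℓ,
    DrivesFast a κ g (P.gen x) P.refState P.refAnc (P.steady x) (P.limAnc Set.univ x)
  /-- `ρ_∞(x)` is driven fast back to the reference state by some local Lindbladian -/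
  drives_back : ∀ x ∈ cube D L ℓ, ∃ (b' : Site D L → ℕ) (back : Site D L → SuperOp (Joint b'))
    (ω₀ ω₁ : Matrix (Anc b') (Anc b') ℂ), IsDensity ω₀ ∧ IsDensity ω₁ ∧
      (∀ j, IsLocalTerm P.per r₀ J j (back j)) ∧
      DrivesFast a κ g (∑ j, back j) (P.steady x) ω₀ P.refState ω₁
  /-- compatibility of system sizes: for `A ⊆ R` away from the boundary of `R`, started from
  `ρ_∞^W(x)` with `R ⊆ W` away from the boundary of `W`, or from the reference state (`W = ∅`), the
  evolution under `L_R(x)` approaches `ρ_∞^R(x)` on the qubits in `A` in trace norm (tested by all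
  operators `O` on `A`) at rate `g`, with a prefactor polynomial in `|R|` -/
  compatible : ∀ x ∈ cube D L ℓ, ∀ A R W : Set (Site D L), A ⊆ bulk P.per R →
    (R ⊆ bulk P.per W ∨ W = ∅) → ∀ O : Matrix (Conf D L) (Conf D L) ℂ, QubitSupportedOn A O →
    ∀ t : ℝ, 0 ≤ t →
      ‖Matrix.trace ((O ⊗ₖ (1 : Matrix (Anc P.b) (Anc P.b) ℂ)) *
          (evolve (P.mixedGen r₀ R x) t (P.limState W x ⊗ₖ P.refAnc) -
            P.limState R x ⊗ₖ P.limAnc R x))‖ ≤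
        a * (R.ncard : ℝ) ^ κ * Real.exp (-g * t) * opNorm O

end Family

/-! ### Classical shadows -/

/-- Result of a randomised single-qubit Pauli measurement of all qubits: for each qubit the measured
Pauli matrix and the observed eigenvalue. -/
abbrev Outcome (D L : ℕ) : Type := Site D L → Fin 3 × Fin 2

/-- The Pauli matrices `X`, `Y`, `Z`. -/
def pauli : Fin 3 → Matrix (Fin 2) (Fin 2) ℂ :=
  ![!![0, 1; 1, 0], !![0, -Complex.I; Complex.I, 0], !![1, 0; 0, -1]]

/-- The projection `|z⟩⟨z|` onto one of `|+⟩, |-⟩, |+i⟩, |-i⟩, |0⟩, |1⟩`, the eigenvector of the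
given Pauli matrix for the eigenvalue `(-1)^e`. -/
def eigenProj (s : Fin 3 × Fin 2) : Matrix (Fin 2) (Fin 2) ℂ :=
  (1 / 2 : ℂ) • (1 + ((-1 : ℂ) ^ (s.2 : ℕ)) • pauli s.1)

/-- Tensor product of single-qubit matrices. -/
def tensor {D L : ℕ} (A : Site D L → Matrix (Fin 2) (Fin 2) ℂ) :
    Matrix (Conf D L) (Conf D L) ℂ :=
  Matrix.of fun σ τ => ∏ j, A j (σ j) (τ j)

/-- Probability of an outcome when each qubit of `ρ` is measured in an independent, uniformly
random Pauli basis. -/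
def outcomeProb {D L : ℕ} (ρ : Matrix (Conf D L) (Conf D L) ℂ) (s : Outcome D L) : ℝ :=
  (1 / 3 : ℝ) ^ Fintype.card (Site D L) *
    (Matrix.trace (ρ * tensor fun j => eigenProj (s j))).re

/-- The single-measurement classical shadow `⊗_j (3 |z_j⟩⟨z_j| - 1)`. -/
def shadow {D L : ℕ} (s : Outcome D L) : Matrix (Conf D L) (Conf D L) ℂ :=
  tensor fun j => (3 : ℂ) • eigenProj (s j) - 1

/-- Law of one sample `(Y, s)`: `Y` is uniform on `[-1, 1]^m`, and `s` is the result of measuring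
one copy of the state `ρ Y`. -/
def sampleLaw {D L ℓ : ℕ} (ρ : Param D L ℓ → Matrix (Conf D L) (Conf D L) ℂ) :
    MeasureTheory.Measure (Param D L ℓ × Outcome D L) :=
  ∑ s : Outcome D L,
    ((ProbabilityTheory.cond MeasureTheory.volume (cube D L ℓ)).withDensity
      fun y => ENNReal.ofReal (outcomeProb (ρ y) s)).map fun y => (y, s)

/-! ### The estimator -/

/-- The sites `j` whose local term (on the ball `b_j(r₀)`) meets `S(r)`; the restriction of `x` to
these is `x|_{S(r)}`. -/
def relevantSites {D L : ℕ} (per : Bool) (r₀ r : ℕ) (S : Set (Site D L)) : Set (Site D L) :=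
  {j | (ball per j r₀ ∩ enlarge per S r).Nonempty}

open Classical in
/-- The samples `k` with `‖x|_{S(r)} - Y_k|_{S(r)}‖_∞ ≤ γ`. -/
def selected {D L ℓ N : ℕ} (per : Bool) (r₀ r : ℕ) (γ : ℝ) (S : Set (Site D L))
    (data : Fin N → Param D L ℓ × Outcome D L) (x : Param D L ℓ) : Finset (Fin N) :=
  Finset.univ.filter fun k => ∀ j ∈ relevantSites per r₀ r S, ∀ i, |x j i - (data k).1 j i| ≤ γ

/-- The empirical shadow estimator: the average of `tr[O ρ̃]` over the selected shadows `ρ̃`. -/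
def localEstimate {D L ℓ N : ℕ} (per : Bool) (r₀ r : ℕ) (γ : ℝ) (S : Set (Site D L))
    (O : Matrix (Conf D L) (Conf D L) ℂ) (data : Fin N → Param D L ℓ × Outcome D L)
    (x : Param D L ℓ) : ℂ :=
  ((selected per r₀ r γ S data x).card : ℂ)⁻¹ *
    ∑ k ∈ selected per r₀ r γ S data x, Matrix.trace (O * shadow (data k).2)

/-! ### The parameters of the algorithm -/

/-- `r = ⌈2ξ log(4 c' |A| J (D-1)! (2ξ)^{D-1} D^{D-1} / (ε e^{1/2ξ} (1 - e^{-1/2ξ})))⌉`,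
with `|A| = k₀^D`. -/
def radius (D k₀ : ℕ) (J ξ c' ε : ℝ) : ℕ :=
  ⌈2 * ξ * Real.log (4 * c' * (k₀ : ℝ) ^ D * J * ((D - 1).factorial : ℝ) * (2 * ξ) ^ (D - 1) *
      (D : ℝ) ^ (D - 1) /
    (ε * Real.exp (1 / (2 * ξ)) * (1 - Real.exp (-(1 / (2 * ξ))))))⌉₊

/-- `γ = ε / (2 [2 (r + k₀)]^D J ℓ)`. -/
def resolution (D k₀ ℓ r : ℕ) (J ε : ℝ) : ℝ :=
  ε / (2 * (2 * ((r : ℝ) + k₀)) ^ D * J * ℓ)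

/-- `q = (8 · 12^{k₀} / (3 ε²)) log(n^{k₀} 2^{k₀+1} / δ')`. -/
def shadowCount (n k₀ : ℕ) (ε δ' : ℝ) : ℝ :=
  8 * 12 ^ k₀ / (3 * ε ^ 2) * Real.log ((n : ℝ) ^ k₀ * 2 ^ (k₀ + 1) / δ')

/-- `N = q (γ/2)^{-m} log(M/δ) + q (γ/2)^{-m} log((2/γ)^m)` with `m = [2 (r + r₀ + k₀)]^D ℓ`. -/
def sampleCount (D n k₀ r₀ ℓ M : ℕ) (J ξ c' ε δ δ' : ℝ) : ℝ :=
  let r := radius D k₀ J ξ c' ε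
  let γ := resolution D k₀ ℓ r J ε
  let m := (2 * (r + r₀ + k₀)) ^ D * ℓ
  let q := shadowCount n k₀ ε δ'
  q * ((γ / 2) ^ m)⁻¹ * Real.log (M / δ) + q * ((γ / 2) ^ m)⁻¹ * Real.log ((2 / γ) ^ m)

end SteadyPhase

end

open scoped Kronecker Topology ComplexOrder
noncomputable section
namespace SteadyPhase

/-! The heart is a stability estimate, `exists_local_stability`: if two parameter vectors are
`γ`-close at the sites relevant to `S(r)`, the expectations of an observable on `S` in the two
steady states differ by at most `C (γ + η ^ r) ‖O‖`, where `C` and `η < 1` do not depend on the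
system size.

To prove it, let `ψ k` be the expectation reached from the reference state after time `τ k`, under
the dynamics that uses `x` only inside `S(k + 1)`. Then `ψ 0` is the same for all `x`, and `ψ k`
tends to the steady-state value. The increments are exponentially small in `k`: enlarging the region
is harmless by a Lieb-Robinson bound (`lieb_robinson`), because `τ` is so small that the light cone
grows more slowly than the region, and the extra time is harmless by the compatibility condition.
The increments beyond step `r` give the term `η ^ r`. For the others one needs Lipschitz constants
that are summable in `k`. By Duhamel's formula an increment has, in each single parameter, a
first-order expansion whose quadratic remainder is polynomial in `k`. A small function with
controlled second-order differences has small slope, roughly the square root of its size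
(`norm_sub_le_of_quadratic_expansion`). Hence the slopes still decay exponentially and outweigh the
polynomial number of parameters.

The statistical part uses that `tr[O ρ̃]` is unbiased and bounded by `8 ^ |S| ‖O‖`. The set of
selected samples varies with the continuous variable `x`, so `x` is replaced by a nearby grid point,
and the selected samples are caught between those in two concentric boxes of half-widths `γ - h` and
`γ + h`. These have nearly equal mass, so samples in the shell may be counted at their worst
possible value (`excess`, `abs_average_sub_le`). A Chernoff bound (`pi_sum_excess_nonneg_le`) and a
union bound over grid points, signs and observables finish the argument.

The constants `ξ` and `c'` are free. Taking `ξ = 1 / (2 log (1/η))` makes `η ^ r` comparable to `ε`,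
and a large `c'` makes `r J` exceed any threshold fixed beforehand. The stated exponent exceeds the
number of relevant parameters, which leaves a spare factor `2 / γ` in the sample count; it pays for
the size of the shadows (`union_bound_le`). The failure probability comes out below `δ`, and `1 - δ
≥ (1 - δ) (1 - δ')`. -/

open scoped MatrixOrder Matrix.Norms.L2Operator in
lemma _root_.Matrix.PosSemidef.exists_eq_conjTranspose_mul_self {I : Type*} [Fintype I]
    {A : Matrix I I ℂ} (h : A.PosSemidef) : ∃ B : Matrix I I ℂ, A = B.conjTranspose * B := by
  classical
  exact CStarAlgebra.nonneg_iff_eq_star_mul_self.1 (Matrix.nonneg_iff_posSemidef.2 h)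

/-! ### Trace norm, duality and completely positive maps -/

section TraceNorm

variable {I : Type*} [Fintype I] [DecidableEq I]

local notation "hat" => Matrix.toEuclideanCLM (n := I) (𝕜 := ℂ)

lemma trace_eq_sum_inner (A : Matrix I I ℂ)
    (v : OrthonormalBasis I ℂ (EuclideanSpace ℂ I)) :
    A.trace = ∑ i, inner ℂ (v i) (hat A (v i)) := by
  have h := LinearMap.trace_eq_sum_inner ((hat A : EuclideanSpace ℂ I →L[ℂ] EuclideanSpace ℂ I) :
    EuclideanSpace ℂ I →ₗ[ℂ] EuclideanSpace ℂ I) v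
  have h2 : LinearMap.trace ℂ _ ((hat A : EuclideanSpace ℂ I →L[ℂ] EuclideanSpace ℂ I) :
    EuclideanSpace ℂ I →ₗ[ℂ] EuclideanSpace ℂ I) = A.trace := by
    rw [Matrix.coe_toEuclideanCLM_eq_toEuclideanLin, Matrix.toEuclideanLin,
      Matrix.toLpLin_eq_toLin]
    exact Matrix.trace_toLin_eq A _
  rw [← h2, h]; rfl

lemma inner_toEuclideanCLM_conjTranspose (A : Matrix I I ℂ) (x y : EuclideanSpace ℂ I) :
    inner ℂ x (hat A y) = inner ℂ (hat A.conjTranspose x) y := by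
  rw [← Matrix.star_eq_conjTranspose, map_star, ContinuousLinearMap.star_eq_adjoint,
    ContinuousLinearMap.adjoint_inner_left]

/-- A singular value decomposition `X vᵢ = sᵢ wᵢ`. -/
lemma exists_singular_decomposition (X : Matrix I I ℂ) :
    ∃ (v : OrthonormalBasis I ℂ (EuclideanSpace ℂ I)) (w : I → EuclideanSpace ℂ I) (s : I → ℝ),
      (∀ i, 0 ≤ s i) ∧ ∑ i, s i = traceNorm X ∧ (∀ i, hat X (v i) = (s i : ℂ) • w i) ∧
      (∀ i, ‖w i‖ ≤ 1) ∧ (∀ i, s i ≠ 0 → ‖w i‖ = 1) ∧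
      ∀ x, ∑ i, ‖inner ℂ (w i) x‖ ^ 2 ≤ ‖x‖ ^ 2 := by
  classical
  set hX := Matrix.isHermitian_conjTranspose_mul_self X
  set v := hX.eigenvectorBasis
  set s : I → ℝ := fun i => √(hX.eigenvalues i)
  -- Since `0⁻¹ = 0`, this vector vanishes at singular value `0`. The `w i` are orthonormal only on
  -- the other indices, and Bessel's inequality is all that is retained.
  set w : I → EuclideanSpace ℂ I := fun i => ((s i)⁻¹ : ℂ) • hat X (v i)
  have hnn : ∀ i, 0 ≤ hX.eigenvalues i :=
    fun i => (Matrix.posSemidef_conjTranspose_mul_self X).eigenvalues_nonneg i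
  have hinner : ∀ i j, inner ℂ (hat X (v i)) (hat X (v j)) =
      if i = j then (hX.eigenvalues j : ℂ) else 0 := by
    intro i j
    have h1 : hat (X.conjTranspose * X) (v j) = (hX.eigenvalues j : ℂ) • v j := by
      have := hX.mulVec_eigenvectorBasis j
      ext k
      rw [Matrix.ofLp_toEuclideanCLM]
      exact congrFun this k
    have h2 : hat (X.conjTranspose * X) (v j) =
        ContinuousLinearMap.adjoint (hat X) (hat X (v j)) := by
      rw [map_mul, ← Matrix.star_eq_conjTranspose, map_star]; rfl
    rw [← ContinuousLinearMap.adjoint_inner_right, ← h2, h1, inner_smul_right,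
      orthonormal_iff_ite.1 v.orthonormal]
    split_ifs <;> simp
  have hXv : ∀ i, hat X (v i) = (s i : ℂ) • w i := by
    intro i
    by_cases hs : s i = 0
    · have h0 : hX.eigenvalues i = 0 := (Real.sqrt_eq_zero (hnn i)).1 hs
      have := hinner i i
      rw [h0] at this
      simp only [if_true, Complex.ofReal_zero, inner_self_eq_zero] at this
      rw [this, hs]; simp
    · have : (s i : ℂ) ≠ 0 := by exact_mod_cast hs
      simp only [w, smul_smul]
      rw [mul_inv_cancel₀ this, one_smul]
  have hw : ∀ i j, s i ≠ 0 → s j ≠ 0 → inner ℂ (w i) (w j) = if i = j then (1 : ℂ) else 0 := by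
    intro i j hi hj
    simp only [w, inner_smul_left, inner_smul_right, hinner]
    split_ifs with h
    · subst h
      have h3 : (hX.eigenvalues i : ℂ) = (s i : ℂ) * s i := by
        rw [← Complex.ofReal_mul]; congr 1; exact (Real.mul_self_sqrt (hnn i)).symm
      have : (s i : ℂ) ≠ 0 := by exact_mod_cast hi
      rw [h3]; simp [this]
    · simp
  have hw0 : ∀ i, s i = 0 → w i = 0 := by intro i hi; simp [w, hi]
  have hw1 : ∀ i, s i ≠ 0 → ‖w i‖ = 1 := by
    intro i hi
    have := hw i i hi hi
    rw [if_pos rfl, inner_self_eq_norm_sq_to_K] at this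
    have h2 : ‖w i‖ ^ 2 = 1 := by
      have h3 : ((‖w i‖ ^ 2 : ℝ) : ℂ) = ((1 : ℝ) : ℂ) := by push_cast; exact this
      exact Complex.ofReal_injective h3
    nlinarith [norm_nonneg (w i)]
  refine ⟨v, w, s, fun i => Real.sqrt_nonneg _, rfl, hXv, ?_, hw1, ?_⟩
  · intro i
    by_cases hs : s i = 0
    · rw [hw0 i hs]; simp
    · exact (hw1 i hs).le
  · intro x
    have ho : Orthonormal ℂ (fun i : {i // s i ≠ 0} => w i) := by
      rw [orthonormal_iff_ite]
      intro i j
      rw [hw i j i.2 j.2]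
      simp [Subtype.ext_iff]
    have := ho.sum_inner_products_le x (s := Finset.univ)
    refine le_trans (le_of_eq ?_) this
    rw [← Finset.sum_subtype (Finset.univ.filter fun i => s i ≠ 0) (by simp)
      (fun i => ‖inner ℂ (w i) x‖ ^ 2)]
    symm
    apply Finset.sum_subset (Finset.subset_univ _)
    intro i _ hi
    have : s i = 0 := by simpa using hi
    rw [hw0 i this]; simp

lemma traceNorm_nonneg (X : Matrix I I ℂ) : 0 ≤ traceNorm X :=
  Finset.sum_nonneg fun _ _ => Real.sqrt_nonneg _

lemma opNorm_nonneg (X : Matrix I I ℂ) : 0 ≤ opNorm X := norm_nonneg _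

/-- Duality of the trace norm and the operator norm. -/
lemma norm_trace_mul_le (A X : Matrix I I ℂ) :
    ‖(A * X).trace‖ ≤ opNorm A * traceNorm X := by
  obtain ⟨v, w, s, hs, hsum, hX, hw, -, -⟩ := exists_singular_decomposition X
  rw [trace_eq_sum_inner _ v, ← hsum, Finset.mul_sum]
  refine (norm_sum_le _ _).trans (Finset.sum_le_sum fun i _ => ?_)
  rw [map_mul]
  change ‖inner ℂ (v i) (hat A (hat X (v i)))‖ ≤ _
  rw [hX, map_smul, inner_smul_right, norm_mul, Complex.norm_real, Real.norm_of_nonneg (hs i),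
    mul_comm]
  refine mul_le_mul_of_nonneg_right ?_ (hs i)
  calc ‖inner ℂ (v i) (hat A (w i))‖ ≤ ‖v i‖ * ‖hat A (w i)‖ := norm_inner_le_norm _ _
    _ ≤ 1 * (‖hat A‖ * 1) := by
      rw [v.orthonormal.1 i]
      gcongr
      exact ((hat A).le_opNorm _).trans (by gcongr; exact hw i)
    _ = opNorm A := by rw [one_mul, mul_one]; rfl

/-- The maximiser is the partial isometry taking each `w i` back to `v i`. It exhibits the trace
norm as a supremum of linear functionals, from which its triangle inequality and all later upper
bounds follow. -/
lemma exists_opNorm_le_one_trace_mul_eq (X : Matrix I I ℂ) :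
    ∃ A : Matrix I I ℂ, opNorm A ≤ 1 ∧ (A * X).trace = traceNorm X := by
  obtain ⟨v, w, s, hs, hsum, hX, hw, hw1, hb⟩ := exists_singular_decomposition X
  set T : EuclideanSpace ℂ I →L[ℂ] EuclideanSpace ℂ I :=
    ∑ i, (innerSL ℂ (w i)).smulRight (v i) with hT
  have hTx : ∀ x, T x = ∑ i, inner ℂ (w i) x • v i := by
    intro x; simp [hT]
  refine ⟨(Matrix.toEuclideanCLM (n := I) (𝕜 := ℂ)).symm T, ?_, ?_⟩
  · unfold opNorm
    rw [StarAlgEquiv.apply_symm_apply]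
    refine ContinuousLinearMap.opNorm_le_bound _ zero_le_one fun x => ?_
    rw [one_mul]
    refine abs_le_of_sq_le_sq' ?_ (norm_nonneg _) |>.2
    rw [hTx, ← v.sum_sq_norm_inner_right]
    refine le_trans (le_of_eq (Finset.sum_congr rfl fun i _ => ?_)) (hb x)
    rw [v.orthonormal.inner_right_fintype]
  · rw [trace_eq_sum_inner _ v, ← hsum, Complex.ofReal_sum]
    refine Finset.sum_congr rfl fun i _ => ?_
    rw [map_mul, StarAlgEquiv.apply_symm_apply]
    change inner ℂ (v i) (T (hat X (v i))) = _
    rw [hX, map_smul, inner_smul_right, hTx, v.orthonormal.inner_right_fintype]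
    by_cases h : s i = 0
    · simp [h]
    · rw [inner_self_eq_norm_sq_to_K, hw1 i h]; simp

lemma traceNorm_le_of_forall {X : Matrix I I ℂ} {C : ℝ}
    (h : ∀ A : Matrix I I ℂ, opNorm A ≤ 1 → ‖(A * X).trace‖ ≤ C) : traceNorm X ≤ C := by
  obtain ⟨A, hA, hX⟩ := exists_opNorm_le_one_trace_mul_eq X
  have := h A hA
  rwa [hX, Complex.norm_real, Real.norm_of_nonneg (traceNorm_nonneg X)] at this

lemma traceNorm_add_le (X Y : Matrix I I ℂ) :
    traceNorm (X + Y) ≤ traceNorm X + traceNorm Y := by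
  refine traceNorm_le_of_forall fun A hA => ?_
  rw [Matrix.mul_add, Matrix.trace_add]
  refine (norm_add_le _ _).trans (add_le_add ?_ ?_)
  · exact (norm_trace_mul_le A X).trans (mul_le_of_le_one_left (traceNorm_nonneg _) hA)
  · exact (norm_trace_mul_le A Y).trans (mul_le_of_le_one_left (traceNorm_nonneg _) hA)

lemma traceNorm_smul_le (c : ℂ) (X : Matrix I I ℂ) :
    traceNorm (c • X) ≤ ‖c‖ * traceNorm X := by
  refine traceNorm_le_of_forall fun A hA => ?_
  rw [Matrix.mul_smul, Matrix.trace_smul, norm_smul]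
  refine mul_le_mul_of_nonneg_left ?_ (norm_nonneg _)
  exact (norm_trace_mul_le A X).trans (mul_le_of_le_one_left (traceNorm_nonneg _) hA)

lemma traceNorm_zero : traceNorm (0 : Matrix I I ℂ) = 0 :=
  le_antisymm (by simpa using traceNorm_smul_le 0 (0 : Matrix I I ℂ)) (traceNorm_nonneg _)

lemma eq_zero_of_traceNorm_eq_zero {X : Matrix I I ℂ} (h : traceNorm X = 0) : X = 0 := by
  have h1 : ∀ A : Matrix I I ℂ, (A * X).trace = 0 := fun A => by
    have := norm_trace_mul_le A X
    rw [h, mul_zero] at this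
    exact norm_le_zero_iff.1 this
  have := h1 X.conjTranspose
  exact Matrix.trace_conjTranspose_mul_self_eq_zero_iff.1 this

/-- A completely positive map with Kraus operators `Aₖ` with `∑ₖ Aₖ* Aₖ ≤ c` has norm at most `c`
with respect to the trace norm. -/
lemma traceNorm_sum_conj_le {K : Type*} [Fintype K] (A : K → Matrix I I ℂ) {c : ℝ}
    (hc : ∀ x : EuclideanSpace ℂ I, ∑ k, ‖hat (A k) x‖ ^ 2 ≤ c * ‖x‖ ^ 2) (X : Matrix I I ℂ) :
    traceNorm (∑ k, A k * X * (A k).conjTranspose) ≤ c * traceNorm X := by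
  refine traceNorm_le_of_forall fun B hB => ?_
  obtain ⟨v, w, s, hs, hsum, hX, hw, -, -⟩ := exists_singular_decomposition X
  have h1 : (B * ∑ k, A k * X * (A k).conjTranspose).trace =
      ∑ i, ∑ k, (s i : ℂ) * inner ℂ (hat (A k) (v i)) (hat B (hat (A k) (w i))) := by
    rw [Finset.sum_comm, Finset.mul_sum, Matrix.trace_sum]
    refine Finset.sum_congr rfl fun k _ => ?_
    rw [← Matrix.mul_assoc, Matrix.trace_mul_comm, trace_eq_sum_inner _ v]
    refine Finset.sum_congr rfl fun i _ => ?_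
    rw [map_mul, ← Matrix.star_eq_conjTranspose, map_star, map_mul, map_mul]
    change inner ℂ (v i) (ContinuousLinearMap.adjoint (hat (A k))
      (hat B (hat (A k) (hat X (v i))))) = _
    rw [ContinuousLinearMap.adjoint_inner_right, hX, map_smul, map_smul, inner_smul_right]
  rw [h1, ← hsum, Finset.mul_sum]
  refine (norm_sum_le _ _).trans (Finset.sum_le_sum fun i _ => ?_)
  rw [← Finset.mul_sum, norm_mul, Complex.norm_real, Real.norm_of_nonneg (hs i), mul_comm]
  refine mul_le_mul_of_nonneg_right ?_ (hs i)
  have hB' : ∀ x, ‖hat B x‖ ≤ ‖x‖ := fun x =>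
    ((hat B).le_opNorm x).trans (mul_le_of_le_one_left (norm_nonneg _) hB)
  -- AM-GM decouples `v i` from `w i`, so that the Kraus bound applies to each of these vectors of
  -- norm at most one.
  calc ‖∑ k, inner ℂ (hat (A k) (v i)) (hat B (hat (A k) (w i)))‖
      ≤ ∑ k, (‖hat (A k) (v i)‖ ^ 2 + ‖hat (A k) (w i)‖ ^ 2) / 2 := by
        refine (norm_sum_le _ _).trans (Finset.sum_le_sum fun k _ => ?_)
        have h2 : ‖inner ℂ (hat (A k) (v i)) (hat B (hat (A k) (w i)))‖ ≤
            ‖hat (A k) (v i)‖ * ‖hat (A k) (w i)‖ :=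
          (norm_inner_le_norm _ _).trans (by gcongr; exact hB' _)
        nlinarith [sq_nonneg (‖hat (A k) (v i)‖ - ‖hat (A k) (w i)‖)]
    _ ≤ c := by
        rw [← Finset.sum_div, Finset.sum_add_distrib]
        have h3 := hc (v i)
        have h4 := hc (w i)
        rw [v.orthonormal.1 i] at h3
        have h5 : 0 ≤ c := by
          have : (0 : ℝ) ≤ ∑ k, ‖hat (A k) (v i)‖ ^ 2 := by positivity
          linarith
        have h6 : c * ‖w i‖ ^ 2 ≤ c * 1 :=
          mul_le_mul_of_nonneg_left (pow_le_one₀ (norm_nonneg _) (hw i)) h5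
        linarith

/-- Writing `ρ = B* B` turns `tr (A ρ)` into a sum of expectation values of `A` in the vectors `B*
eᵢ`, whose squared norms add up to `tr ρ = 1`. -/
lemma traceNorm_le_one_of_isDensity {ρ : Matrix I I ℂ} (h : IsDensity ρ) : traceNorm ρ ≤ 1 := by
  obtain ⟨B, hB⟩ := h.1.exists_eq_conjTranspose_mul_self
  refine traceNorm_le_of_forall fun A hA => ?_
  set e := EuclideanSpace.basisFun I ℂ
  have hA' : ∀ x, ‖hat A x‖ ≤ ‖x‖ := fun x =>
    ((hat A).le_opNorm x).trans (mul_le_of_le_one_left (norm_nonneg _) hA)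
  have h1 : ∀ A : Matrix I I ℂ, (A * ρ).trace = ∑ i, inner ℂ (hat B.conjTranspose (e i))
      (hat A (hat B.conjTranspose (e i))) := by
    intro A
    rw [hB, ← Matrix.mul_assoc, Matrix.trace_mul_comm, trace_eq_sum_inner _ e]
    refine Finset.sum_congr rfl fun i _ => ?_
    have h3 := inner_toEuclideanCLM_conjTranspose B (e i) (hat A (hat B.conjTranspose (e i)))
    rw [map_mul, map_mul]
    exact h3
  have h2 := h1 1
  rw [one_mul, h.2] at h2
  have h2' : (1 : ℝ) = ∑ i, ‖hat B.conjTranspose (e i)‖ ^ 2 := by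
    have : (1 : ℂ) = ((∑ i, ‖hat B.conjTranspose (e i)‖ ^ 2 : ℝ) : ℂ) := by
      rw [h2, Complex.ofReal_sum]
      refine Finset.sum_congr rfl fun i _ => ?_
      rw [map_one, one_apply_eq_self, inner_self_eq_norm_sq_to_K]; simp
    exact_mod_cast this
  rw [h1, h2']
  refine (norm_sum_le _ _).trans (Finset.sum_le_sum fun i _ => ?_)
  rw [sq]
  exact (norm_inner_le_norm _ _).trans (by gcongr; exact hA' _)

lemma opNorm_le_iff {A : Matrix I I ℂ} {c : ℝ} (hc : 0 ≤ c) :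
    opNorm A ≤ c ↔ ∀ x : I → ℂ, ∑ i, ‖(A.mulVec x) i‖ ^ 2 ≤ c ^ 2 * ∑ i, ‖x i‖ ^ 2 := by
  unfold opNorm
  rw [ContinuousLinearMap.opNorm_le_iff hc]
  constructor
  · intro h x
    have := h (WithLp.toLp 2 x)
    rw [Matrix.toEuclideanCLM_toLp] at this
    have h2 := pow_le_pow_left₀ (norm_nonneg _) this 2
    rw [mul_pow, EuclideanSpace.norm_sq_eq, EuclideanSpace.norm_sq_eq] at h2
    exact h2
  · intro h x
    refine abs_le_of_sq_le_sq' ?_ (by positivity) |>.2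
    rw [mul_pow, EuclideanSpace.norm_sq_eq, EuclideanSpace.norm_sq_eq]
    have := h (WithLp.ofLp x)
    simpa [Matrix.ofLp_toEuclideanCLM] using this

lemma norm_entry_le_opNorm (A : Matrix I I ℂ) (i j : I) : ‖A i j‖ ≤ opNorm A := by
  have h := (opNorm_le_iff (A := A) (opNorm_nonneg A)).1 le_rfl (Pi.single j 1)
  have h1 : ∑ k, ‖(Pi.single j (1 : ℂ) : I → ℂ) k‖ ^ 2 = 1 := by
    rw [Finset.sum_eq_single j] <;> simp +contextual
  rw [h1, mul_one, Matrix.mulVec_single_one] at h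
  have h2 : ‖A i j‖ ^ 2 ≤ ∑ k, ‖A.col j k‖ ^ 2 :=
    Finset.single_le_sum (f := fun k => ‖A.col j k‖ ^ 2) (fun _ _ => by positivity)
      (Finset.mem_univ i)
  exact abs_le_of_sq_le_sq' (h2.trans h) (opNorm_nonneg A) |>.2

end TraceNorm

lemma opNorm_kronecker_one_le {I K : Type*} [Fintype I] [DecidableEq I] [Fintype K] [DecidableEq K]
    (A : Matrix I I ℂ) : opNorm (A ⊗ₖ (1 : Matrix K K ℂ)) ≤ opNorm A := by
  rw [opNorm_le_iff (opNorm_nonneg A)]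
  intro x
  have h0 := (opNorm_le_iff (A := A) (opNorm_nonneg A)).1 le_rfl
  have h1 : ∀ i k, ((A ⊗ₖ (1 : Matrix K K ℂ)).mulVec x) (i, k) =
      (A.mulVec fun j => x (j, k)) i := by
    intro i k
    simp only [Matrix.mulVec, dotProduct, Fintype.sum_prod_type, Matrix.kroneckerMap_apply,
      Matrix.one_apply]
    refine Finset.sum_congr rfl fun j _ => ?_
    simp
  rw [Fintype.sum_prod_type_right, Fintype.sum_prod_type_right, Finset.mul_sum]
  refine Finset.sum_le_sum fun k _ => ?_
  simp_rw [h1]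
  exact h0 _

lemma opNorm_submatrix_equiv_le {I K : Type*} [Fintype I] [DecidableEq I] [Fintype K]
    [DecidableEq K] (e : K ≃ I) (A : Matrix I I ℂ) : opNorm (A.submatrix e e) ≤ opNorm A := by
  rw [opNorm_le_iff (opNorm_nonneg A)]
  intro x
  have h0 := (opNorm_le_iff (A := A) (opNorm_nonneg A)).1 le_rfl (x ∘ e.symm)
  have h1 : (A.submatrix e e).mulVec x = (A.mulVec (x ∘ e.symm)) ∘ e := by
    rw [Matrix.submatrix_mulVec_equiv]
  have h2 := e.sum_comp fun i => ‖(A.mulVec (x ∘ e.symm)) i‖ ^ 2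
  have h3 := e.symm.sum_comp fun k => ‖x k‖ ^ 2
  rw [h1, ← h3]
  exact h2.le.trans h0

lemma traceNorm_submatrix_equiv_le {I K : Type*} [Fintype I] [DecidableEq I] [Fintype K]
    [DecidableEq K] (e : K ≃ I) (X : Matrix I I ℂ) :
    traceNorm (X.submatrix e e) ≤ traceNorm X := by
  refine traceNorm_le_of_forall fun A hA => ?_
  have h : (A * X.submatrix e e).trace = (A.submatrix e.symm e.symm * X).trace := by
    have h2 : A = (A.submatrix e.symm e.symm).submatrix e e := by ext; simp
    conv_lhs => rw [h2, Matrix.submatrix_mul_equiv]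
    simp only [Matrix.trace, Matrix.diag, Matrix.submatrix_apply]
    exact e.sum_comp fun i => (A.submatrix e.symm e.symm * X) i i
  rw [h]
  refine (norm_trace_mul_le _ _).trans ?_
  exact mul_le_of_le_one_left (traceNorm_nonneg _) ((opNorm_submatrix_equiv_le _ _).trans hA)

/-- Amplification by a one-dimensional factor is `T` itself up to a relabelling of the basis. -/
lemma CbNormLE.traceNorm_le {I : Type*} [Fintype I] [DecidableEq I] {T : SuperOp I} {J : ℝ}
    (h : CbNormLE T J) (hJ : 0 ≤ J) (X : Matrix I I ℂ) : traceNorm (T X) ≤ J * traceNorm X := by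
  let e : I × Fin 1 ≃ I := Equiv.prodUnique I (Fin 1)
  have h1 := h 1 (X.submatrix e e)
  have h2 : amplify T 1 (X.submatrix e e) = (T X).submatrix e e := by
    ext p q
    simp only [amplify, Matrix.of_apply, Matrix.submatrix_apply]
    rfl
  have h3 : T X = ((T X).submatrix e e).submatrix e.symm e.symm := by ext; simp
  rw [h2] at h1
  rw [h3]
  refine (traceNorm_submatrix_equiv_le _ _).trans (h1.trans ?_)
  exact mul_le_mul_of_nonneg_left (traceNorm_submatrix_equiv_le _ _) hJ

/-! ### Contraction semigroups and Duhamel's formula -/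

section Semigroup

open NormedSpace MeasureTheory

variable {𝔸 : Type*} [NormedRing 𝔸] [NormedAlgebra ℝ 𝔸]

/-- The logarithmic norm of `A` is at most `0`. -/
def Dissipative (A : 𝔸) : Prop :=
  ∃ C : ℝ, 0 ≤ C ∧ ∀ e : ℝ, 0 ≤ e → e ≤ 1 → ‖1 + e • A‖ ≤ 1 + C * e ^ 2

/-- Up to a term of order `e ^ 2`, `1 + e (A + B)` is the product of `1 + e A` and `1 + e B`.
Stability under sums is the reason for working with this condition: any partial sum of local
Lindbladians generates contractions. -/
lemma Dissipative.add {A B : 𝔸} (hA : Dissipative A) (hB : Dissipative B) :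
    Dissipative (A + B) := by
  obtain ⟨C, hC, h⟩ := hA
  obtain ⟨C', hC', h'⟩ := hB
  refine ⟨C + C' + C * C' + ‖A * B‖, by positivity, fun e he he1 => ?_⟩
  have h1 : 1 + e • (A + B) = (1 + e • A) * (1 + e • B) - (e ^ 2) • (A * B) := by
    rw [add_mul, mul_add, mul_add, smul_mul_smul_comm, smul_add, sq]; simp only [one_mul, mul_one]
    abel
  have h2 : e ^ 2 * e ^ 2 ≤ e ^ 2 :=
    mul_le_of_le_one_left (by positivity) (pow_le_one₀ he he1)
  calc ‖1 + e • (A + B)‖ ≤ ‖(1 + e • A) * (1 + e • B)‖ + ‖(e ^ 2) • (A * B)‖ := by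
        rw [h1]; exact norm_sub_le _ _
    _ ≤ (1 + C * e ^ 2) * (1 + C' * e ^ 2) + e ^ 2 * ‖A * B‖ := by
        refine add_le_add ((norm_mul_le _ _).trans ?_) ?_
        · exact mul_le_mul (h e he he1) (h' e he he1) (norm_nonneg _) (by positivity)
        · rw [norm_smul, Real.norm_of_nonneg (by positivity)]
    _ ≤ _ := by nlinarith [mul_nonneg hC hC']

lemma norm_one_le_of_dissipative {A : 𝔸} (hA : Dissipative A) : ‖(1 : 𝔸)‖ ≤ 1 := by
  obtain ⟨C, hC, h⟩ := hA
  simpa using h 0 le_rfl zero_le_one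

lemma dissipative_zero (h1 : ‖(1 : 𝔸)‖ ≤ 1) : Dissipative (0 : 𝔸) :=
  ⟨0, le_rfl, fun e _ _ => by simpa using h1⟩

lemma dissipative_sum (h1 : ‖(1 : 𝔸)‖ ≤ 1) {ι : Type*} (s : Finset ι) (L : ι → 𝔸)
    (h : ∀ i ∈ s, Dissipative (L i)) : Dissipative (∑ i ∈ s, L i) :=
  Finset.sum_induction L Dissipative (fun _ _ => Dissipative.add) (dissipative_zero h1) h

lemma hasDerivAt_exp_smul (A : 𝔸) [CompleteSpace 𝔸] (t : ℝ) :
    HasDerivAt (fun s : ℝ => exp (s • A)) (exp (t • A) * A) t :=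
  hasDerivAt_exp_smul_const A t

lemma exp_add_smul [CompleteSpace 𝔸] (A : 𝔸) (s t : ℝ) :
    exp ((s + t) • A) = exp (s • A) * exp (t • A) := by
  let _ : NormedAlgebra ℚ 𝔸 := NormedAlgebra.restrictScalars ℚ ℝ 𝔸
  rw [add_smul]
  exact exp_add_of_commute (((Commute.refl A).smul_left s).smul_right t)

lemma continuous_exp_smul [CompleteSpace 𝔸] (A : 𝔸) : Continuous fun s : ℝ => exp (s • A) :=
  continuous_iff_continuousAt.2 fun t => (hasDerivAt_exp_smul A t).continuousAt

lemma exp_natCast_smul [CompleteSpace 𝔸] (A : 𝔸) (n : ℕ) (s : ℝ) :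
    exp ((n * s) • A) = exp (s • A) ^ n := by
  induction n with
  | zero => simp
  | succ n ih => rw [Nat.cast_succ, add_mul, one_mul, exp_add_smul, ih, pow_succ]

/-- A dissipative operator generates a semigroup of contractions. -/
lemma Dissipative.norm_exp_le_one [CompleteSpace 𝔸] {A : 𝔸} (hA : Dissipative A) {t : ℝ}
    (ht : 0 ≤ t) : ‖exp (t • A)‖ ≤ 1 := by
  have h1 := norm_one_le_of_dissipative hA
  obtain ⟨C, hC, h⟩ := hA
  have hpow : ∀ (X : 𝔸) (n : ℕ), ‖X ^ n‖ ≤ ‖X‖ ^ n := fun X n => by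
    induction n with
    | zero => simpa using h1
    | succ n ih =>
      rw [pow_succ, pow_succ]
      exact (norm_mul_le _ _).trans (by gcongr)
  have hder : HasDerivAt (fun s : ℝ => exp (s • A)) A 0 := by
    simpa using hasDerivAt_exp_smul A 0
  -- `‖exp (s A)‖ ≤ 1 + ε s` for small `s`
  refine le_of_forall_pos_le_add fun η hη => ?_
  obtain ⟨ε, hε, hεη⟩ : ∃ ε : ℝ, 0 < ε ∧ Real.exp (ε * t) ≤ 1 + η := by
    -- The denominator `t + 1` instead of `t` covers `t = 0`.
    refine ⟨Real.log (1 + η) / (t + 1), div_pos (Real.log_pos (by linarith)) (by linarith), ?_⟩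
    have h2 : 0 < Real.log (1 + η) := Real.log_pos (by linarith)
    calc Real.exp (Real.log (1 + η) / (t + 1) * t) ≤ Real.exp (Real.log (1 + η)) := by
          apply Real.exp_le_exp.2
          rw [div_mul_eq_mul_div, div_le_iff₀ (by linarith)]
          nlinarith
      _ = 1 + η := Real.exp_log (by linarith)
  have hsmall : ∀ᶠ s : ℝ in 𝓝 0, 0 ≤ s → ‖exp (s • A)‖ ≤ 1 + ε * s := by
    have h3 := hder.isLittleO
    have h4 := h3.bound (half_pos hε)
    have h5 : ∀ᶠ s : ℝ in 𝓝 0, s < min 1 (ε / 2 / (C + 1)) :=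
      Iio_mem_nhds (by positivity)
    filter_upwards [h4, h5] with s hs hs' hs0
    rw [lt_min_iff] at hs'
    simp only [zero_smul, exp_zero, sub_zero] at hs
    have h6 : exp (s • A) = (1 + s • A) + (exp (s • A) - 1 - s • A) := by abel
    have h7 := h s hs0 hs'.1.le
    have h8 : C * s ^ 2 ≤ ε / 2 * s := by
      have : s * (C + 1) ≤ ε / 2 := by
        have := hs'.2; rw [lt_div_iff₀ (by linarith)] at this; exact this.le
      nlinarith
    calc ‖exp (s • A)‖ ≤ ‖1 + s • A‖ + ‖exp (s • A) - 1 - s • A‖ := by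
          conv_lhs => rw [h6]
          exact norm_add_le _ _
      _ ≤ (1 + C * s ^ 2) + ε / 2 * ‖s‖ := add_le_add h7 hs
      _ ≤ 1 + ε * s := by rw [Real.norm_of_nonneg hs0]; linarith
  have hlim : Filter.Tendsto (fun n : ℕ => t / (n : ℝ)) Filter.atTop (𝓝 0) :=
    tendsto_const_div_atTop_nhds_zero_nat t
  obtain ⟨n, hn, hn0⟩ := ((hlim.eventually hsmall).and (Filter.eventually_gt_atTop 0)).exists
  have hnpos : (0 : ℝ) < n := by exact_mod_cast hn0
  have h9 : t = n * (t / n) := by field_simp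
  -- The time is cut into `n` short steps, each with norm at most `1 + ε t / n`.
  calc ‖exp (t • A)‖ = ‖exp ((t / n) • A) ^ n‖ := by rw [← exp_natCast_smul, ← h9]
    _ ≤ (1 + ε * (t / n)) ^ n := (hpow _ n).trans (by gcongr; exact hn (by positivity))
    _ ≤ Real.exp (ε * (t / n)) ^ n := by
        gcongr; linarith [Real.add_one_le_exp (ε * (t / n))]
    _ = Real.exp (ε * t) := by rw [← Real.exp_nat_mul]; congr 1; field_simp
    _ ≤ 1 + η := hεη

/-- Duhamel's formula. -/
lemma exp_mul_sub_mul_exp [CompleteSpace 𝔸] (A B K : 𝔸) (t : ℝ) :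
    exp (t • B) * K - K * exp (t • A) =
      ∫ s in (0 : ℝ)..t, exp (s • B) * (B * K - K * A) * exp ((t - s) • A) := by
  -- The path joins `K exp (t A)` at `s = 0` to `exp (t B) K` at `s = t`. With `K = 1` it compares
  -- two semigroups; with `A` the part of `B` that commutes with `K` it moves `K` across the
  -- evolution.
  have hd : ∀ s ∈ Set.uIcc 0 t, HasDerivAt (fun s : ℝ => exp (s • B) * K * exp ((t - s) • A))
      (exp (s • B) * (B * K - K * A) * exp ((t - s) • A)) s := by
    intro s _
    have h1 := (hasDerivAt_exp_smul B s).mul_const K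
    have h2 : HasDerivAt (fun s : ℝ => exp ((t - s) • A)) (-(exp ((t - s) • A) * A)) s := by
      have := (hasDerivAt_exp_smul A (t - s)).scomp s ((hasDerivAt_id s).const_sub t)
      simpa using! this
    have h3 := h1.mul h2
    refine h3.congr_deriv ?_
    have h4 : exp ((t - s) • A) * A = A * exp ((t - s) • A) := by
      let _ : NormedAlgebra ℚ 𝔸 := NormedAlgebra.restrictScalars ℚ ℝ 𝔸
      exact (((Commute.refl A).smul_right (t - s)).exp_right).eq.symm
    rw [h4]
    noncomm_ring
  have hc : Continuous fun s : ℝ => exp (s • B) * (B * K - K * A) * exp ((t - s) • A) :=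
    ((continuous_exp_smul B).mul continuous_const).mul
      ((continuous_exp_smul A).comp (continuous_const.sub continuous_id))
  rw [intervalIntegral.integral_eq_sub_of_hasDerivAt hd (hc.intervalIntegrable _ _)]
  simp

lemma norm_exp_sub_exp_le [CompleteSpace 𝔸] {A B : 𝔸}
    (hA : ∀ t : ℝ, 0 ≤ t → ‖exp (t • A)‖ ≤ 1) (hB : ∀ t : ℝ, 0 ≤ t → ‖exp (t • B)‖ ≤ 1)
    {t : ℝ} (ht : 0 ≤ t) : ‖exp (t • B) - exp (t • A)‖ ≤ ‖B - A‖ * t := by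
  have h := exp_mul_sub_mul_exp A B 1 t
  simp only [mul_one, one_mul] at h
  rw [h]
  refine (intervalIntegral.norm_integral_le_of_norm_le_const (C := ‖B - A‖) fun s hs => ?_).trans
    (by simp [abs_of_nonneg ht])
  rw [Set.uIoc_of_le ht] at hs
  calc ‖exp (s • B) * (B - A) * exp ((t - s) • A)‖
      ≤ ‖exp (s • B)‖ * ‖B - A‖ * ‖exp ((t - s) • A)‖ :=
        (norm_mul_le _ _).trans (by gcongr; exact norm_mul_le _ _)
    _ ≤ 1 * ‖B - A‖ * 1 := by
        gcongr
        · exact hB s hs.1.le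
        · exact hA _ (by linarith [hs.2])
    _ = ‖B - A‖ := by ring

/-- First-order expansion of the semigroup in an affine parameter. -/
lemma exists_exp_affine_expansion [CompleteSpace 𝔸] {A B : 𝔸}
    (hAB : ∀ h ∈ Set.Icc (-1 : ℝ) 1, ∀ t : ℝ, 0 ≤ t → ‖exp (t • (A + h • B))‖ ≤ 1)
    {t : ℝ} (ht : 0 ≤ t) {h : ℝ} (hh : h ∈ Set.Icc (-1 : ℝ) 1) :
    ∃ Q : 𝔸, ∀ h' ∈ Set.Icc (-1 : ℝ) 1,
      ‖exp (t • (A + h' • B)) - exp (t • (A + h • B)) - (h' - h) • Q‖ ≤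
        (‖B‖ * t) ^ 2 * (h' - h) ^ 2 := by
  set X := A + h • B
  -- The derivative at the base point. The error comes from replacing `exp (s Y)` by `exp (s X)` in
  -- the Duhamel integral, which costs a second factor `|h' - h|`.
  refine ⟨∫ s in (0 : ℝ)..t, exp (s • X) * B * exp ((t - s) • X), fun h' hh' => ?_⟩
  set Y := A + h' • B
  have hYX : Y - X = (h' - h) • B := by simp only [X, Y, sub_smul]; abel
  have h1 := exp_mul_sub_mul_exp X Y 1 t
  simp only [mul_one, one_mul, hYX] at h1
  have hc : ∀ Z : 𝔸, Continuous fun s : ℝ => exp (s • Z) * B * exp ((t - s) • X) := fun Z =>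
    ((continuous_exp_smul Z).mul continuous_const).mul
      ((continuous_exp_smul X).comp (continuous_const.sub continuous_id))
  have h2 : exp (t • Y) - exp (t • X) - (h' - h) • ∫ s in (0 : ℝ)..t,
      exp (s • X) * B * exp ((t - s) • X) =
      (h' - h) • ∫ s in (0 : ℝ)..t, (exp (s • Y) - exp (s • X)) * B * exp ((t - s) • X) := by
    have h3 : ∀ s : ℝ, (exp (s • Y) - exp (s • X)) * B * exp ((t - s) • X) =
        exp (s • Y) * B * exp ((t - s) • X) - exp (s • X) * B * exp ((t - s) • X) := by
      intro s; rw [sub_mul, sub_mul]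
    simp_rw [h3]
    rw [intervalIntegral.integral_sub ((hc Y).intervalIntegrable _ _)
      ((hc X).intervalIntegrable _ _), smul_sub, h1]
    congr 1
    rw [← intervalIntegral.integral_smul]
    congr 1
    funext s
    rw [mul_smul_comm, smul_mul_assoc]
  have hX := hAB h hh
  rw [h2, norm_smul]
  have h5 : ‖∫ s in (0 : ℝ)..t, (exp (s • Y) - exp (s • X)) * B * exp ((t - s) • X)‖ ≤
      (|h' - h| * ‖B‖ * t * ‖B‖) * |t - 0| := by
    refine intervalIntegral.norm_integral_le_of_norm_le_const fun s hs => ?_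
    rw [Set.uIoc_of_le ht] at hs
    calc ‖(exp (s • Y) - exp (s • X)) * B * exp ((t - s) • X)‖
        ≤ ‖exp (s • Y) - exp (s • X)‖ * ‖B‖ * ‖exp ((t - s) • X)‖ :=
          (norm_mul_le _ _).trans (by gcongr; exact norm_mul_le _ _)
      _ ≤ (‖Y - X‖ * s) * ‖B‖ * 1 := by
          have := hs.1.le
          gcongr
          · exact norm_exp_sub_exp_le hX (hAB h' hh') hs.1.le
          · exact hX _ (by linarith [hs.2])
      _ ≤ |h' - h| * ‖B‖ * t * ‖B‖ := by
          rw [hYX, norm_smul, mul_one, Real.norm_eq_abs]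
          gcongr
          exact hs.2
  calc ‖h' - h‖ * _ ≤ |h' - h| * ((|h' - h| * ‖B‖ * t * ‖B‖) * |t - 0|) := by
        rw [Real.norm_eq_abs]; gcongr
    _ = (‖B‖ * t) ^ 2 * (h' - h) ^ 2 := by
        rw [sub_zero, abs_of_nonneg ht, ← sq_abs (h' - h)]; ring

/-! ### The Lieb-Robinson bound -/

section LiebRobinson

variable [CompleteSpace 𝔸] {W : Type*} [NormedAddCommGroup W] [NormedSpace ℝ W]
  {ι : Type*} [Fintype ι] [DecidableEq ι] {L : ι → 𝔸} {Φ : 𝔸 →L[ℝ] W}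

/-- The recursion behind the Lieb-Robinson bound. Let `A` be the sum of the terms outside `nr`,
which commute with `K`. Duhamel's formula leaves `K exp (t A)`, which the observable sees no better
than `K` because `exp (t A)` is a contraction, and an integral in which some `L i` with `i ∈ nr` has
taken the place of `K` behind the evolution. -/
lemma norm_map_exp_mul_le [CompleteSpace W]
    (hΦ : ∀ X Y : 𝔸, ‖Φ (X * Y)‖ ≤ ‖Φ X‖ * ‖Y‖)
    (hL : ∀ s : Finset ι, ∀ t : ℝ, 0 ≤ t → ‖exp (t • ∑ i ∈ s, L i)‖ ≤ 1)
    (K : 𝔸) (nr : Finset ι) (hK : ∀ i ∉ nr, Commute (L i) K) {u : ι → ℝ → ℝ}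
    (hu : ∀ i, Continuous (u i)) {t : ℝ} (ht : 0 ≤ t)
    (hub : ∀ i ∈ nr, ∀ s : ℝ, 0 ≤ s → ‖Φ (exp (s • ∑ i, L i) * L i)‖ ≤ u i s) :
    ‖Φ (exp (t • ∑ i, L i) * K)‖ ≤ ‖Φ K‖ + ‖K‖ * ∫ s in (0 : ℝ)..t, ∑ i ∈ nr, u i s := by
  set B := ∑ i, L i
  set A := ∑ i ∈ nrᶜ, L i
  have hAK : K * A = A * K :=
    (Commute.sum_right _ _ _ fun i hi => (hK i (by simpa using hi)).symm).eq
  have hBA : B = A + ∑ i ∈ nr, L i := by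
    simp only [A, B]; rw [add_comm, Finset.sum_add_sum_compl]
  have hBK : B * K - K * A = ∑ i ∈ nr, L i * K := by
    rw [hAK, hBA, add_mul, add_sub_cancel_left, Finset.sum_mul]
  have h1 := exp_mul_sub_mul_exp A B K t
  rw [hBK, sub_eq_iff_eq_add] at h1
  have hc : Continuous fun s : ℝ => exp (s • B) * (∑ i ∈ nr, L i * K) * exp ((t - s) • A) :=
    ((continuous_exp_smul B).mul continuous_const).mul
      ((continuous_exp_smul A).comp (continuous_const.sub continuous_id))
  have hA := hL nrᶜ
  rw [h1, map_add, ← ContinuousLinearMap.intervalIntegral_comp_comm _ (hc.intervalIntegrable _ _),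
    add_comm]
  refine (norm_add_le _ _).trans (add_le_add ?_ ?_)
  · refine (hΦ _ _).trans (mul_le_of_le_one_right (norm_nonneg _) (hA t ht))
  · rw [← intervalIntegral.integral_const_mul]
    refine intervalIntegral.norm_integral_le_of_norm_le ht ?_ ?_
    · refine Filter.Eventually.of_forall fun s hs => ?_
      calc ‖Φ (exp (s • B) * (∑ i ∈ nr, L i * K) * exp ((t - s) • A))‖
          ≤ ‖Φ (exp (s • B) * (∑ i ∈ nr, L i * K))‖ * 1 :=
            (hΦ _ _).trans (by gcongr; exact hA _ (by linarith [hs.2]))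
        _ = ‖∑ i ∈ nr, Φ ((exp (s • B) * L i) * K)‖ := by
            rw [mul_one, Finset.mul_sum, map_sum]; simp only [mul_assoc]
        _ ≤ ∑ i ∈ nr, u i s * ‖K‖ := by
            refine (norm_sum_le _ _).trans (Finset.sum_le_sum fun i hi => (hΦ _ _).trans ?_)
            gcongr
            exact hub i hi s hs.1.le
        _ = ‖K‖ * ∑ i ∈ nr, u i s := by rw [← Finset.sum_mul, mul_comm]
    · exact (continuous_const.mul
        (continuous_finsetSum _ fun i _ => hu i)).intervalIntegrable _ _

/-- In Duhamel's formula the perturbation `B - A` stands directly behind `exp (s B)`, where a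
Lieb-Robinson bound can estimate it. The remaining factor `exp ((t - s) A)` is only needed as a
contraction. -/
lemma norm_map_exp_sub_exp_le [CompleteSpace W]
    (hΦ : ∀ X Y : 𝔸, ‖Φ (X * Y)‖ ≤ ‖Φ X‖ * ‖Y‖) {A B : 𝔸}
    (hA : ∀ t : ℝ, 0 ≤ t → ‖exp (t • A)‖ ≤ 1) {t C : ℝ} (ht : 0 ≤ t)
    (hC : ∀ s : ℝ, 0 ≤ s → s ≤ t → ‖Φ (exp (s • B) * (B - A))‖ ≤ C) :
    ‖Φ (exp (t • B) - exp (t • A))‖ ≤ C * t := by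
  have h := exp_mul_sub_mul_exp A B 1 t
  simp only [mul_one, one_mul] at h
  have hc : Continuous fun s : ℝ => exp (s • B) * (B - A) * exp ((t - s) • A) :=
    ((continuous_exp_smul B).mul continuous_const).mul
      ((continuous_exp_smul A).comp (continuous_const.sub continuous_id))
  rw [h, ← ContinuousLinearMap.intervalIntegral_comp_comm _ (hc.intervalIntegrable _ _)]
  refine (intervalIntegral.norm_integral_le_of_norm_le_const (C := C) fun s hs => ?_).trans
    (by simp [abs_of_nonneg ht])
  rw [Set.uIoc_of_le ht] at hs
  refine (hΦ _ _).trans ((mul_le_of_le_one_right (norm_nonneg _) (hA _ ?_)).trans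
    (hC s hs.1.le hs.2))
  linarith [hs.2]

/-- A Lieb-Robinson bound: the evolved observable `Φ ∘ exp (t L)` depends only weakly on the local
terms `L j` for which the weight `w j` is small. -/
lemma lieb_robinson [CompleteSpace W]
    (hΦ : ∀ X Y : 𝔸, ‖Φ (X * Y)‖ ≤ ‖Φ X‖ * ‖Y‖)
    (hL : ∀ s : Finset ι, ∀ t : ℝ, 0 ≤ t → ‖exp (t • ∑ i ∈ s, L i)‖ ≤ 1)
    {J E B c : ℝ} {N : ℕ} {w : ι → ℝ} (hJ : 0 ≤ J) (hE : 0 ≤ E) (hB : 0 ≤ B) (hc : 0 < c)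
    (hcJ : J * N * E ≤ c) (hw : ∀ i, 0 < w i)
    (nr : ι → Finset ι) (hcomm : ∀ j, ∀ i ∉ nr j, Commute (L i) (L j))
    (hcard : ∀ j, (nr j).card ≤ N) (hwE : ∀ j, ∀ i ∈ nr j, w i ≤ E * w j)
    (hLJ : ∀ j, ‖L j‖ ≤ J) (h0 : ∀ j, ‖Φ (L j)‖ ≤ B * w j)
    {j : ι} {K : 𝔸} (hK : ∀ i ∉ nr j, Commute (L i) K) (hKJ : ‖K‖ ≤ J) (hK0 : ‖Φ K‖ ≤ B * w j)
    {t : ℝ} (ht : 0 ≤ t) :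
    ‖Φ (exp (t • ∑ i, L i) * K)‖ ≤ 2 * B * Real.exp (2 * c * t) * w j := by
  -- one step of the iteration
  have step : ∀ M : ℝ, 0 ≤ M →
      (∀ i, ∀ s : ℝ, 0 ≤ s → ‖Φ (exp (s • ∑ i, L i) * L i)‖ ≤
        (2 * B + M) * Real.exp (2 * c * s) * w i) →
      ∀ (j : ι) (K : 𝔸), (∀ i ∉ nr j, Commute (L i) K) → ‖K‖ ≤ J → ‖Φ K‖ ≤ B * w j →
      ∀ t : ℝ, 0 ≤ t → ‖Φ (exp (t • ∑ i, L i) * K)‖ ≤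
        (2 * B + M / 2) * Real.exp (2 * c * t) * w j := by
    -- The constant `c` bounds the interaction rate `J N E`. Allowing growth at rate `2 c` makes the
    -- time integral contribute `1 / (2 c)`, so the excess `M` is halved at each pass.
    intro M hM hu j K hK hKJ hK0 t ht
    have h1 := norm_map_exp_mul_le hΦ hL K (nr j) hK
      (u := fun i s => (2 * B + M) * Real.exp (2 * c * s) * w i) (fun i => by fun_prop) ht
      (fun i _ s hs => hu i s hs)
    have h2 : ∫ s in (0 : ℝ)..t, ∑ i ∈ nr j, (2 * B + M) * Real.exp (2 * c * s) * w i =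
        (2 * B + M) * (∑ i ∈ nr j, w i) * ((Real.exp (2 * c * t) - 1) / (2 * c)) := by
      have h3 : ∀ s : ℝ, ∑ i ∈ nr j, (2 * B + M) * Real.exp (2 * c * s) * w i =
          (2 * B + M) * (∑ i ∈ nr j, w i) * Real.exp (2 * c * s) := by
        intro s; rw [Finset.mul_sum, Finset.sum_mul]
        exact Finset.sum_congr rfl fun i _ => by ring
      simp_rw [h3]
      rw [intervalIntegral.integral_const_mul, intervalIntegral.integral_comp_mul_left
        (fun s => Real.exp s) (by positivity : 2 * c ≠ 0), integral_exp]
      simp [div_eq_inv_mul]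
    have h4 : ∑ i ∈ nr j, w i ≤ N * (E * w j) := by
      refine (Finset.sum_le_card_nsmul _ _ _ (hwE j)).trans ?_
      rw [nsmul_eq_mul]
      have := hw j
      gcongr
      exact hcard j
    have he : 1 ≤ Real.exp (2 * c * t) := Real.one_le_exp (by positivity)
    have hwj := hw j
    have hs0 : 0 ≤ ∑ i ∈ nr j, w i := Finset.sum_nonneg fun i _ => (hw i).le
    rw [h2] at h1
    have h5 : ‖K‖ * ((2 * B + M) * (∑ i ∈ nr j, w i) * ((Real.exp (2 * c * t) - 1) / (2 * c))) ≤
        (B + M / 2) * (Real.exp (2 * c * t) - 1) * w j := by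
      have h6 : 0 ≤ (Real.exp (2 * c * t) - 1) / (2 * c) := div_nonneg (by linarith) (by linarith)
      calc _ ≤ J * ((2 * B + M) * (N * (E * w j)) * ((Real.exp (2 * c * t) - 1) / (2 * c))) := by
            gcongr
        _ = (J * N * E) * ((2 * B + M) * w j * ((Real.exp (2 * c * t) - 1) / (2 * c))) := by ring
        _ ≤ c * ((2 * B + M) * w j * ((Real.exp (2 * c * t) - 1) / (2 * c))) := by gcongr
        _ = _ := by field_simp
    have h7 : 0 ≤ B * w j * (Real.exp (2 * c * t) - 1) := by
      have : 0 ≤ Real.exp (2 * c * t) - 1 := by linarith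
      positivity
    have h8 : 0 ≤ M * w j := by positivity
    nlinarith
  -- a crude initial bound
  obtain ⟨M, hM, hM0⟩ : ∃ M : ℝ, 0 ≤ M ∧ ∀ i, ∀ s : ℝ, 0 ≤ s →
      ‖Φ (exp (s • ∑ i, L i) * L i)‖ ≤ (2 * B + M) * Real.exp (2 * c * s) * w i := by
    -- This grows with the system, which does not matter: the iteration halves it to zero.
    refine ⟨∑ i, ‖Φ‖ * J / w i, Finset.sum_nonneg fun i _ => by have := hw i; positivity,
      fun i s hs => ?_⟩
    have h1 : ‖Φ (exp (s • ∑ i, L i) * L i)‖ ≤ ‖Φ‖ * J := by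
      refine (Φ.le_opNorm _).trans (mul_le_mul_of_nonneg_left ?_ (norm_nonneg _))
      refine (norm_mul_le _ _).trans ?_
      calc _ ≤ 1 * J := mul_le_mul (hL _ s hs) (hLJ i) (norm_nonneg _) zero_le_one
        _ = J := one_mul J
    have h2 : ‖Φ‖ * J / w i ≤ ∑ i, ‖Φ‖ * J / w i :=
      Finset.single_le_sum (f := fun i => ‖Φ‖ * J / w i)
        (fun i _ => by have := hw i; positivity) (Finset.mem_univ i)
    have he : 1 ≤ Real.exp (2 * c * s) := Real.one_le_exp (by positivity)
    have hwi := hw i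
    calc _ ≤ ‖Φ‖ * J / w i * 1 * w i := by rw [mul_one, div_mul_cancel₀ _ hwi.ne']; exact h1
      _ ≤ _ := by
        have h3 : ‖Φ‖ * J / w i ≤ 2 * B + ∑ i, ‖Φ‖ * J / w i := by linarith
        have : 0 ≤ 2 * B + ∑ i, ‖Φ‖ * J / w i := le_trans (by positivity) h3
        gcongr
  have iter : ∀ n : ℕ, ∀ i, ∀ s : ℝ, 0 ≤ s →
      ‖Φ (exp (s • ∑ i, L i) * L i)‖ ≤ (2 * B + M / 2 ^ n) * Real.exp (2 * c * s) * w i := by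
    intro n
    induction n with
    | zero => simpa using hM0
    | succ n ih =>
      intro i s hs
      have := step (M / 2 ^ n) (by positivity) ih i (L i) (hcomm i) (hLJ i) (h0 i) s hs
      rwa [div_div, ← pow_succ] at this
  have hfin : ∀ n : ℕ, ‖Φ (exp (t • ∑ i, L i) * K)‖ ≤
      (2 * B + M / 2 ^ n / 2) * Real.exp (2 * c * t) * w j := fun n =>
    step (M / 2 ^ n) (by positivity) (iter n) j K hK hKJ hK0 t ht
  have hlim : Filter.Tendsto (fun n : ℕ => (2 * B + M / 2 ^ n / 2) * Real.exp (2 * c * t) * w j)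
      Filter.atTop (𝓝 ((2 * B + 0 / 2) * Real.exp (2 * c * t) * w j)) := by
    have h1 : Filter.Tendsto (fun n : ℕ => M / 2 ^ n) Filter.atTop (𝓝 0) :=
      tendsto_const_nhds.div_atTop (tendsto_pow_atTop_atTop_of_one_lt one_lt_two)
    exact (((h1.div_const 2).const_add _).mul_const _).mul_const _
  simpa using ge_of_tendsto' hlim hfin

end LiebRobinson

end Semigroup

/-- Interpolation between a bound on a function and on its second-order differences. -/
lemma norm_sub_le_of_quadratic_expansion {ψ : ℝ → ℂ} {E K θ : ℝ} (hE : 0 ≤ E) (hK : 0 ≤ K)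
    (hθ : 0 < θ) (hθ1 : θ ≤ 1)
    (hψ : ∀ h ∈ Set.Icc (-1 : ℝ) 1, ‖ψ h‖ ≤ E * θ ^ 2)
    (hq : ∀ h ∈ Set.Icc (-1 : ℝ) 1, ∃ q : ℂ, ∀ h' ∈ Set.Icc (-1 : ℝ) 1,
      ‖ψ h' - ψ h - (h' - h : ℝ) • q‖ ≤ K * (h' - h) ^ 2)
    {h h' : ℝ} (hh : h ∈ Set.Icc (-1 : ℝ) 1) (hh' : h' ∈ Set.Icc (-1 : ℝ) 1) :
    ‖ψ h' - ψ h‖ ≤ (2 * E + 2 * K) * θ * |h' - h| := by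
  obtain ⟨q, hq⟩ := hq h hh
  have hqb : ‖q‖ * θ ≤ (2 * E + K) * θ ^ 2 := by
    -- The derivative is probed at distance exactly `θ`, on the side of `h` with enough room. At
    -- this scale size and curvature balance: `E θ² / θ` against `K θ`.
    obtain ⟨k, hk, hkθ⟩ : ∃ k ∈ Set.Icc (-1 : ℝ) 1, |k - h| = θ := by
      by_cases h0 : h ≤ 0
      · exact ⟨h + θ, ⟨by linarith [hh.1], by linarith⟩, by
          rw [add_sub_cancel_left, abs_of_pos hθ]⟩
      · exact ⟨h - θ, ⟨by linarith, by linarith [hh.2]⟩, by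
          rw [sub_sub_cancel_left, abs_neg, abs_of_pos hθ]⟩
    have h1 := hq k hk
    have h2 : ((k - h : ℝ) • q) = ψ k - ψ h - (ψ k - ψ h - (k - h : ℝ) • q) := by abel
    have h3 : ‖(k - h : ℝ) • q‖ ≤ E * θ ^ 2 + E * θ ^ 2 + K * (k - h) ^ 2 := by
      rw [h2]
      refine (norm_sub_le _ _).trans (add_le_add ((norm_sub_le _ _).trans ?_) h1)
      exact add_le_add (hψ k hk) (hψ h hh)
    rw [norm_smul, Real.norm_eq_abs, hkθ, ← sq_abs (k - h), hkθ] at h3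
    linarith
  have hqb' : ‖q‖ ≤ (2 * E + K) * θ := by
    refine le_of_mul_le_mul_right (hqb.trans (le_of_eq (by ring))) hθ
  -- At short distance the expansion is used; beyond `θ` the uniform bound `2 E θ²` is already at
  -- most `2 E θ |h' - h|`.
  by_cases hd : |h' - h| ≤ θ
  · have h1 := hq h' hh'
    have h2 : ψ h' - ψ h = (h' - h : ℝ) • q + (ψ h' - ψ h - (h' - h : ℝ) • q) := by abel
    have h3 : ‖ψ h' - ψ h‖ ≤ |h' - h| * ‖q‖ + K * |h' - h| ^ 2 := by
      rw [h2]
      refine (norm_add_le _ _).trans (add_le_add ?_ ?_)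
      · rw [norm_smul, Real.norm_eq_abs]
      · rw [sq_abs]; exact h1
    have h4 : K * |h' - h| ^ 2 ≤ K * (θ * |h' - h|) := by
      rw [sq]; gcongr
    have h5 : |h' - h| * ‖q‖ ≤ |h' - h| * ((2 * E + K) * θ) := by gcongr
    linarith
  · push Not at hd
    have h1 : ‖ψ h' - ψ h‖ ≤ 2 * E * θ * θ := by
      refine (norm_sub_le _ _).trans ?_
      linarith [hψ h' hh', hψ h hh]
    have h2 : 2 * E * θ * θ ≤ 2 * E * θ * |h' - h| := by gcongr
    have h3 : 0 ≤ K * θ * |h' - h| := by positivity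
    linarith

/-! ### Superoperators as bounded operators for the trace norm -/

section TraceClass

/-- Matrices with the trace norm. -/
def TM (I : Type*) : Type _ := Matrix I I ℂ

variable {I : Type*} [Fintype I] [DecidableEq I]

instance : AddCommGroup (TM I) := inferInstanceAs (AddCommGroup (Matrix I I ℂ))
instance : Module ℂ (TM I) := inferInstanceAs (Module ℂ (Matrix I I ℂ))
instance : Norm (TM I) := ⟨fun X => traceNorm (I := I) X⟩

lemma TM.core : NormedSpace.Core ℂ (TM I) where
  norm_nonneg X := traceNorm_nonneg (I := I) X
  norm_smul c := fun (X : Matrix I I ℂ) => by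
    change traceNorm (c • X) = ‖c‖ * traceNorm X
    refine le_antisymm (traceNorm_smul_le c X) ?_
    by_cases hc : c = 0
    · rw [hc, norm_zero, zero_mul]
      exact traceNorm_nonneg (I := I) _
    · have h := traceNorm_smul_le (I := I) c⁻¹ (c • X)
      rw [inv_smul_smul₀ hc X, norm_inv, inv_mul_eq_div, le_div_iff₀ (norm_pos_iff.2 hc),
        mul_comm] at h
      exact h
  norm_triangle X Y := traceNorm_add_le (I := I) X Y
  norm_eq_zero_iff X := ⟨fun h => eq_zero_of_traceNorm_eq_zero (I := I) h, fun h => by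
    rw [h]; exact traceNorm_zero (I := I)⟩

instance : NormedAddCommGroup (TM I) := NormedAddCommGroup.ofCore TM.core
instance : NormedSpace ℂ (TM I) := NormedSpace.ofCore TM.core
instance : FiniteDimensional ℂ (TM I) := inferInstanceAs (FiniteDimensional ℂ (Matrix I I ℂ))
instance : CompleteSpace (TM I) := FiniteDimensional.complete ℂ (TM I)

/-- A superoperator as a bounded operator for the trace norm. -/
def opCLM : SuperOp I ≃ₗ[ℂ] (TM I →L[ℂ] TM I) :=
  LinearMap.toContinuousLinearMap (𝕜 := ℂ) (E := TM I) (F' := TM I)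

lemma opCLM_pow_apply (T : SuperOp I) (k : ℕ) (X : Matrix I I ℂ) :
    (opCLM T ^ k) X = (T ^ k) X := by
  induction k generalizing X with
  | zero => rfl
  | succ k ih =>
    rw [pow_succ, pow_succ]
    exact ih (T X)

lemma norm_opCLM_le {T : SuperOp I} {J : ℝ} (hJ : 0 ≤ J)
    (h : ∀ X : Matrix I I ℂ, traceNorm (T X) ≤ J * traceNorm X) : ‖opCLM T‖ ≤ J :=
  ContinuousLinearMap.opNorm_le_bound _ hJ h

/-- The identity, from the trace norm topology to the topology of matrices. -/
def ofTM : TM I →L[ℂ] Matrix I I ℂ :=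
  LinearMap.toContinuousLinearMap
    { toFun := fun X => X
      map_add' := fun _ _ => rfl
      map_smul' := fun _ _ => rfl }

lemma evolve_eq_exp (T : SuperOp I) (t : ℝ) (X : Matrix I I ℂ) :
    evolve T t X = NormedSpace.exp (t • opCLM T) X := by
  have h := NormedSpace.exp_series_hasSum_exp' (𝕂 := ℝ) (t • opCLM T)
  let X' : TM I := X
  -- The exponential series converges in the operator norm; evaluation at `X` followed by `ofTM`
  -- carries the sum to the matrix topology in which `evolve` is defined.
  have h2 := (h.map (ContinuousLinearMap.apply ℂ (TM I) X')
    (ContinuousLinearMap.continuous _)).map ofTM ofTM.continuous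
  refine Eq.trans ?_ h2.tsum_eq
  refine tsum_congr fun k => ?_
  have h3 : (t • opCLM T) ^ k = t ^ k • opCLM T ^ k := smul_pow _ _ _
  change _ = ofTM (((k.factorial : ℝ)⁻¹ • (t • opCLM T) ^ k) X')
  rw [h3, smul_smul]
  rw [div_eq_inv_mul, ← opCLM_pow_apply]
  rfl

/-- The functional `X ↦ tr (A X)`. -/
def trFun (A : Matrix I I ℂ) : TM I →L[ℂ] ℂ :=
  LinearMap.mkContinuous
    ({ toFun := fun X => (A * X).trace
       map_add' := fun X Y => by rw [Matrix.mul_add, Matrix.trace_add]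
       map_smul' := fun c X => by
        rw [Matrix.mul_smul, Matrix.trace_smul]; rfl } : Matrix I I ℂ →ₗ[ℂ] ℂ)
    (opNorm A) (fun X => norm_trace_mul_le A X)

lemma norm_trFun_le (A : Matrix I I ℂ) : ‖trFun A‖ ≤ opNorm A :=
  LinearMap.mkContinuous_norm_le _ (opNorm_nonneg A) _

/-- `X ↦ f ∘ X`. -/
def precomp (f : TM I →L[ℂ] ℂ) : (TM I →L[ℂ] TM I) →L[ℝ] (TM I →L[ℂ] ℂ) :=
  ((ContinuousLinearMap.compL ℂ (TM I) (TM I) ℂ) f).restrictScalars ℝ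

/-- The submultiplicativity that `lieb_robinson` requires of `Φ`. -/
lemma norm_precomp_mul_le (f : TM I →L[ℂ] ℂ) (X Y : TM I →L[ℂ] TM I) :
    ‖precomp f (X * Y)‖ ≤ ‖precomp f X‖ * ‖Y‖ :=
  ContinuousLinearMap.opNorm_comp_le (f.comp X) Y

lemma norm_one_TM_le : ‖(1 : TM I →L[ℂ] TM I)‖ ≤ 1 := ContinuousLinearMap.norm_id_le

end TraceClass

/-! ### Lindblad generators: locality and dissipativity -/

section Lindblad

variable {I : Type*} [Fintype I]

/-- The Lindbladian with Hamiltonian `H` and Lindblad operators `K`. -/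
def IsLindbladForm {p : ℕ} (T : SuperOp I) (H : Matrix I I ℂ) (K : Fin p → Matrix I I ℂ) : Prop :=
  ∀ ρ, T ρ = Complex.I • (ρ * H - H * ρ) +
      ∑ k, (K k * ρ * (K k).conjTranspose -
        (1 / 2 : ℂ) • ((K k).conjTranspose * K k * ρ + ρ * ((K k).conjTranspose * K k)))

lemma IsLindbladForm.trace_eq_zero {p : ℕ} {T : SuperOp I} {H : Matrix I I ℂ}
    {K : Fin p → Matrix I I ℂ} (h : IsLindbladForm T H K) (ρ : Matrix I I ℂ) :
    (T ρ).trace = 0 := by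
  rw [h ρ, Matrix.trace_add, Matrix.trace_smul, Matrix.trace_sub, Matrix.trace_mul_comm ρ H,
    sub_self, smul_zero, zero_add, Matrix.trace_sum]
  refine Finset.sum_eq_zero fun k _ => ?_
  rw [Matrix.trace_sub, Matrix.trace_smul, Matrix.trace_add, Matrix.trace_mul_comm (K k * ρ),
    ← Matrix.mul_assoc, Matrix.trace_mul_comm ρ, smul_eq_mul]
  ring

/-- A Lindbladian is a module map over the operators commuting with `H`, the `K k` and their
adjoints. Both forms of locality rest on this: commutation of generators with disjoint supports, and
invisibility of distant terms. -/
lemma IsLindbladForm.map_mul_left {p : ℕ} {T : SuperOp I} {H : Matrix I I ℂ}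
    {K : Fin p → Matrix I I ℂ} (h : IsLindbladForm T H K) {B : Matrix I I ℂ}
    (hH : B * H = H * B) (hK : ∀ k, B * K k = K k * B)
    (hK' : ∀ k, B * (K k).conjTranspose = (K k).conjTranspose * B) (ρ : Matrix I I ℂ) :
    T (B * ρ) = B * T ρ := by
  rw [h, h, Matrix.mul_add, Matrix.mul_smul, Matrix.mul_sub, Finset.mul_sum]
  congr 1
  · rw [Matrix.mul_assoc, ← Matrix.mul_assoc H, ← hH, Matrix.mul_assoc B H]
  · refine Finset.sum_congr rfl fun k _ => ?_
    rw [Matrix.mul_sub, Matrix.mul_smul, Matrix.mul_add]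
    congr 1
    · rw [← Matrix.mul_assoc (K k), ← hK]; simp only [Matrix.mul_assoc]
    · congr 2
      · rw [← Matrix.mul_assoc _ B ρ, Matrix.mul_assoc _ (K k) B, ← hK, ← Matrix.mul_assoc _ B,
          ← hK']
        simp only [Matrix.mul_assoc]
      · simp only [Matrix.mul_assoc]

lemma IsLindbladForm.map_mul_right {p : ℕ} {T : SuperOp I} {H : Matrix I I ℂ}
    {K : Fin p → Matrix I I ℂ} (h : IsLindbladForm T H K) {B : Matrix I I ℂ}
    (hH : B * H = H * B) (hK : ∀ k, B * K k = K k * B)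
    (hK' : ∀ k, B * (K k).conjTranspose = (K k).conjTranspose * B) (ρ : Matrix I I ℂ) :
    T (ρ * B) = T ρ * B := by
  rw [h, h, Matrix.add_mul, Matrix.smul_mul, Matrix.sub_mul, Finset.sum_mul]
  congr 1
  · rw [Matrix.mul_assoc, hH]; simp only [Matrix.mul_assoc]
  · refine Finset.sum_congr rfl fun k _ => ?_
    rw [Matrix.sub_mul, Matrix.smul_mul, Matrix.add_mul]
    congr 1
    · simp only [Matrix.mul_assoc]; rw [hK']
    · congr 2
      · simp only [Matrix.mul_assoc]
      · rw [Matrix.mul_assoc ρ B, ← Matrix.mul_assoc B, hK', Matrix.mul_assoc _ B, hK]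
        simp only [Matrix.mul_assoc]

/-- `T'` is assembled from left and right multiplications by `H'`, `K' l` and their adjoints, and
each of these passes through `T`. -/
lemma IsLindbladForm.comm {p q : ℕ} {T T' : SuperOp I} {H H' : Matrix I I ℂ}
    {K : Fin p → Matrix I I ℂ} {K' : Fin q → Matrix I I ℂ} (h : IsLindbladForm T H K)
    (h' : IsLindbladForm T' H' K') (hH : H' * H = H * H') (hHK : ∀ k, H' * K k = K k * H')
    (hHK' : ∀ k, H' * (K k).conjTranspose = (K k).conjTranspose * H')
    (hKH : ∀ l, K' l * H = H * K' l) (hKK : ∀ l k, K' l * K k = K k * K' l)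
    (hKK' : ∀ l k, K' l * (K k).conjTranspose = (K k).conjTranspose * K' l)
    (hKH2 : ∀ l, (K' l).conjTranspose * H = H * (K' l).conjTranspose)
    (hKK2 : ∀ l k, (K' l).conjTranspose * K k = K k * (K' l).conjTranspose)
    (hKK2' : ∀ l k, (K' l).conjTranspose * (K k).conjTranspose =
      (K k).conjTranspose * (K' l).conjTranspose) :
    T * T' = T' * T := by
  refine LinearMap.ext fun ρ => ?_
  change T (T' ρ) = T' (T ρ)
  rw [h' ρ, h' (T ρ), map_add, map_smul, map_sub, map_sum,
    h.map_mul_left hH hHK hHK', h.map_mul_right hH hHK hHK']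
  congr 1
  refine Finset.sum_congr rfl fun l _ => ?_
  rw [map_sub, map_smul, map_add, h.map_mul_right (hKH2 l) (hKK2 l) (hKK2' l),
    h.map_mul_left (hKH l) (hKK l) (hKK' l)]
  congr 3
  · rw [Matrix.mul_assoc, h.map_mul_left (hKH2 l) (hKK2 l) (hKK2' l),
      h.map_mul_left (hKH l) (hKK l) (hKK' l), Matrix.mul_assoc]
  · rw [← Matrix.mul_assoc, h.map_mul_right (hKH l) (hKK l) (hKK' l),
      h.map_mul_right (hKH2 l) (hKK2 l) (hKK2' l), Matrix.mul_assoc]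

variable [DecidableEq I]

local notation "hat" => Matrix.toEuclideanCLM (n := I) (𝕜 := ℂ)

lemma traceNorm_conj_le (G X : Matrix I I ℂ) :
    traceNorm (G * X * G.conjTranspose) ≤ opNorm G ^ 2 * traceNorm X := by
  have := traceNorm_sum_conj_le (K := Unit) (fun _ => G) (c := opNorm G ^ 2) (fun x => by
    simp only [Finset.univ_unique, Finset.sum_singleton]
    rw [← mul_pow]
    exact pow_le_pow_left₀ (norm_nonneg _) ((hat G).le_opNorm x) 2) X
  simpa using this

/-- With `G = -i H - ½ ∑ K* K` one has `T ρ = G ρ + ρ G* + ∑ K ρ K*`. Hence `1 + e T` is the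
completely positive map with Kraus operators `1 + e G` and `√e K k`, minus `e² G X G*`. Since `2 Re
⟨x, G x⟩ = -∑ ‖K x‖²`, the first-order terms cancel in the normalisation of the Kraus operators, and
only an error of order `e²` remains. -/
lemma IsLindbladForm.dissipative {p : ℕ} {T : SuperOp I} {H : Matrix I I ℂ}
    {K : Fin p → Matrix I I ℂ} (h : IsLindbladForm T H K) (hH : H.IsHermitian) :
    Dissipative (opCLM T) := by
  set G : Matrix I I ℂ := -(Complex.I • H) - (1 / 2 : ℂ) • ∑ k, (K k).conjTranspose * K k with hG
  have hG' : G.conjTranspose = Complex.I • H - (1 / 2 : ℂ) • ∑ k, (K k).conjTranspose * K k := by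
    rw [hG, Matrix.conjTranspose_sub, Matrix.conjTranspose_neg, Matrix.conjTranspose_smul,
      Matrix.conjTranspose_smul, Matrix.conjTranspose_sum, hH.eq]
    simp [Matrix.conjTranspose_mul]
  have hT : ∀ ρ, T ρ = G * ρ + ρ * G.conjTranspose + ∑ k, K k * ρ * (K k).conjTranspose := by
    intro ρ
    rw [h ρ, hG', hG, Finset.sum_sub_distrib, ← Finset.smul_sum, Finset.sum_add_distrib,
      ← Finset.sum_mul, ← Finset.mul_sum]
    simp only [Matrix.sub_mul, Matrix.neg_mul, Matrix.mul_sub, Matrix.smul_mul, Matrix.mul_smul,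
      smul_sub, smul_add]
    abel
  have hre : ∀ x, (inner ℂ x (hat G x)).re = -(1 / 2) * ∑ k, ‖hat (K k) x‖ ^ 2 := by
    intro x
    have h1 : (inner ℂ x (hat H x)).im = 0 := by
      have h2 := inner_toEuclideanCLM_conjTranspose H x x
      rw [hH.eq, ← inner_conj_symm (hat H x)] at h2
      exact (Complex.conj_eq_iff_im.1 h2.symm)
    have h3 : ∀ k, inner ℂ x (hat ((K k).conjTranspose * K k) x) = ((‖hat (K k) x‖ ^ 2 : ℝ) : ℂ) := by
      intro k
      rw [map_mul]
      change inner ℂ x (hat (K k).conjTranspose (hat (K k) x)) = _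
      rw [inner_toEuclideanCLM_conjTranspose, Matrix.conjTranspose_conjTranspose,
        inner_self_eq_norm_sq_to_K]
      simp
    have h4 : inner ℂ x (hat G x) = -(Complex.I * inner ℂ x (hat H x)) -
        (1 / 2 : ℂ) * ((∑ k, ‖hat (K k) x‖ ^ 2 : ℝ) : ℂ) := by
      rw [hG, map_sub, map_neg, map_smul, map_smul, map_sum]
      simp only [sub_apply, neg_apply, smul_apply, sum_apply, inner_sub_right, inner_neg_right,
        inner_smul_right, inner_sum, h3]
      rw [Complex.ofReal_sum]
    rw [h4]
    simp only [Complex.sub_re, Complex.neg_re, Complex.mul_re, Complex.I_re, Complex.I_im,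
      Complex.ofReal_re, Complex.ofReal_im, h1]
    norm_num
  refine ⟨2 * opNorm G ^ 2, by positivity, fun e he he1 => ?_⟩
  refine ContinuousLinearMap.opNorm_le_bound _ (by positivity) fun (X : Matrix I I ℂ) => ?_
  change traceNorm (I := I) (X + (e : ℂ) • T X) ≤ _ * traceNorm (I := I) X
  let A : Option (Fin p) → Matrix I I ℂ := fun k =>
    k.elim (1 + (e : ℂ) • G) fun k => ((√e : ℝ) : ℂ) • K k
  have hsq : ((√e : ℝ) : ℂ) * ((√e : ℝ) : ℂ) = e := by
    rw [← Complex.ofReal_mul, Real.mul_self_sqrt he]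
  have hXT : X + (e : ℂ) • T X = (∑ k, A k * X * (A k).conjTranspose) +
      (-(e : ℂ) ^ 2) • (G * X * G.conjTranspose) := by
    rw [hT, Fintype.sum_option]
    simp only [A, Option.elim_none, Option.elim_some, Matrix.conjTranspose_add,
      Matrix.conjTranspose_one, Matrix.conjTranspose_smul, Matrix.smul_mul, Matrix.mul_smul,
      smul_smul, Complex.star_def, Complex.conj_ofReal, hsq, ← Finset.smul_sum,
      Matrix.add_mul, Matrix.mul_add, Matrix.one_mul, Matrix.mul_one, smul_add, neg_smul, sq]
    abel
  have hA : ∀ x : EuclideanSpace ℂ I, ∑ k, ‖hat (A k) x‖ ^ 2 ≤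
      (1 + e ^ 2 * opNorm G ^ 2) * ‖x‖ ^ 2 := by
    intro x
    rw [Fintype.sum_option]
    simp only [A, Option.elim_none, Option.elim_some, map_add, map_one, map_smul, add_apply,
      smul_apply, one_apply_eq_self, norm_smul, mul_pow, Complex.norm_real, Real.norm_eq_abs,
      sq_abs, Real.sq_sqrt he]
    rw [← Finset.mul_sum, norm_add_sq (𝕜 := ℂ), inner_smul_right, norm_smul, mul_pow,
      Complex.norm_real, Real.norm_eq_abs, sq_abs]
    have h1 : RCLike.re ((e : ℂ) * inner ℂ x (hat G x)) = e * (inner ℂ x (hat G x)).re := by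
      simp
    rw [h1, hre]
    have h2 : ‖hat G x‖ ^ 2 ≤ opNorm G ^ 2 * ‖x‖ ^ 2 := by
      rw [← mul_pow]; exact pow_le_pow_left₀ (norm_nonneg _) ((hat G).le_opNorm x) 2
    nlinarith [mul_le_mul_of_nonneg_left h2 (sq_nonneg e)]
  rw [hXT]
  refine (traceNorm_add_le _ _).trans ?_
  have h1 := traceNorm_sum_conj_le A hA X
  have h2 := traceNorm_smul_le (-(e : ℂ) ^ 2) (G * X * G.conjTranspose)
  have h3 := traceNorm_conj_le G X
  rw [norm_neg, norm_pow, Complex.norm_real, Real.norm_eq_abs, sq_abs] at h2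
  nlinarith [mul_le_mul_of_nonneg_left h3 (sq_nonneg e), traceNorm_nonneg (I := I) X]

end Lindblad

/-! ### Supports of operators -/

section Support

variable {D L : ℕ} {b : Site D L → ℕ}

open Classical in
/-- The basis vector that agrees with `σ` on `S` and with `τ` elsewhere. -/
def Joint.mix (S : Set (Site D L)) (σ τ : Joint b) : Joint b :=
  (fun j => if j ∈ S then σ.1 j else τ.1 j, fun j => if j ∈ S then σ.2 j else τ.2 j)

lemma Joint.coord_mix_of_mem {S : Set (Site D L)} {σ τ : Joint b} {j : Site D L} (h : j ∈ S) :
    (Joint.mix S σ τ).coord j = σ.coord j := by simp [Joint.mix, Joint.coord, h]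

lemma Joint.coord_mix_of_notMem {S : Set (Site D L)} {σ τ : Joint b} {j : Site D L}
    (h : j ∉ S) : (Joint.mix S σ τ).coord j = τ.coord j := by simp [Joint.mix, Joint.coord, h]

lemma Joint.ext_coord {σ τ : Joint b} (h : ∀ j, σ.coord j = τ.coord j) : σ = τ :=
  Prod.ext (funext fun j => congrArg Prod.fst (h j)) (funext fun j => congrArg Prod.snd (h j))

lemma SupportedOn.conjTranspose {V I : Type*} {α : V → Type*} {c : I → ∀ v, α v} {S : Set V}
    {A : Matrix I I ℂ} (h : SupportedOn c S A) : SupportedOn c S A.conjTranspose := by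
  refine ⟨fun σ τ ⟨v, hv, hn⟩ => ?_, fun σ τ σ' τ' h1 h2 h3 h4 => ?_⟩
  · rw [Matrix.conjTranspose_apply, h.1 τ σ ⟨v, hv, hn.symm⟩, star_zero]
  · rw [Matrix.conjTranspose_apply, Matrix.conjTranspose_apply,
      h.2 τ σ τ' σ' h2 h1 (fun v hv => (h3 v hv).symm) fun v hv => (h4 v hv).symm]

/-- The sum over intermediate basis vectors has a single term: `B` fixes the coordinates on `S`, so
these come from `τ`, and `A` fixes those off `S`, so these come from `σ`. -/
lemma SupportedOn.mul_apply {S T : Set (Site D L)} {A B : Matrix (Joint b) (Joint b) ℂ}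
    (hA : SupportedOn Joint.coord S A) (hB : SupportedOn Joint.coord T B) (hST : Disjoint S T)
    (σ τ : Joint b) :
    (A * B) σ τ = A σ (Joint.mix S τ σ) * B (Joint.mix S τ σ) τ := by
  rw [Matrix.mul_apply]
  refine Finset.sum_eq_single _ (fun μ _ hμ => ?_) (fun h => absurd (Finset.mem_univ _) h)
  by_contra hne
  refine hμ (Joint.ext_coord fun j => ?_)
  by_cases hj : j ∈ S
  · rw [Joint.coord_mix_of_mem hj]
    by_contra h
    exact hne (by rw [hB.1 μ τ ⟨j, hST.notMem_of_mem_left hj, h⟩, mul_zero])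
  · rw [Joint.coord_mix_of_notMem hj]
    by_contra h
    exact hne (by rw [hA.1 σ μ ⟨j, hj, fun h' => h h'.symm⟩, zero_mul])

/-- Operators with disjoint supports commute. -/
lemma SupportedOn.mul_comm {S T : Set (Site D L)} {A B : Matrix (Joint b) (Joint b) ℂ}
    (hA : SupportedOn Joint.coord S A) (hB : SupportedOn Joint.coord T B) (hST : Disjoint S T) :
    A * B = B * A := by
  ext σ τ
  rw [hA.mul_apply hB hST, hB.mul_apply hA hST.symm]
  -- If `σ` and `τ` differ somewhere off both supports, both products vanish. Otherwise the factors
  -- agree pairwise, because entries depend only on the coordinates in the support.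
  by_cases h : ∃ v, v ∉ S ∧ v ∉ T ∧ σ.coord v ≠ τ.coord v
  · obtain ⟨v, hS, hT, hne⟩ := h
    rw [hB.1 (Joint.mix S τ σ) τ ⟨v, hT, by rwa [Joint.coord_mix_of_notMem hS]⟩,
      hA.1 (Joint.mix T τ σ) τ ⟨v, hS, by rwa [Joint.coord_mix_of_notMem hT]⟩, mul_zero, mul_zero]
  · push Not at h
    have key : ∀ {S T : Set (Site D L)} {A : Matrix (Joint b) (Joint b) ℂ},
        SupportedOn Joint.coord S A → Disjoint S T →
        (∀ v, v ∉ S → v ∉ T → σ.coord v = τ.coord v) →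
        A σ (Joint.mix S τ σ) = A (Joint.mix T τ σ) τ := by
      intro S T A hA hST h
      refine hA.2 _ _ _ _ (fun v hv => ?_) (fun v hv => ?_) (fun v hv => ?_) (fun v hv => ?_)
      · rw [Joint.coord_mix_of_notMem (hST.notMem_of_mem_left hv)]
      · rw [Joint.coord_mix_of_mem hv]
      · rw [Joint.coord_mix_of_notMem hv]
      · by_cases hT : v ∈ T
        · rw [Joint.coord_mix_of_mem hT]
        · rw [Joint.coord_mix_of_notMem hT, h v hv hT]
    rw [key hA hST h, key hB hST.symm fun v h1 h2 => h v h2 h1, _root_.mul_comm]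

lemma QubitSupportedOn.kronecker_one {S : Set (Site D L)} {A : Matrix (Conf D L) (Conf D L) ℂ}
    (h : QubitSupportedOn S A) :
    SupportedOn Joint.coord S (A ⊗ₖ (1 : Matrix (Anc b) (Anc b) ℂ)) := by
  refine ⟨fun σ τ ⟨v, hv, hn⟩ => ?_, fun σ τ σ' τ' h1 h2 h3 h4 => ?_⟩
  · rw [Matrix.kroneckerMap_apply]
    by_cases h1 : σ.1 v = τ.1 v
    · have h2 : σ.2 ≠ τ.2 := fun h2 => hn (Prod.ext h1 (congrFun h2 v))
      rw [Matrix.one_apply_ne h2, mul_zero]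
    · rw [h.1 _ _ ⟨v, hv, h1⟩, zero_mul]
  · rw [Matrix.kroneckerMap_apply, Matrix.kroneckerMap_apply]
    have e1 : ∀ {σ τ : Joint b} {v}, σ.coord v = τ.coord v → σ.1 v = τ.1 v :=
      fun h => congrArg Prod.fst h
    have e2 : ∀ {σ τ : Joint b} {v}, σ.coord v = τ.coord v → σ.2 v = τ.2 v :=
      fun h => congrArg Prod.snd h
    rw [h.2 σ.1 τ.1 σ'.1 τ'.1 (fun v hv => e1 (h1 v hv)) (fun v hv => e1 (h2 v hv))
      (fun v hv => e1 (h3 v hv)) (fun v hv => e1 (h4 v hv))]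
    congr 1
    have : σ.2 = τ.2 ↔ σ'.2 = τ'.2 := by
      rw [funext_iff, funext_iff]
      refine forall_congr' fun v => ?_
      by_cases hv : v ∈ S
      · rw [e2 (h1 v hv), e2 (h2 v hv)]
      · simp [e2 (h3 v hv), e2 (h4 v hv)]
    simp only [Matrix.one_apply, this]

lemma IsLindbladianOn.commute {S S' : Set (Site D L)} {T T' : SuperOp (Joint b)}
    (h : IsLindbladianOn S T) (h' : IsLindbladianOn S' T') (hS : Disjoint S S') :
    Commute (opCLM T) (opCLM T') := by
  obtain ⟨H, p, K, -, hsH, hsK, hT⟩ := h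
  obtain ⟨H', q, K', -, hsH', hsK', hT'⟩ := h'
  have hform : IsLindbladForm T H K := hT
  have hform' : IsLindbladForm T' H' K' := hT'
  have hS' := hS.symm
  have := hform.comm hform' (hsH'.mul_comm hsH hS') (fun k => hsH'.mul_comm (hsK k) hS')
    (fun k => hsH'.mul_comm (hsK k).conjTranspose hS') (fun l => (hsK' l).mul_comm hsH hS')
    (fun l k => (hsK' l).mul_comm (hsK k) hS')
    (fun l k => (hsK' l).mul_comm (hsK k).conjTranspose hS')
    (fun l => (hsK' l).conjTranspose.mul_comm hsH hS')
    (fun l k => (hsK' l).conjTranspose.mul_comm (hsK k) hS')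
    (fun l k => (hsK' l).conjTranspose.mul_comm (hsK k).conjTranspose hS')
  exact ContinuousLinearMap.ext fun X => LinearMap.congr_fun this X

lemma IsLindbladianOn.dissipative {S : Set (Site D L)} {T : SuperOp (Joint b)}
    (h : IsLindbladianOn S T) : Dissipative (opCLM T) := by
  obtain ⟨H, p, K, hH, -, -, hT⟩ := h
  exact IsLindbladForm.dissipative (K := K) hT hH

/-- Locality in the Heisenberg picture: `A` passes through `T`, and the range of `T` is traceless.
-/
lemma IsLindbladianOn.precomp_eq_zero {S S' : Set (Site D L)} {T : SuperOp (Joint b)}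
    (h : IsLindbladianOn S T) {A : Matrix (Joint b) (Joint b) ℂ}
    (hA : SupportedOn Joint.coord S' A) (hS : Disjoint S S') :
    precomp (trFun A) (opCLM T) = 0 := by
  obtain ⟨H, p, K, -, hsH, hsK, hT⟩ := h
  have hform : IsLindbladForm T H K := hT
  refine ContinuousLinearMap.ext fun (X : Matrix (Joint b) (Joint b) ℂ) => ?_
  change (A * T X).trace = 0
  have hS' := hS.symm
  rw [← hform.map_mul_left (hA.mul_comm hsH hS') (fun k => hA.mul_comm (hsK k) hS')
    (fun k => hA.mul_comm (hsK k).conjTranspose hS'), hform.trace_eq_zero]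

end Support

/-! ### Distances and cardinalities on the lattice -/

section Lattice

variable {D L : ℕ} {per : Bool}

lemma axisDist_self (a : Fin (2 * L + 1)) : axisDist per a a = 0 := by
  unfold axisDist; split_ifs <;> simp

lemma axisDist_comm (a b : Fin (2 * L + 1)) : axisDist per a b = axisDist per b a := by
  unfold axisDist; split_ifs <;> omega

lemma axisDist_triangle (a b c : Fin (2 * L + 1)) :
    axisDist per a c ≤ axisDist per a b + axisDist per b c := by
  have ha := a.2
  have hb := b.2
  have hc := c.2
  unfold axisDist; split_ifs <;> omega

lemma axisDist_le (a b : Fin (2 * L + 1)) : axisDist per a b ≤ 2 * L := by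
  have ha := a.2
  have hb := b.2
  unfold axisDist; split_ifs <;> omega

/-- Congruences modulo `2 L + 1` treat open and periodic boundaries alike: going around the axis
only changes the displacement by one period. -/
lemma exists_modEq_of_axisDist_le {a b : Fin (2 * L + 1)} {m : ℕ} (h : axisDist per a b ≤ m) :
    ∃ e : ℤ, -m ≤ e ∧ e ≤ m ∧ (a : ℤ) ≡ b + e [ZMOD (2 * L + 1 : ℕ)] := by
  have ha := a.2
  have hb := b.2
  have h0 : ((a : ℤ) - b).natAbs ≤ m ∨ 2 * L + 1 - ((a : ℤ) - b).natAbs ≤ m := by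
    unfold axisDist at h; split_ifs at h <;> omega
  rcases h0 with h0 | h0
  · exact ⟨(a : ℤ) - b, by omega, by omega, by rw [add_sub_cancel]⟩
  · rcases le_total (a : ℤ) b with hab | hab
    · refine ⟨(a : ℤ) - b + (2 * L + 1 : ℕ), by omega, by omega, ?_⟩
      exact Int.modEq_iff_dvd.2 ⟨1, by ring⟩
    · refine ⟨(a : ℤ) - b - (2 * L + 1 : ℕ), by omega, by omega, ?_⟩
      exact Int.modEq_iff_dvd.2 ⟨-1, by ring⟩

lemma siteDist_le_iff {u v : Site D L} {m : ℕ} :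
    siteDist per u v ≤ m ↔ ∀ i, axisDist per (u i) (v i) ≤ m := by
  simp [siteDist, Finset.sup_le_iff]

lemma siteDist_self (u : Site D L) : siteDist per u u = 0 :=
  Nat.le_zero.1 (siteDist_le_iff.2 fun i => (axisDist_self (u i)).le)

lemma siteDist_comm (u v : Site D L) : siteDist per u v = siteDist per v u := by
  unfold siteDist; simp_rw [axisDist_comm (u _) (v _)]

lemma siteDist_triangle (u v w : Site D L) :
    siteDist per u w ≤ siteDist per u v + siteDist per v w :=
  siteDist_le_iff.2 fun i => (axisDist_triangle _ (v i) _).trans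
    (add_le_add (siteDist_le_iff.1 le_rfl i) (siteDist_le_iff.1 le_rfl i))

lemma siteDist_le (u v : Site D L) : siteDist per u v ≤ 2 * L :=
  siteDist_le_iff.2 fun _ => axisDist_le _ _

/-- A region whose sites are, on each axis, congruent to one of `k` consecutive integers has at
most `k ^ D` sites. -/
lemma ncard_le_of_modEq {R : Set (Site D L)} {k : ℕ} {c : Fin D → ℤ}
    (h : ∀ u ∈ R, ∀ i, ∃ s < k, ((u i : ℕ) : ℤ) ≡ c i + (s : ℕ) [ZMOD (2 * L + 1 : ℕ)]) :
    R.ncard ≤ k ^ D := by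
  classical
  choose! f hf hfm using h
  let F : Site D L → Fin D → ℕ := fun u i => f u i
  have hmaps : ∀ u ∈ R, F u ∈ (↑(Fintype.piFinset fun _ : Fin D => Finset.range k) :
      Set (Fin D → ℕ)) := by
    intro u hu
    simp only [Finset.mem_coe, Fintype.mem_piFinset, Finset.mem_range]
    exact hf u hu
  have hinj : Set.InjOn F R := by
    intro u hu v hv huv
    funext i
    have h1 := hfm u hu i
    have h2 := hfm v hv i
    have h3 : f u i = f v i := congrFun huv i
    rw [h3] at h1
    have h4 := h1.trans h2.symm
    have h5 := (Int.natCast_modEq_iff.1 h4)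
    exact Fin.ext (h5.eq_of_lt_of_lt (u i).2 (v i).2)
  have := Set.ncard_le_ncard_of_injOn F hmaps hinj (Finset.finite_toSet _)
  rwa [Set.ncard_coe_finset, Fintype.card_piFinset, Finset.prod_const, Finset.card_range,
    Finset.card_univ, Fintype.card_fin] at this

lemma FitsInCube.exists_modEq {k : ℕ} {S : Set (Site D L)} (h : FitsInCube per k S) :
    ∃ c : Site D L, ∀ u ∈ S, ∀ i, ∃ s < k,
      ((u i : ℕ) : ℤ) ≡ ((c i : ℕ) : ℤ) + (s : ℕ) [ZMOD (2 * L + 1 : ℕ)] := by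
  obtain ⟨c, hc⟩ := h
  refine ⟨c, fun u hu i => ?_⟩
  obtain ⟨s, hs, h⟩ := hc u hu i
  refine ⟨s, hs, ?_⟩
  rw [h]
  split_ifs
  · push_cast
    exact Int.mod_modEq _ _
  · push_cast; rfl

lemma FitsInCube.ncard_le {k : ℕ} {S : Set (Site D L)} (h : FitsInCube per k S) :
    S.ncard ≤ k ^ D := by
  obtain ⟨c, hc⟩ := h.exists_modEq
  exact ncard_le_of_modEq hc

lemma FitsInCube.ncard_enlarge_le {k : ℕ} {S : Set (Site D L)} (h : FitsInCube per k S) (r : ℕ) :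
    (enlarge per S r).ncard ≤ (2 * r + k) ^ D := by
  obtain ⟨c, hc⟩ := h.exists_modEq
  -- Moving the corner by `-r` puts the new offset `s + e + r` into `[0, 2 r + k)`.
  refine ncard_le_of_modEq (c := fun i => (c i : ℕ) - (r : ℤ)) fun w ⟨u, hu, hw⟩ i => ?_
  obtain ⟨s, hs, h1⟩ := hc u hu i
  obtain ⟨e, he, he', h2⟩ := exists_modEq_of_axisDist_le (siteDist_le_iff.1 hw i)
  refine ⟨(s + e + r).toNat, by omega, ?_⟩
  have h3 : ((s + e + r).toNat : ℤ) = s + e + r := Int.toNat_of_nonneg (by omega)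
  rw [h3]
  refine h2.trans ((h1.add_right e).trans ?_)
  have h4 : (c i : ℤ) + s + e = (c i : ℤ) - r + (s + e + r) := by ring
  rw [h4]

lemma fitsInCube_singleton (per : Bool) (u : Site D L) : FitsInCube per 1 {u} := by
  refine ⟨u, fun v hv i => ⟨0, one_pos, ?_⟩⟩
  rw [Set.mem_singleton_iff.1 hv, add_zero, Nat.mod_eq_of_lt (u i).2]
  simp

lemma fitsInCube_univ (per : Bool) : FitsInCube per (2 * L + 1) (Set.univ : Set (Site D L)) := by
  refine ⟨fun _ => 0, fun v _ i => ⟨v i, (v i).2, ?_⟩⟩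
  simp [Nat.mod_eq_of_lt (v i).2]

lemma mem_ball_self (u : Site D L) (r : ℕ) : u ∈ ball per u r := by
  simp [ball, siteDist_self]

lemma enlarge_mono (S : Set (Site D L)) {r r' : ℕ} (h : r ≤ r') :
    enlarge per S r ⊆ enlarge per S r' := fun _ ⟨v, hv, hd⟩ => ⟨v, hv, hd.trans h⟩

lemma subset_bulk_enlarge (S : Set (Site D L)) {r : ℕ} (h : 1 ≤ r) :
    S ⊆ bulk per (enlarge per S r) := fun u hu _ hv =>
  ⟨u, hu, ((siteDist_comm _ _).le.trans hv).trans h⟩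

lemma enlarge_eq_univ {S : Set (Site D L)} (hS : S.Nonempty) {r : ℕ} (h : 2 * L ≤ r) :
    enlarge per S r = Set.univ := by
  obtain ⟨v, hv⟩ := hS
  exact Set.eq_univ_of_forall fun u => ⟨v, hv, (siteDist_le u v).trans h⟩

lemma relevantSites_subset (r₀ r : ℕ) (S : Set (Site D L)) :
    relevantSites per r₀ r S ⊆ enlarge per S (r₀ + r) := by
  rintro j ⟨u, hju, v, hv, huv⟩
  exact ⟨v, hv, (siteDist_triangle j u v).trans (add_le_add hju huv)⟩

lemma mem_relevantSites_of_ball_subset {r₀ r : ℕ} {S : Set (Site D L)} {j : Site D L}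
    (h : ball per j r₀ ⊆ enlarge per S r) : j ∈ relevantSites per r₀ r S :=
  ⟨j, mem_ball_self j r₀, h (mem_ball_self j r₀)⟩

open Classical in
/-- The distance of a site from a region. -/
def distTo (per : Bool) (S : Set (Site D L)) (j : Site D L) : ℕ :=
  sInf {m | j ∈ enlarge per S m}

/-- For empty `S` the infimum in `distTo` takes the default value `0`, hence the nonemptiness
assumption here and in what follows. -/
lemma mem_enlarge_iff {S : Set (Site D L)} (hS : S.Nonempty) {j : Site D L} {m : ℕ} :
    j ∈ enlarge per S m ↔ distTo per S j ≤ m := by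
  refine ⟨fun h => Nat.sInf_le h, fun h => enlarge_mono S h ?_⟩
  refine Nat.sInf_mem (s := {m | j ∈ enlarge per S m}) ⟨2 * L, ?_⟩
  rw [Set.mem_ofPred_eq, enlarge_eq_univ hS le_rfl]; trivial

lemma distTo_le_add {S : Set (Site D L)} (hS : S.Nonempty) (i j : Site D L) :
    distTo per S j ≤ distTo per S i + siteDist per i j := by
  rw [← mem_enlarge_iff hS]
  obtain ⟨v, hv, hd⟩ := (mem_enlarge_iff (per := per) hS (j := i)).2 le_rfl
  refine ⟨v, hv, (siteDist_triangle j i v).trans ?_⟩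
  rw [siteDist_comm j i, add_comm]
  exact add_le_add_left hd _

open Classical in
/-- The sites `i` such that the balls of radius `r₀` around `i` and `j` meet. -/
def nearSites (per : Bool) (r₀ : ℕ) (j : Site D L) : Finset (Site D L) :=
  Finset.univ.filter fun i => ¬ Disjoint (ball per i r₀) (ball per j r₀)

lemma siteDist_le_of_mem_nearSites {r₀ : ℕ} {i j : Site D L} (h : i ∈ nearSites per r₀ j) :
    siteDist per i j ≤ 2 * r₀ := by
  simp only [nearSites, Finset.mem_filter, Finset.mem_univ, true_and, Set.not_disjoint_iff] at h
  obtain ⟨u, hu, hu'⟩ := h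
  have := siteDist_triangle (per := per) i u j
  rw [siteDist_comm u j] at this
  have h1 : siteDist per i u ≤ r₀ := hu
  have h2 : siteDist per j u ≤ r₀ := hu'
  omega

lemma card_nearSites_le (r₀ : ℕ) (j : Site D L) :
    (nearSites per r₀ j).card ≤ (2 * (2 * r₀) + 1) ^ D := by
  rw [← Set.ncard_coe_finset]
  refine (Set.ncard_le_ncard (fun i hi => ?_) (Set.toFinite _)).trans
    ((fitsInCube_singleton per j).ncard_enlarge_le (2 * r₀))
  exact ⟨j, rfl, siteDist_le_of_mem_nearSites hi⟩

end Lattice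

/-! ### Local observables: spatial insensitivity and expansion in the parameters -/

namespace Family

open NormedSpace

variable {D L ℓ : ℕ} (P : Family D L ℓ)

open Classical in
/-- The local terms of `L_R(x)`. -/
def localTerm (r₀ : ℕ) (R : Set (Site D L)) (x : Param D L ℓ) (j : Site D L) :
    SuperOp (Joint P.b) :=
  if ball P.per j r₀ ⊆ R then P.term j (x j) else P.refTerm j

lemma opCLM_mixedGen (r₀ : ℕ) (R : Set (Site D L)) (x : Param D L ℓ) :
    opCLM (P.mixedGen r₀ R x) = ∑ j, opCLM (P.localTerm r₀ R x j) := by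
  unfold mixedGen localTerm
  rw [map_sum]

/-- The expectation of the qubit observable `O` after evolving the reference state under
`L_R(x)` for time `t`. -/
def expect (r₀ : ℕ) (R : Set (Site D L)) (O : Matrix (Conf D L) (Conf D L) ℂ) (t : ℝ)
    (x : Param D L ℓ) : ℂ :=
  ((O ⊗ₖ (1 : Matrix (Anc P.b) (Anc P.b) ℂ)) *
    evolve (P.mixedGen r₀ R x) t (P.refState ⊗ₖ P.refAnc)).trace

/-- The observable `O` on the qubits, as a functional on the joint system. -/
def obs (O : Matrix (Conf D L) (Conf D L) ℂ) : TM (Joint P.b) →L[ℂ] ℂ :=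
  trFun (O ⊗ₖ (1 : Matrix (Anc P.b) (Anc P.b) ℂ))

lemma norm_obs_le (O : Matrix (Conf D L) (Conf D L) ℂ) : ‖P.obs O‖ ≤ opNorm O :=
  (norm_trFun_le _).trans (opNorm_kronecker_one_le O)

/-- The reference state of the joint system. -/
def ref : TM (Joint P.b) := P.refState ⊗ₖ P.refAnc

lemma expect_eq (r₀ : ℕ) (R : Set (Site D L)) (O : Matrix (Conf D L) (Conf D L) ℂ) (t : ℝ)
    (x : Param D L ℓ) :
    P.expect r₀ R O t x = P.obs O (exp (t • ∑ j, opCLM (P.localTerm r₀ R x j)) P.ref) := by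
  unfold expect
  rw [evolve_eq_exp, opCLM_mixedGen]
  rfl

variable {P} {r₀ κ : ℕ} {J a g : ℝ}

lemma trace_kronecker_one_mul {O ρ : Matrix (Conf D L) (Conf D L) ℂ}
    {ω : Matrix (Anc P.b) (Anc P.b) ℂ} (hω : ω.trace = 1) :
    ((O ⊗ₖ (1 : Matrix (Anc P.b) (Anc P.b) ℂ)) * (ρ ⊗ₖ ω)).trace = (O * ρ).trace := by
  rw [← Matrix.mul_kronecker_mul, Matrix.trace_kronecker, Matrix.one_mul, hω, mul_one]

namespace IsSteadyStatePhase

variable (hP : P.IsSteadyStatePhase r₀ J a κ g)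
include hP

lemma norm_ref_le : ‖P.ref‖ ≤ 1 := by
  refine traceNorm_le_one_of_isDensity (I := Joint P.b) ⟨?_, ?_⟩
  · exact hP.density_ref.1.1.kronecker hP.density_ref.2.1
  · change (P.refState ⊗ₖ P.refAnc).trace = 1
    rw [Matrix.trace_kronecker, hP.density_ref.1.2, hP.density_ref.2.2, one_mul]

lemma isLocalTerm {x : Param D L ℓ} (hx : x ∈ cube D L ℓ) (R : Set (Site D L)) (j : Site D L) :
    IsLocalTerm P.per r₀ J j (P.localTerm r₀ R x j) := by
  unfold localTerm
  split_ifs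
  · exact hP.local_term j (x j) ⟨fun i => hx.1 j i, fun i => hx.2 j i⟩
  · exact hP.local_ref j

lemma norm_exp_sum_le {x : Param D L ℓ} (hx : x ∈ cube D L ℓ) (R : Set (Site D L))
    (s : Finset (Site D L)) {t : ℝ} (ht : 0 ≤ t) :
    ‖exp (t • ∑ j ∈ s, opCLM (P.localTerm r₀ R x j))‖ ≤ 1 :=
  (dissipative_sum norm_one_TM_le s _ fun j _ =>
    (hP.isLocalTerm hx R j).1.dissipative).norm_exp_le_one ht

/-- A Lieb-Robinson bound for a local observable and one local term. -/
lemma norm_obs_exp_mul_le (hJ : 0 ≤ J) {S : Set (Site D L)} (hS : S.Nonempty)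
    {O : Matrix (Conf D L) (Conf D L) ℂ} (hO : QubitSupportedOn S O) {c : ℝ} (hc : 0 < c)
    (hcJ : J * ((2 * (2 * r₀) + 1) ^ D : ℕ) * Real.exp (2 * r₀) ≤ c)
    {x : Param D L ℓ} (hx : x ∈ cube D L ℓ) (R : Set (Site D L)) (j : Site D L)
    (K : SuperOp (Joint P.b)) (hK : IsLocalTerm P.per r₀ J j K) {s : ℝ} (hs : 0 ≤ s) :
    ‖precomp (P.obs O) (exp (s • ∑ i, opCLM (P.localTerm r₀ R x i)) * opCLM K)‖ ≤
      2 * (opNorm O * J * Real.exp r₀) * Real.exp (2 * c * s) *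
        Real.exp (-(distTo P.per S j : ℝ)) := by
  have hO0 := opNorm_nonneg O
  have hnorm : ∀ j (K : SuperOp (Joint P.b)), IsLocalTerm P.per r₀ J j K → ‖opCLM K‖ ≤ J :=
    fun j K hK => norm_opCLM_le hJ fun X => hK.2.traceNorm_le hJ X
  have h0 : ∀ j (K : SuperOp (Joint P.b)), IsLocalTerm P.per r₀ J j K →
      ‖precomp (P.obs O) (opCLM K)‖ ≤
        (opNorm O * J * Real.exp r₀) * Real.exp (-(distTo P.per S j : ℝ)) := by
    intro j K hK
    -- A term whose ball misses `S` is invisible at time `0`. Any other term sits within `r₀` of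
    -- `S`, and the factor `exp r₀` makes up for its weight.
    by_cases hd : Disjoint (ball P.per j r₀) S
    · have : precomp (P.obs O) (opCLM K) = 0 := hK.1.precomp_eq_zero hO.kronecker_one hd
      rw [this, norm_zero]; positivity
    · obtain ⟨u, hu, huS⟩ := Set.not_disjoint_iff.1 hd
      have hdj : distTo P.per S j ≤ r₀ := (mem_enlarge_iff hS).1 ⟨u, huS, hu⟩
      have h1 : ‖precomp (P.obs O) (opCLM K)‖ ≤ opNorm O * J :=
        (ContinuousLinearMap.opNorm_comp_le _ _).trans
          (mul_le_mul (P.norm_obs_le O) (hnorm j K hK) (norm_nonneg _) hO0)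
      refine h1.trans ?_
      rw [mul_assoc _ (Real.exp _), ← Real.exp_add]
      refine le_mul_of_one_le_right (by positivity) (Real.one_le_exp ?_)
      have : (distTo P.per S j : ℝ) ≤ r₀ := by exact_mod_cast hdj
      linarith
  have hcomm : ∀ j (K : SuperOp (Joint P.b)), IsLocalTerm P.per r₀ J j K →
      ∀ i ∉ nearSites P.per r₀ j, Commute (opCLM (P.localTerm r₀ R x i)) (opCLM K) := by
    intro j K hK i hi
    refine (hP.isLocalTerm hx R i).1.commute hK.1 ?_
    simpa [nearSites] using hi
  -- Terms that fail to commute have centres within `2 r₀` of each other: this bounds their number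
  -- by `(4 r₀ + 1) ^ D` and the ratio of their weights by `exp (2 r₀)`.
  refine lieb_robinson (E := Real.exp (2 * r₀)) (N := (2 * (2 * r₀) + 1) ^ D)
    (w := fun j => Real.exp (-(distTo P.per S j : ℝ)))
    (norm_precomp_mul_le (P.obs O)) (fun s t ht => hP.norm_exp_sum_le hx R s ht) hJ
    (Real.exp_pos _).le (by positivity) hc hcJ (fun i => Real.exp_pos _) (nearSites P.per r₀)
    (fun j => hcomm j _ (hP.isLocalTerm hx R j)) (card_nearSites_le r₀) ?_
    (fun j => hnorm j _ (hP.isLocalTerm hx R j)) (fun j => h0 j _ (hP.isLocalTerm hx R j))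
    (hcomm j K hK) (hnorm j K hK) (h0 j K hK) hs
  intro j i hi
  rw [← Real.exp_add]
  refine Real.exp_le_exp.2 ?_
  have h1 := distTo_le_add (per := P.per) hS i j
  have h2 := siteDist_le_of_mem_nearSites hi
  have h3 : (distTo P.per S j : ℝ) ≤ distTo P.per S i + 2 * r₀ := by
    exact_mod_cast h1.trans (Nat.add_le_add_left h2 _)
  linarith

/-- Insensitivity of local observables to the terms of the Lindbladian outside of a large region. -/
lemma norm_expect_enlarge_sub_le (hJ : 0 ≤ J) {S : Set (Site D L)} (hS : S.Nonempty)
    {O : Matrix (Conf D L) (Conf D L) ℂ} (hO : QubitSupportedOn S O) {c : ℝ} (hc : 0 < c)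
    (hcJ : J * ((2 * (2 * r₀) + 1) ^ D : ℕ) * Real.exp (2 * r₀) ≤ c)
    {x : Param D L ℓ} (hx : x ∈ cube D L ℓ) (m : ℕ) {t : ℝ} (ht : 0 ≤ t) :
    ‖P.expect r₀ (enlarge P.per S (m + 1)) O t x - P.expect r₀ (enlarge P.per S m) O t x‖ ≤
      opNorm O * (t * ((enlarge P.per S (m + 1)).ncard *
        (4 * J * Real.exp (2 * r₀) * Real.exp (2 * c * t - (m + 1))))) := by
  classical
  set R' := enlarge P.per S (m + 1)
  set R := enlarge P.per S m
  have hRR' : R ⊆ R' := enlarge_mono S (Nat.le_succ m)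
  set T' := fun j => opCLM (P.localTerm r₀ R' x j)
  set T := fun j => opCLM (P.localTerm r₀ R x j)
  set Φ := precomp (P.obs O)
  have hLR := hP.norm_obs_exp_mul_le hJ hS hO hc hcJ hx R'
  -- the terms that differ
  set Q : Finset (Site D L) := (Set.toFinite R').toFinset with hQ
  have hdiff : ∀ j, j ∉ Q → T' j = T j := by
    intro j hj
    have h1 : ¬ ball P.per j r₀ ⊆ R' := fun h => hj (by
      rw [hQ, Set.Finite.mem_toFinset]; exact h (mem_ball_self j r₀))
    simp only [T, T', localTerm, if_neg h1, if_neg fun h => h1 (Set.Subset.trans h hRR')]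
  have hsum : ∑ j, T' j - ∑ j, T j = ∑ j ∈ Q, (T' j - T j) := by
    rw [← Finset.sum_sub_distrib]
    symm
    refine Finset.sum_subset (Finset.subset_univ _) fun j _ hj => ?_
    rw [hdiff j hj, sub_self]
  set bound := 4 * J * Real.exp (2 * r₀) * Real.exp (2 * c * t - (m + 1)) with hbound
  have hterm : ∀ s : ℝ, 0 ≤ s → s ≤ t → ∀ j, ‖Φ (exp (s • ∑ i, T' i) * (T' j - T j))‖ ≤
      opNorm O * bound := by
    intro s hs hst j
    have hO0 := opNorm_nonneg O
    by_cases hsub : ball P.per j r₀ ⊆ R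
    · have : T' j = T j := by
        simp only [T, T', localTerm, if_pos hsub, if_pos (hsub.trans hRR')]
      rw [this, sub_self, mul_zero, map_zero, norm_zero]; positivity
    -- A ball that leaves `S(m)` has its centre at distance at least `m + 1 - r₀` from `S`; this
    -- loss of `r₀` turns `exp r₀` into `exp (2 r₀)`.
    · obtain ⟨u, hu, huR⟩ := Set.not_subset.1 hsub
      have h1 : m < distTo P.per S u := by
        by_contra h
        exact huR ((mem_enlarge_iff hS).2 (not_lt.1 h))
      have h2 := distTo_le_add (per := P.per) hS j u
      have h3 : siteDist P.per j u ≤ r₀ := hu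
      have h4 : (m + 1 : ℝ) ≤ distTo P.per S j + r₀ := by
        have : m + 1 ≤ distTo P.per S j + r₀ := by omega
        exact_mod_cast this
      rw [mul_sub, map_sub]
      have h5 := hLR j _ (hP.isLocalTerm hx R' j) hs
      have h6 := hLR j _ (hP.isLocalTerm hx R j) hs
      have h7 : Real.exp r₀ * (Real.exp (2 * c * s) * Real.exp (-(distTo P.per S j : ℝ))) ≤
          Real.exp (2 * r₀) * Real.exp (2 * c * t - (m + 1)) := by
        rw [← Real.exp_add, ← Real.exp_add, ← Real.exp_add]
        refine Real.exp_le_exp.2 ?_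
        have : 2 * c * s ≤ 2 * c * t := by gcongr
        linarith
      calc _ ≤ 4 * (opNorm O * J) * (Real.exp r₀ * (Real.exp (2 * c * s) * Real.exp (-(distTo P.per S j : ℝ)))) := by
            refine (norm_sub_le _ _).trans ((add_le_add h5 h6).trans (le_of_eq ?_)); ring
        _ ≤ 4 * (opNorm O * J) * (Real.exp (2 * r₀) * Real.exp (2 * c * t - (m + 1))) := by gcongr
        _ = _ := by rw [hbound]; ring
  have hΦ : ‖Φ (exp (t • ∑ j, T' j) - exp (t • ∑ j, T j))‖ ≤ Q.card * (opNorm O * bound) * t := by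
    refine norm_map_exp_sub_exp_le (norm_precomp_mul_le _)
      (fun t ht => hP.norm_exp_sum_le hx R Finset.univ ht) ht fun s hs hst => ?_
    rw [hsum, Finset.mul_sum, map_sum]
    refine (norm_sum_le _ _).trans ((Finset.sum_le_card_nsmul _ _ _ fun j _ =>
      hterm s hs hst j).trans (le_of_eq ?_))
    rw [nsmul_eq_mul]
  rw [expect_eq, expect_eq, ← map_sub]
  calc _ = ‖Φ (exp (t • ∑ j, T' j) - exp (t • ∑ j, T j)) P.ref‖ := rfl
    _ ≤ ‖Φ (exp (t • ∑ j, T' j) - exp (t • ∑ j, T j))‖ * 1 :=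
      (ContinuousLinearMap.le_opNorm _ _).trans (by gcongr; exact hP.norm_ref_le)
    _ ≤ Q.card * (opNorm O * bound) * t := by rw [mul_one]; exact hΦ
    _ = _ := by rw [hQ, ← Set.ncard_eq_toFinset_card]; ring

/-- This is compatibility with `W = ∅`, where the evolution starts from the reference state. The
sign of `a` is not prescribed, hence `|a|`. -/
lemma norm_expect_sub_le {S R : Set (Site D L)} (hSR : S ⊆ bulk P.per R)
    {O : Matrix (Conf D L) (Conf D L) ℂ} (hO : QubitSupportedOn S O)
    {x : Param D L ℓ} (hx : x ∈ cube D L ℓ) {t : ℝ} (ht : 0 ≤ t) :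
    ‖P.expect r₀ R O t x - (O * P.limState R x).trace‖ ≤
      opNorm O * (|a| * (R.ncard : ℝ) ^ κ * Real.exp (-g * t)) := by
  have h := hP.compatible x hx S R ∅ hSR (Or.inr rfl) O hO t ht
  rw [hP.lim_empty x hx, Matrix.mul_sub, Matrix.trace_sub,
    trace_kronecker_one_mul (hP.density_lim R x hx).2.2] at h
  refine h.trans ?_
  rw [mul_comm]
  have := opNorm_nonneg O
  gcongr
  exact le_abs_self a

end IsSteadyStatePhase

/-- Change of one parameter. -/
def _root_.SteadyPhase.Param.update {D L ℓ : ℕ} (x : Param D L ℓ) (j : Site D L) (i : Fin ℓ)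
    (h : ℝ) : Param D L ℓ := Function.update x j (Function.update (x j) i h)

lemma _root_.SteadyPhase.Param.update_apply {D L ℓ : ℕ} (x : Param D L ℓ) (j : Site D L)
    (i : Fin ℓ) (h : ℝ) (j' : Site D L) (i' : Fin ℓ) :
    x.update j i h j' i' = if j' = j ∧ i' = i then h else x j' i' := by
  unfold Param.update
  by_cases hj : j' = j
  · subst hj
    by_cases hi : i' = i
    · subst hi; simp
    · simp [hi]
  · simp [hj]

lemma _root_.SteadyPhase.mem_cube_iff {D L ℓ : ℕ} {x : Param D L ℓ} :
    x ∈ cube D L ℓ ↔ ∀ j i, x j i ∈ Set.Icc (-1 : ℝ) 1 :=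
  ⟨fun h j i => ⟨h.1 j i, h.2 j i⟩, fun h => ⟨fun j i => (h j i).1, fun j i => (h j i).2⟩⟩

lemma _root_.SteadyPhase.Param.update_mem_cube {D L ℓ : ℕ} {x : Param D L ℓ} (hx : x ∈ cube D L ℓ)
    (j : Site D L) (i : Fin ℓ) {h : ℝ} (hh : h ∈ Set.Icc (-1 : ℝ) 1) :
    x.update j i h ∈ cube D L ℓ := by
  rw [mem_cube_iff] at hx ⊢
  intro j' i'
  rw [Param.update_apply]
  split_ifs
  · exact hh
  · exact hx j' i'

lemma term_update (j : Site D L) (y : Fin ℓ → ℝ) (i : Fin ℓ) (h : ℝ) :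
    P.term j (Function.update y i h) = P.term j (Function.update y i 0) + (h : ℂ) • P.dir j i := by
  have key : ∀ h : ℝ, ∑ k, ((Function.update y i h k : ℝ) : ℂ) • P.dir j k =
      (h : ℂ) • P.dir j i + ∑ k ∈ Finset.univ.erase i, ((y k : ℝ) : ℂ) • P.dir j k := by
    intro h
    rw [← Finset.add_sum_erase _ _ (Finset.mem_univ i), Function.update_self]
    congr 1
    exact Finset.sum_congr rfl fun k hk => by rw [Function.update_of_ne (Finset.ne_of_mem_erase hk)]
  unfold term
  rw [key, key 0]
  simp only [Complex.ofReal_zero, zero_smul, zero_add]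
  abel

namespace IsSteadyStatePhase

variable (hP : P.IsSteadyStatePhase r₀ J a κ g)
include hP

/-- Each direction is half the difference of two admissible local terms, those at `±1` on its axis.
-/
lemma norm_dir_le (hJ : 0 ≤ J) (j : Site D L) (i : Fin ℓ) : ‖opCLM (P.dir j i)‖ ≤ J := by
  have hmem : ∀ h ∈ Set.Icc (-1 : ℝ) 1, Function.update (0 : Fin ℓ → ℝ) i h ∈
      Set.Icc (-1 : Fin ℓ → ℝ) 1 := by
    intro h hh
    constructor <;> intro k <;> by_cases hk : k = i
    · subst hk; simpa using hh.1
    · simp [hk]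
    · subst hk; simpa using hh.2
    · simp [hk]
  have hn : ∀ h ∈ Set.Icc (-1 : ℝ) 1,
      ‖opCLM (P.term j (Function.update (0 : Fin ℓ → ℝ) i h))‖ ≤ J := fun h hh =>
    norm_opCLM_le hJ fun X => (hP.local_term j _ (hmem h hh)).2.traceNorm_le hJ X
  have h1 := hn 1 (by norm_num)
  have h2 := hn (-1) (by norm_num)
  have h3 : (2 : ℂ) • opCLM (P.dir j i) =
      opCLM (P.term j (Function.update (0 : Fin ℓ → ℝ) i 1)) -
      opCLM (P.term j (Function.update (0 : Fin ℓ → ℝ) i (-1))) := by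
    rw [term_update j 0 i 1, term_update j 0 i (-1), ← map_sub, ← map_smul]
    congr 1
    push_cast
    module
  have h4 := (congrArg norm h3).le.trans (norm_sub_le _ _)
  rw [norm_smul, Complex.norm_ofNat] at h4
  linarith

omit hP in
lemma _root_.SteadyPhase.Family.localTerm_update_of_not_subset {R : Set (Site D L)} (x : Param D L ℓ) (j : Site D L)
    (i : Fin ℓ) (hj : ¬ ball P.per j r₀ ⊆ R) (h : ℝ) (k : Site D L) :
    P.localTerm r₀ R (x.update j i h) k = P.localTerm r₀ R x k := by
  unfold localTerm
  by_cases hk : k = j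
  · subst hk; rw [if_neg hj, if_neg hj]
  · rw [Param.update, Function.update_of_ne hk]

/-- First-order expansion of expectations in one of the parameters. -/
lemma exists_expect_expansion (hJ : 0 ≤ J) {R : Set (Site D L)}
    (O : Matrix (Conf D L) (Conf D L) ℂ) {x : Param D L ℓ} (hx : x ∈ cube D L ℓ) (j : Site D L)
    (i : Fin ℓ) {t : ℝ} (ht : 0 ≤ t) {h : ℝ} (hh : h ∈ Set.Icc (-1 : ℝ) 1) :
    ∃ q : ℂ, ∀ h' ∈ Set.Icc (-1 : ℝ) 1,
      ‖P.expect r₀ R O t (x.update j i h') - P.expect r₀ R O t (x.update j i h) -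
        (h' - h : ℝ) • q‖ ≤ opNorm O * (J * t) ^ 2 * (h' - h) ^ 2 := by
  classical
  set A := ∑ k, opCLM (P.localTerm r₀ R (x.update j i 0) k)
  set B : TM (Joint P.b) →L[ℂ] TM (Joint P.b) :=
    if ball P.per j r₀ ⊆ R then opCLM (P.dir j i) else 0
  have hB : ‖B‖ ≤ J := by
    simp only [B]; split_ifs
    · exact hP.norm_dir_le hJ j i
    · simpa using hJ
  have hAB : ∀ h : ℝ, ∑ k, opCLM (P.localTerm r₀ R (x.update j i h) k) = A + h • B := by
    intro h
    by_cases hj : ball P.per j r₀ ⊆ R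
    · have h1 : ∀ k, opCLM (P.localTerm r₀ R (x.update j i h) k) =
          opCLM (P.localTerm r₀ R (x.update j i 0) k) + if k = j then h • B else 0 := by
        intro k
        by_cases hk : k = j
        · subst hk
          simp only [localTerm, if_pos hj, if_true, Param.update, Function.update_self, B]
          rw [term_update, map_add, map_smul]
          rfl
        · simp only [localTerm, if_neg hk, Param.update, Function.update_of_ne hk, add_zero]
      simp_rw [h1, Finset.sum_add_distrib]
      simp [A]
    · simp only [A, B, if_neg hj, smul_zero, add_zero]
      refine Finset.sum_congr rfl fun k _ => ?_
      rw [localTerm_update_of_not_subset x j i hj, localTerm_update_of_not_subset x j i hj]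
  obtain ⟨Q, hQ⟩ := exists_exp_affine_expansion (A := A) (B := B) (fun h hh t ht => by
    rw [← hAB]
    exact hP.norm_exp_sum_le (Param.update_mem_cube hx j i hh) R Finset.univ ht) ht hh
  refine ⟨P.obs O (Q P.ref), fun h' hh' => ?_⟩
  have h1 := hQ h' hh'
  rw [expect_eq, expect_eq, hAB, hAB]
  have h2 : P.obs O (exp (t • (A + h' • B)) P.ref) - P.obs O (exp (t • (A + h • B)) P.ref) -
      (h' - h : ℝ) • P.obs O (Q P.ref) =
      P.obs O ((exp (t • (A + h' • B)) - exp (t • (A + h • B)) - (h' - h) • Q) P.ref) := by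
    rw [sub_apply, sub_apply, map_sub, map_sub]
    congr 1
    change _ = P.obs O (((h' - h : ℝ) : ℂ) • Q P.ref)
    rw [map_smul]; rfl
  rw [h2]
  have hO := opNorm_nonneg O
  calc _ ≤ opNorm O * ((‖B‖ * t) ^ 2 * (h' - h) ^ 2 * 1) := by
        refine (ContinuousLinearMap.le_opNorm _ _).trans
          (mul_le_mul (P.norm_obs_le O) ?_ (norm_nonneg _) hO)
        exact (ContinuousLinearMap.le_opNorm _ _).trans
          (mul_le_mul h1 hP.norm_ref_le (norm_nonneg _) (by positivity))
    _ ≤ opNorm O * ((J * t) ^ 2 * (h' - h) ^ 2 * 1) := by gcongr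
    _ = _ := by ring

end IsSteadyStatePhase

end Family

/-- A coordinatewise Lipschitz function on the cube is Lipschitz. -/
lemma norm_sub_le_of_coordinatewise {D L ℓ : ℕ} {G : Param D L ℓ → ℂ} {Λ : Site D L → ℝ}
    (hG : ∀ x ∈ cube D L ℓ, ∀ j i, ∀ h ∈ Set.Icc (-1 : ℝ) 1, ∀ h' ∈ Set.Icc (-1 : ℝ) 1,
      ‖G (x.update j i h') - G (x.update j i h)‖ ≤ Λ j * |h' - h|)
    {x x' : Param D L ℓ} (hx : x ∈ cube D L ℓ) (hx' : x' ∈ cube D L ℓ) :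
    ‖G x' - G x‖ ≤ ∑ j, ∑ i, Λ j * |x' j i - x j i| := by
  classical
  -- Hybrid points, which pass from `x` to `x'` one coordinate at a time.
  let z : Finset (Site D L × Fin ℓ) → Param D L ℓ := fun s j i =>
    if (j, i) ∈ s then x' j i else x j i
  have hz : ∀ s, z s ∈ cube D L ℓ := fun s => mem_cube_iff.2 fun j i => by
    simp only [z]; split_ifs
    · exact mem_cube_iff.1 hx' j i
    · exact mem_cube_iff.1 hx j i
  have key : ∀ s : Finset (Site D L × Fin ℓ),
      ‖G (z s) - G x‖ ≤ ∑ q ∈ s, Λ q.1 * |x' q.1 q.2 - x q.1 q.2| := by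
    intro s
    induction s using Finset.induction_on with
    | empty =>
      have : z ∅ = x := by funext j i; simp [z]
      rw [this]; simp
    | insert q s hq ih =>
      have h1 : z (insert q s) = (z s).update q.1 q.2 (x' q.1 q.2) := by
        funext j i
        rw [Param.update_apply]
        by_cases h : j = q.1 ∧ i = q.2
        · obtain ⟨rfl, rfl⟩ := h; simp [z]
        · have : (j, i) ≠ q := fun h' => h ⟨congrArg Prod.fst h', congrArg Prod.snd h'⟩
          simp [z, h, this]
      have h2 : z s = (z s).update q.1 q.2 (x q.1 q.2) := by
        funext j i
        rw [Param.update_apply]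
        split_ifs with h
        · obtain ⟨rfl, rfl⟩ := h; simp [z, hq]
        · rfl
      have h3 := hG (z s) (hz s) q.1 q.2 _ (mem_cube_iff.1 hx q.1 q.2) _
        (mem_cube_iff.1 hx' q.1 q.2)
      rw [← h1, ← h2] at h3
      rw [Finset.sum_insert hq]
      calc ‖G (z (insert q s)) - G x‖ ≤ ‖G (z (insert q s)) - G (z s)‖ + ‖G (z s) - G x‖ :=
            norm_sub_le_norm_sub_add_norm_sub _ _ _
        _ ≤ _ := add_le_add h3 ih
  have h := key Finset.univ
  have h1 : z Finset.univ = x' := by funext j i; simp [z]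
  rwa [h1, Fintype.sum_prod_type] at h

lemma exists_pow_le_exp (p : ℕ) {c : ℝ} (hc : 0 < c) :
    ∃ C : ℝ, 0 < C ∧ ∀ k : ℕ, ((k : ℝ) + 1) ^ p ≤ C * Real.exp (c * k) := by
  -- From `y ^ p / p! ≤ exp y` at `y = c (k + 1)`.
  refine ⟨p.factorial * Real.exp c / c ^ p, by positivity, fun k => ?_⟩
  have h := Real.pow_div_factorial_le_exp (c * (k + 1)) (by positivity) p
  rw [div_le_iff₀ (by positivity), mul_pow, mul_add, mul_one, Real.exp_add] at h
  rw [div_mul_eq_mul_div, le_div_iff₀ (by positivity)]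
  linarith

/-! ### Local stability of the steady state -/

namespace Family

/-- The approximations of a steady-state expectation by evolutions for short times in small
regions converge exponentially fast. -/
lemma exists_norm_expect_step_le (D r₀ k₀ κ : ℕ) {J a g τ c : ℝ} (hJ : 0 ≤ J) (hg : 0 < g)
    (hτ : 0 < τ) (hc : 0 < c) (hcτ : 2 * c * τ = 1 / 2)
    (hcJ : J * ((2 * (2 * r₀) + 1) ^ D : ℕ) * Real.exp (2 * r₀) ≤ c) :
    ∃ E : ℝ, 0 < E ∧ ∃ η : ℝ, 0 < η ∧ η < 1 ∧
      ∀ (L ℓ : ℕ) (P : Family D L ℓ), P.IsSteadyStatePhase r₀ J a κ g →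
      ∀ S : Set (Site D L), S.Nonempty → FitsInCube P.per k₀ S →
      ∀ O : Matrix (Conf D L) (Conf D L) ℂ, QubitSupportedOn S O →
      ∀ x ∈ cube D L ℓ, ∀ k : ℕ,
        ‖P.expect r₀ (enlarge P.per S (k + 1 + 1)) O (τ * ((k + 1 : ℕ) : ℝ)) x -
          P.expect r₀ (enlarge P.per S (k + 1)) O (τ * k) x‖ ≤
        opNorm O * (E * ((η ^ k) ^ 2) ^ 2) := by
  -- The space and time errors both decay like `exp (-2 μ k)`. Half of this rate absorbs the
  -- polynomial factors, and the remaining `exp (-μ k)` is written as a fourth power of `η ^ k`: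
  -- interpolation will take a square root, and half of what is left will absorb further
  -- polynomials.
  set μ := min (1 / 2) (g * τ) / 2 with hμdef
  have hμ : 0 < μ := by positivity
  have hμ1 : 2 * μ ≤ 1 / 2 := by rw [hμdef]; linarith [min_le_left (1 / 2) (g * τ)]
  have hμ2 : 2 * μ ≤ g * τ := by rw [hμdef]; linarith [min_le_right (1 / 2) (g * τ)]
  set b : ℝ := 4 + k₀
  set p := D + 1 + D * κ
  obtain ⟨C, hC, hpoly⟩ := exists_pow_le_exp p hμ
  set A₁ := τ * b ^ D * (4 * J * Real.exp (2 * r₀))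
  set A₂ := 2 * |a| * b ^ (D * κ)
  have hb : 0 < b := by positivity
  have hA₁ : 0 ≤ A₁ := by positivity
  have hA₂ : 0 ≤ A₂ := by positivity
  refine ⟨(A₁ + A₂ + 1) * C, by positivity, Real.exp (-(μ / 4)), Real.exp_pos _,
    Real.exp_lt_one_iff.2 (by linarith), ?_⟩
  intro L ℓ P hP S hS hfit O hO x hx k
  have hO0 := opNorm_nonneg O
  have hη : ((Real.exp (-(μ / 4)) ^ k) ^ 2) ^ 2 = Real.exp (-(2 * μ * k)) * Real.exp (μ * k) := by
    rw [← Real.exp_nat_mul, ← Real.exp_nat_mul, ← Real.exp_nat_mul, ← Real.exp_add]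
    congr 1; push_cast; ring
  have hk1 : (1 : ℝ) ≤ (k : ℝ) + 1 := by
    have : (0 : ℝ) ≤ k := Nat.cast_nonneg k
    linarith
  have hcard1 : ((enlarge P.per S (k + 1 + 1)).ncard : ℝ) ≤ b ^ D * (k + 1) ^ D := by
    have h1 : ((enlarge P.per S (k + 1 + 1)).ncard : ℝ) ≤ (2 * (k + 1 + 1) + k₀ : ℝ) ^ D := by
      exact_mod_cast hfit.ncard_enlarge_le (k + 1 + 1)
    rw [← mul_pow]
    refine h1.trans (pow_le_pow_left₀ (by positivity) ?_ D)
    simp only [b]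
    nlinarith [Nat.cast_nonneg (α := ℝ) k, Nat.cast_nonneg (α := ℝ) k₀]
  have hcard2 : ((enlarge P.per S (k + 1)).ncard : ℝ) ≤ b ^ D * (k + 1) ^ D := by
    refine le_trans ?_ hcard1
    exact_mod_cast Set.ncard_le_ncard (enlarge_mono S (Nat.le_succ (k + 1))) (Set.toFinite _)
  have hspace := hP.norm_expect_enlarge_sub_le hJ hS hO hc hcJ hx (k + 1)
    (t := τ * ((k + 1 : ℕ) : ℝ)) (by positivity)
  have hsub : S ⊆ bulk P.per (enlarge P.per S (k + 1)) := subset_bulk_enlarge S (by omega)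
  have htime1 := hP.norm_expect_sub_le hsub hO hx (t := τ * ((k + 1 : ℕ) : ℝ)) (by positivity)
  have htime2 := hP.norm_expect_sub_le hsub hO hx (t := τ * k) (by positivity)
  set R := enlarge P.per S (k + 1)
  set R' := enlarge P.per S (k + 1 + 1)
  -- At time `τ (k + 1)` the light cone contributes `exp ((k + 1) / 2)`, against the decay `exp (-(k
  -- + 2))` over the distance to the edge of the region.
  have he0 : Real.exp (2 * c * (τ * ((k + 1 : ℕ) : ℝ)) - (((k + 1 : ℕ) : ℝ) + 1)) ≤
      Real.exp (-(2 * μ * k)) := by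
    refine Real.exp_le_exp.2 ?_
    have h1 : 2 * c * (τ * ((k + 1 : ℕ) : ℝ)) = 1 / 2 * (k + 1) := by
      rw [← hcτ]; push_cast; ring
    rw [h1]
    push_cast
    nlinarith [Nat.cast_nonneg (α := ℝ) k]
  have he2 : Real.exp (-g * (τ * k)) ≤ Real.exp (-(2 * μ * k)) := by
    refine Real.exp_le_exp.2 ?_
    nlinarith [Nat.cast_nonneg (α := ℝ) k]
  have he1 : Real.exp (-g * (τ * ((k + 1 : ℕ) : ℝ))) ≤ Real.exp (-(2 * μ * k)) := by
    refine le_trans (Real.exp_le_exp.2 ?_) he2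
    push_cast
    nlinarith [mul_pos hg hτ]
  have hR : (R.ncard : ℝ) ^ κ ≤ b ^ (D * κ) * (k + 1) ^ (D * κ) := by
    rw [pow_mul, pow_mul, ← mul_pow]
    exact pow_le_pow_left₀ (by positivity) hcard2 κ
  have hp1 : ((k : ℝ) + 1) ^ (D + 1) ≤ (k + 1) ^ p :=
    pow_le_pow_right₀ hk1 (by simp only [p]; omega)
  have hp2 : ((k : ℝ) + 1) ^ (D * κ) ≤ (k + 1) ^ p :=
    pow_le_pow_right₀ hk1 (by simp only [p]; omega)
  set e := Real.exp (-(2 * μ * k)) with he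
  have hepos : 0 < e := Real.exp_pos _
  have hsp : τ * ((k + 1 : ℕ) : ℝ) * (R'.ncard * (4 * J * Real.exp (2 * r₀) *
      Real.exp (2 * c * (τ * ((k + 1 : ℕ) : ℝ)) - (((k + 1 : ℕ) : ℝ) + 1)))) ≤
      A₁ * (k + 1) ^ p * e := by
    calc _ ≤ τ * ((k + 1 : ℕ) : ℝ) * (b ^ D * (k + 1) ^ D * (4 * J * Real.exp (2 * r₀) * e)) := by
          gcongr
      _ = A₁ * (k + 1) ^ (D + 1) * e := by simp only [A₁]; push_cast; ring
      _ ≤ _ := by gcongr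
  have ht : |a| * (R.ncard : ℝ) ^ κ * Real.exp (-g * (τ * ((k + 1 : ℕ) : ℝ))) +
      |a| * (R.ncard : ℝ) ^ κ * Real.exp (-g * (τ * k)) ≤ A₂ * (k + 1) ^ p * e := by
    calc _ ≤ |a| * (b ^ (D * κ) * (k + 1) ^ (D * κ)) * e +
          |a| * (b ^ (D * κ) * (k + 1) ^ (D * κ)) * e := by gcongr
      _ = A₂ * (k + 1) ^ (D * κ) * e := by simp only [A₂]; ring
      _ ≤ _ := by gcongr
  -- The region is changed at the later time; then the two times are compared within the smaller
  -- region, through its limit state.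
  have htri : ‖P.expect r₀ R' O (τ * ((k + 1 : ℕ) : ℝ)) x - P.expect r₀ R O (τ * k) x‖ ≤
      ‖P.expect r₀ R' O (τ * ((k + 1 : ℕ) : ℝ)) x - P.expect r₀ R O (τ * ((k + 1 : ℕ) : ℝ)) x‖ +
      (‖P.expect r₀ R O (τ * ((k + 1 : ℕ) : ℝ)) x - (O * P.limState R x).trace‖ +
        ‖P.expect r₀ R O (τ * k) x - (O * P.limState R x).trace‖) := by
    refine (norm_sub_le_norm_sub_add_norm_sub _ (P.expect r₀ R O (τ * ((k + 1 : ℕ) : ℝ)) x) _).trans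
      ?_
    gcongr
    refine (norm_sub_le_norm_sub_add_norm_sub _ (O * P.limState R x).trace _).trans ?_
    rw [norm_sub_rev (O * P.limState R x).trace]
  calc _ ≤ opNorm O * (A₁ * (k + 1) ^ p * e) + opNorm O * (A₂ * (k + 1) ^ p * e) := by
        refine htri.trans (add_le_add (hspace.trans (by gcongr)) ?_)
        refine (add_le_add htime1 htime2).trans ?_
        rw [← mul_add]
        gcongr
    _ = opNorm O * ((A₁ + A₂) * e * (k + 1) ^ p) := by ring
    _ ≤ opNorm O * ((A₁ + A₂ + 1) * e * (C * Real.exp (μ * k))) := by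
        have h1 : A₁ + A₂ ≤ A₁ + A₂ + 1 := by linarith
        have h2 := hpoly k
        gcongr
    _ = _ := by rw [hη]; ring

/-- Expectations of local observables in the steady state depend smoothly on the parameters close
to the support of the observable, and only weakly on the others. -/
theorem exists_local_stability (D r₀ k₀ ℓ κ : ℕ) {J a g : ℝ} (hJ : 0 < J) (hg : 0 < g) :
    ∃ C : ℝ, 0 < C ∧ ∃ η : ℝ, 0 < η ∧ η < 1 ∧
      ∀ (L : ℕ) (P : Family D L ℓ), P.IsSteadyStatePhase r₀ J a κ g →
      ∀ S : Set (Site D L), FitsInCube P.per k₀ S →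
      ∀ O : Matrix (Conf D L) (Conf D L) ℂ, QubitSupportedOn S O →
      ∀ (r : ℕ) (γ : ℝ), 0 ≤ γ → ∀ x ∈ cube D L ℓ, ∀ x' ∈ cube D L ℓ,
        (∀ j ∈ relevantSites P.per r₀ r S, ∀ i, |x j i - x' j i| ≤ γ) →
        ‖(O * P.steady x).trace - (O * P.steady x').trace‖ ≤ C * (γ + η ^ r) * opNorm O := by
  set c : ℝ := J * ((2 * (2 * r₀) + 1) ^ D : ℕ) * Real.exp (2 * r₀)
  have hc : 0 < c := by positivity
  set τ : ℝ := 1 / (4 * c)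
  have hτ : 0 < τ := by positivity
  have hcτ : 2 * c * τ = 1 / 2 := by simp only [τ]; field_simp; norm_num
  obtain ⟨E, hE, η, hη, hη1, hstep⟩ := exists_norm_expect_step_le D r₀ k₀ κ (a := a) hJ.le hg hτ hc
    hcτ le_rfl
  obtain ⟨C₁, hC₁, hpoly⟩ := exists_pow_le_exp (D + 2) (c := -Real.log η)
    (neg_pos.2 (Real.log_neg hη hη1))
  set b : ℝ := 4 + k₀
  set Λ : ℝ := 2 * E + 4 * (J * τ) ^ 2
  set E₂ : ℝ := b ^ D * ℓ * Λ * C₁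
  have hE₂ : 0 ≤ E₂ := by positivity
  set C : ℝ := (E₂ + 2 * E * η⁻¹) * (1 - η)⁻¹
  have h1η : 0 < 1 - η := by linarith
  refine ⟨C, by positivity, η, hη, hη1, ?_⟩
  intro L P hP S hfit O hO r γ hγ x hx x' hx' hclose
  have hO0 := opNorm_nonneg O
  rcases S.eq_empty_or_nonempty with hSe | hS
  · -- a scalar observable
    have hscalar : ∀ ρ : Matrix (Conf D L) (Conf D L) ℂ,
        (O * ρ).trace = O (fun _ => 0) (fun _ => 0) * ρ.trace := by
      intro ρ
      rw [hSe] at hO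
      have h1 : ∀ σ τ, O σ τ = if σ = τ then O (fun _ => 0) (fun _ => 0) else 0 := by
        intro σ τ
        split_ifs with h
        · subst h
          exact hO.2 _ _ _ _ (fun v hv => hv.elim) (fun v hv => hv.elim) (fun _ _ => rfl)
            (fun _ _ => rfl)
        · obtain ⟨v, hv⟩ := Function.ne_iff.1 h
          exact hO.1 σ τ ⟨v, fun h => h, hv⟩
      have h2 : O = O (fun _ => 0) (fun _ => 0) • (1 : Matrix (Conf D L) (Conf D L) ℂ) := by
        ext σ τ
        rw [h1, Matrix.smul_apply, Matrix.one_apply]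
        split_ifs <;> simp
      conv_lhs => rw [h2]
      rw [Matrix.smul_mul, one_mul, Matrix.trace_smul, smul_eq_mul]
    have htr : ∀ x ∈ cube D L ℓ, (P.steady x).trace = 1 := fun x hx =>
      (hP.density_lim Set.univ x hx).1.2
    rw [hscalar, hscalar, htr x hx, htr x' hx', sub_self, norm_zero]
    positivity
  set ψ : ℕ → Param D L ℓ → ℂ := fun k x =>
    P.expect r₀ (enlarge P.per S (k + 1)) O (τ * k) x with hψ
  have hδ : ∀ k, ∀ x ∈ cube D L ℓ,
      ‖ψ (k + 1) x - ψ k x‖ ≤ opNorm O * (E * ((η ^ k) ^ 2) ^ 2) := fun k x hx =>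
    hstep L ℓ P hP S hS hfit O hO x hx k
  -- Lipschitz bound for one step
  have hlip : ∀ k : ℕ, k + 1 + 1 ≤ r →
      ‖(ψ (k + 1) x' - ψ k x') - (ψ (k + 1) x - ψ k x)‖ ≤ opNorm O * (γ * E₂ * η ^ k) := by
    intro k hk
    classical
    set R := enlarge P.per S (k + 1)
    set R' := enlarge P.per S (k + 1 + 1) with hR'
    have hRR' : R ⊆ R' := enlarge_mono S (Nat.le_succ _)
    set Lk : ℝ := opNorm O * (Λ * (k + 1) ^ 2 * (η ^ k) ^ 2)
    have hLk : 0 ≤ Lk := by positivity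
    have hcoord := norm_sub_le_of_coordinatewise (G := fun x => ψ (k + 1) x - ψ k x)
      (Λ := fun j => if ball P.per j r₀ ⊆ R' then Lk else 0) (fun z hz j i h hh h' hh' => by
        by_cases hj : ball P.per j r₀ ⊆ R'
        · simp only [if_pos hj]
          -- With `θ = (η ^ k) ^ 2` the bound on the increment is exactly the `E θ²` of the
          -- interpolation lemma. The curvature is quadratic in the evolution time, hence of order
          -- `(k + 1) ^ 2`.
          have := norm_sub_le_of_quadratic_expansion
            (ψ := fun h => ψ (k + 1) (z.update j i h) - ψ k (z.update j i h))
            (E := opNorm O * E) (K := opNorm O * (2 * (J * τ) ^ 2 * (k + 1) ^ 2))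
            (θ := (η ^ k) ^ 2) (by positivity) (by positivity) (by positivity)
            (pow_le_one₀ (by positivity) (pow_le_one₀ hη.le hη1.le))
            (fun h hh => by
              rw [mul_assoc]; exact hδ k _ (Param.update_mem_cube hz j i hh))
            (fun h hh => by
              obtain ⟨q₁, hq₁⟩ := hP.exists_expect_expansion hJ.le (R := R') O hz j i
                (t := τ * ((k + 1 : ℕ) : ℝ)) (by positivity) hh
              obtain ⟨q₂, hq₂⟩ := hP.exists_expect_expansion hJ.le (R := R) O hz j i
                (t := τ * k) (by positivity) hh
              refine ⟨q₁ - q₂, fun h' hh' => ?_⟩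
              have e1 : ∀ a₁ a₂ b₁ b₂ : ℂ, a₁ - a₂ - (b₁ - b₂) - (h' - h : ℝ) • (q₁ - q₂) =
                  (a₁ - b₁ - (h' - h : ℝ) • q₁) - (a₂ - b₂ - (h' - h : ℝ) • q₂) := by
                intro a₁ a₂ b₁ b₂; rw [smul_sub]; abel
              rw [e1]
              refine (norm_sub_le _ _).trans ((add_le_add (hq₁ h' hh') (hq₂ h' hh')).trans ?_)
              have e2 : (J * (τ * k)) ^ 2 ≤ (J * τ) ^ 2 * (k + 1) ^ 2 := by
                rw [← mul_pow, ← mul_assoc]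
                gcongr
                linarith
              have e3 : (J * (τ * ((k + 1 : ℕ) : ℝ))) ^ 2 = (J * τ) ^ 2 * (k + 1) ^ 2 := by
                push_cast; ring
              rw [e3, ← add_mul, ← mul_add]
              have e4 : (J * τ) ^ 2 * ((k : ℝ) + 1) ^ 2 + (J * (τ * k)) ^ 2 ≤
                  2 * (J * τ) ^ 2 * (k + 1) ^ 2 := by linarith
              gcongr) hh hh'
          refine this.trans ?_
          refine mul_le_mul_of_nonneg_right ?_ (abs_nonneg _)
          have e5 : (2 * E + 2 * (2 * (J * τ) ^ 2 * (k + 1) ^ 2)) ≤ Λ * (k + 1) ^ 2 := by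
            have : (1 : ℝ) ≤ ((k : ℝ) + 1) ^ 2 := one_le_pow₀ (by linarith [Nat.cast_nonneg (α := ℝ) k])
            simp only [Λ]
            nlinarith
          calc _ = opNorm O * ((2 * E + 2 * (2 * (J * τ) ^ 2 * (k + 1) ^ 2)) * (η ^ k) ^ 2) := by ring
            _ ≤ Lk := by simp only [Lk]; gcongr
        · have hj' : ¬ ball P.per j r₀ ⊆ R := fun h => hj (h.trans hRR')
          simp only [if_neg hj, zero_mul, hψ]
          have e1 : ∀ h, P.expect r₀ R' O (τ * ((k + 1 : ℕ) : ℝ)) (z.update j i h) =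
              P.expect r₀ R' O (τ * ((k + 1 : ℕ) : ℝ)) z := fun h => by
            rw [expect_eq, expect_eq]; simp_rw [localTerm_update_of_not_subset z j i hj]
          have e2 : ∀ h, P.expect r₀ R O (τ * k) (z.update j i h) =
              P.expect r₀ R O (τ * k) z := fun h => by
            rw [expect_eq, expect_eq]; simp_rw [localTerm_update_of_not_subset z j i hj']
          rw [e1, e1, e2, e2, sub_self, norm_zero]) hx hx'
    refine hcoord.trans ?_
    set Q : Finset (Site D L) := (Set.toFinite R').toFinset with hQ
    have hle : ∑ j, ∑ i, (if ball P.per j r₀ ⊆ R' then Lk else 0) * |x' j i - x j i| ≤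
        ∑ j ∈ Q, ∑ _i : Fin ℓ, Lk * γ := by
      rw [← Finset.sum_subset (Finset.subset_univ Q)]
      · refine Finset.sum_le_sum fun j _ => Finset.sum_le_sum fun i _ => ?_
        split_ifs with hj
        · refine mul_le_mul_of_nonneg_left ?_ hLk
          rw [abs_sub_comm]
          exact hclose j (mem_relevantSites_of_ball_subset (hj.trans (enlarge_mono S hk))) i
        · rw [zero_mul]; positivity
      · intro j _ hj
        have : ¬ ball P.per j r₀ ⊆ R' := fun h => hj (by
          rw [hQ, Set.Finite.mem_toFinset]; exact h (mem_ball_self j r₀))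
        simp [this]
    refine hle.trans ?_
    have hcard : (Q.card : ℝ) ≤ b ^ D * (k + 1) ^ D := by
      rw [hQ, ← Set.ncard_eq_toFinset_card]
      have h1 : (R'.ncard : ℝ) ≤ (2 * (k + 1 + 1) + k₀ : ℝ) ^ D := by
        exact_mod_cast hfit.ncard_enlarge_le (k + 1 + 1)
      rw [← mul_pow]
      refine h1.trans (pow_le_pow_left₀ (by positivity) ?_ D)
      simp only [b]
      nlinarith [Nat.cast_nonneg (α := ℝ) k, Nat.cast_nonneg (α := ℝ) k₀]
    -- One of the two factors `η ^ k` in the slope is spent here: the power `D` counts the sites of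
    -- the region and the extra `2` comes from the curvature. The other factor makes the steps
    -- summable.
    have hηk : ((k : ℝ) + 1) ^ (D + 2) * η ^ k ≤ C₁ := by
      have h1 := hpoly k
      have h2 : Real.exp (-Real.log η * k) = (η ^ k)⁻¹ := by
        rw [neg_mul, Real.exp_neg, mul_comm, Real.exp_nat_mul, Real.exp_log hη]
      rw [h2] at h1
      rw [← le_div_iff₀ (by positivity)]
      exact h1
    rw [Finset.sum_const, Finset.sum_const, Finset.card_univ, Fintype.card_fin, nsmul_eq_mul,
      nsmul_eq_mul]
    calc (Q.card : ℝ) * (ℓ * (Lk * γ)) ≤ (b ^ D * (k + 1) ^ D) * (ℓ * (Lk * γ)) := by gcongr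
      _ = opNorm O * (γ * (b ^ D * ℓ * Λ * ((k + 1) ^ (D + 2) * η ^ k)) * η ^ k) := by
          simp only [Lk]; ring
      _ ≤ opNorm O * (γ * (b ^ D * ℓ * Λ * C₁) * η ^ k) := by gcongr
      _ = _ := rfl
  -- sum of the steps
  have hone : ∀ k, ‖(ψ (k + 1) x' - ψ k x') - (ψ (k + 1) x - ψ k x)‖ ≤
      opNorm O * ((γ * E₂ + 2 * E * η⁻¹ * η ^ r) * η ^ k) := by
    intro k
    -- While the larger region `S(k + 2)` stays inside `S(r)`, all parameters involved are close.
    -- Afterwards `k + 1 ≥ r`, and the size of the increments alone supplies `η ^ r`, up to a factor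
    -- `η⁻¹`.
    by_cases hk : k + 1 + 1 ≤ r
    · refine (hlip k hk).trans ?_
      have : 0 ≤ 2 * E * η⁻¹ * η ^ r := by positivity
      gcongr
      linarith
    · refine (norm_sub_le _ _).trans ((add_le_add (hδ k x' hx') (hδ k x hx)).trans ?_)
      have h1 : ((η ^ k) ^ 2) ^ 2 ≤ η⁻¹ * η ^ r * η ^ k := by
        have h2 : η ^ k * η ≤ η ^ r := by
          rw [← pow_succ]; exact pow_le_pow_of_le_one hη.le hη1.le (by omega)
        have h3 : η ^ k ≤ η⁻¹ * η ^ r := by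
          rw [inv_mul_eq_div, le_div_iff₀ hη]; exact h2
        have h4 : η ^ k ≤ 1 := pow_le_one₀ hη.le hη1.le
        have h5 : 0 < η ^ k := by positivity
        calc ((η ^ k) ^ 2) ^ 2 = (η ^ k * η ^ k) * (η ^ k * η ^ k) := by ring
          _ ≤ (η ^ k * η ^ k) * 1 := by
            gcongr; exact mul_le_one₀ h4 h5.le h4
          _ = η ^ k * η ^ k := mul_one _
          _ ≤ _ := by gcongr
      have h6 : 0 ≤ γ * E₂ * η ^ k := by positivity
      calc _ = opNorm O * (2 * E * ((η ^ k) ^ 2) ^ 2) := by ring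
        _ ≤ opNorm O * (2 * E * (η⁻¹ * η ^ r * η ^ k)) := by gcongr
        _ ≤ _ := by
          refine mul_le_mul_of_nonneg_left ?_ hO0
          linarith
  have hzero : ∀ x x' : Param D L ℓ, ψ 0 x = ψ 0 x' := by
    intro x x'
    simp only [hψ, expect_eq, Nat.cast_zero, mul_zero, zero_smul]
  have hpart : ∀ K, ‖ψ K x' - ψ K x‖ ≤ C * (γ + η ^ r) * opNorm O := by
    intro K
    have h1 : ψ K x' - ψ K x =
        ∑ k ∈ Finset.range K, ((ψ (k + 1) x' - ψ k x') - (ψ (k + 1) x - ψ k x)) := by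
      rw [Finset.sum_sub_distrib, Finset.sum_range_sub (fun k => ψ k x'),
        Finset.sum_range_sub (fun k => ψ k x), hzero x x']
      abel
    rw [h1]
    refine (norm_sum_le _ _).trans ((Finset.sum_le_sum fun k _ => hone k).trans ?_)
    rw [← Finset.mul_sum, ← Finset.mul_sum]
    have h2 : ∑ k ∈ Finset.range K, η ^ k ≤ (1 - η)⁻¹ := by
      rw [← tsum_geometric_of_lt_one hη.le hη1]
      exact (summable_geometric_of_lt_one hη.le hη1).sum_le_tsum _ fun k _ => by positivity
    have h3 : γ * E₂ + 2 * E * η⁻¹ * η ^ r ≤ (E₂ + 2 * E * η⁻¹) * (γ + η ^ r) := by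
      have h4 : 0 ≤ E₂ * η ^ r := by positivity
      have h5 : 0 ≤ 2 * E * η⁻¹ * γ := by positivity
      linarith
    calc _ ≤ opNorm O * ((E₂ + 2 * E * η⁻¹) * (γ + η ^ r) * (1 - η)⁻¹) := by gcongr
      _ = _ := by simp only [C]; ring
  have hlim : ∀ x ∈ cube D L ℓ, Filter.Tendsto (fun K => ψ K x) Filter.atTop
      (𝓝 (O * P.steady x).trace) := by
    intro x hx
    rw [tendsto_iff_norm_sub_tendsto_zero]
    have hb : Filter.Tendsto (fun K : ℕ => opNorm O * (|a| *
        ((Set.univ : Set (Site D L)).ncard : ℝ) ^ κ * Real.exp (-(g * τ) * K)))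
        Filter.atTop (𝓝 0) := by
      have h1 : Filter.Tendsto (fun K : ℕ => Real.exp (-(g * τ) * K)) Filter.atTop (𝓝 0) := by
        refine Real.tendsto_exp_atBot.comp ?_
        exact tendsto_natCast_atTop_atTop.const_mul_atTop_of_neg (by nlinarith [mul_pos hg hτ])
      simpa using (h1.const_mul (|a| * ((Set.univ : Set (Site D L)).ncard : ℝ) ^ κ)).const_mul
        (opNorm O)
    refine squeeze_zero' (Filter.Eventually.of_forall fun _ => norm_nonneg _) ?_ hb
    -- From `K = 2 L` on the region is the whole lattice, so the limit state is the steady state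
    -- itself.
    filter_upwards [Filter.eventually_ge_atTop (2 * L)] with K hK
    have hu : enlarge P.per S (K + 1) = Set.univ := enlarge_eq_univ hS (by omega)
    have := hP.norm_expect_sub_le (S := S) (R := Set.univ) (fun _ _ _ _ => trivial) hO hx
      (t := τ * K) (by positivity)
    simp only [hψ, hu]
    refine this.trans (le_of_eq ?_)
    rw [show -g * (τ * K) = -(g * τ) * K by ring]
  have hfin := le_of_tendsto' ((hlim x' hx').sub (hlim x hx)).norm hpart
  rwa [norm_sub_rev] at hfin

end Family

/-! ### Classical shadows: unbiasedness and boundedness -/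

section Shadow

variable {D L : ℕ}

lemma tensor_mul (A B : Site D L → Matrix (Fin 2) (Fin 2) ℂ) :
    tensor A * tensor B = tensor fun j => A j * B j := by
  ext σ τ
  simp only [tensor, Matrix.mul_apply, Matrix.of_apply, ← Finset.prod_mul_distrib]
  rw [Finset.prod_univ_sum, Fintype.piFinset_univ]

lemma tensor_conjTranspose (A : Site D L → Matrix (Fin 2) (Fin 2) ℂ) :
    (tensor A).conjTranspose = tensor fun j => (A j).conjTranspose := by
  ext σ τ
  simp [tensor, Matrix.conjTranspose_apply]

lemma trace_mul_tensor (O : Matrix (Conf D L) (Conf D L) ℂ)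
    (B : Site D L → Matrix (Fin 2) (Fin 2) ℂ) :
    (O * tensor B).trace = ∑ σ, ∑ τ, O σ τ * ∏ j, B j (τ j) (σ j) := by
  simp [Matrix.trace, Matrix.mul_apply, tensor]

lemma eigenProj_conjTranspose (s : Fin 3 × Fin 2) : (eigenProj s).conjTranspose = eigenProj s := by
  obtain ⟨i, e⟩ := s
  ext p q
  fin_cases i <;> fin_cases e <;> fin_cases p <;> fin_cases q <;>
    simp [eigenProj, pauli, Matrix.conjTranspose_apply] <;> ring

lemma eigenProj_mul_self (s : Fin 3 × Fin 2) : eigenProj s * eigenProj s = eigenProj s := by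
  obtain ⟨i, e⟩ := s
  ext p q
  fin_cases i <;> fin_cases e <;> fin_cases p <;> fin_cases q <;>
    simp [eigenProj, pauli, Matrix.mul_apply, Fin.sum_univ_two, Matrix.one_apply] <;>
    ring_nf <;> simp <;> norm_num

lemma sum_eigenProj_apply (p q : Fin 2) :
    ∑ s : Fin 3 × Fin 2, eigenProj s p q = if p = q then 3 else 0 := by
  rw [Fintype.sum_prod_type]
  fin_cases p <;> fin_cases q <;>
    simp [eigenProj, pauli, Fin.sum_univ_two, Fin.sum_univ_three] <;>
    ring_nf

/-- The single-qubit shadow inverts the measurement channel. -/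
lemma sum_eigenProj_mul_shadow (a b c d : Fin 2) :
    ∑ s : Fin 3 × Fin 2, (1 / 3 : ℂ) * (eigenProj s a b * ((3 : ℂ) • eigenProj s - 1) c d) =
      if a = d ∧ b = c then 1 else 0 := by
  rw [Fintype.sum_prod_type]
  fin_cases a <;> fin_cases b <;> fin_cases c <;> fin_cases d <;>
    simp [eigenProj, pauli, Fin.sum_univ_two, Fin.sum_univ_three] <;>
    ring_nf <;> simp <;> norm_num

lemma trace_shadow_site (s : Fin 3 × Fin 2) : ((3 : ℂ) • eigenProj s - 1).trace = 1 := by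
  obtain ⟨i, e⟩ := s
  fin_cases i <;> fin_cases e <;>
    simp [eigenProj, pauli, Matrix.trace, Fin.sum_univ_two] <;> norm_num

lemma norm_shadow_site_le (s : Fin 3 × Fin 2) (p q : Fin 2) :
    ‖((3 : ℂ) • eigenProj s - 1) p q‖ ≤ 2 := by
  obtain ⟨i, e⟩ := s
  fin_cases i <;> fin_cases e <;> fin_cases p <;> fin_cases q <;>
    simp [eigenProj, pauli] <;> norm_num

/-- The tensor product `Q` of eigenprojections is a projection, so `tr (ρ Q) = tr (Q ρ Q*)` is real
and nonnegative. In particular the real part in `outcomeProb` discards nothing. -/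
lemma outcomeProb_nonneg {ρ : Matrix (Conf D L) (Conf D L) ℂ} (hρ : ρ.PosSemidef)
    (s : Outcome D L) :
    0 ≤ outcomeProb ρ s ∧ (outcomeProb ρ s : ℂ) =
      (1 / 3 : ℂ) ^ Fintype.card (Site D L) * (ρ * tensor fun j => eigenProj (s j)).trace := by
  set Q := tensor fun j => eigenProj (s j) with hQ
  have hQ1 : Q.conjTranspose = Q := by
    rw [hQ, tensor_conjTranspose]; simp only [eigenProj_conjTranspose]
  have hQ2 : Q * Q = Q := by rw [hQ, tensor_mul]; simp only [eigenProj_mul_self]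
  have h1 : (ρ * Q).trace = (Q * ρ * Q.conjTranspose).trace := by
    rw [hQ1, Matrix.trace_mul_comm (Q * ρ), ← Matrix.mul_assoc, hQ2, Matrix.trace_mul_comm]
  have h2 : 0 ≤ (ρ * Q).trace := by
    rw [h1]; exact (hρ.mul_mul_conjTranspose_same Q).trace_nonneg
  have h3 := Complex.nonneg_iff.1 h2
  refine ⟨mul_nonneg (by positivity) h3.1, ?_⟩
  have h4 : (((ρ * Q).trace.re : ℝ) : ℂ) = (ρ * Q).trace :=
    Complex.ext (by simp) (by simp [← h3.2])
  unfold outcomeProb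
  rw [Complex.ofReal_mul, h4]
  push_cast
  rfl

lemma sum_outcomeProb {ρ : Matrix (Conf D L) (Conf D L) ℂ} (hρ : IsDensity ρ) :
    ∑ s, outcomeProb ρ s = 1 := by
  have h : ((∑ s, outcomeProb ρ s : ℝ) : ℂ) = 1 := by
    rw [Complex.ofReal_sum]
    simp_rw [(outcomeProb_nonneg hρ.1 _).2, trace_mul_tensor]
    rw [← Finset.mul_sum, Finset.sum_comm]
    have h1 : ∀ σ : Conf D L, ∑ s : Outcome D L, ∑ τ, ρ σ τ * ∏ j, eigenProj (s j) (τ j) (σ j) =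
        3 ^ Fintype.card (Site D L) * ρ σ σ := by
      intro σ
      rw [Finset.sum_comm]
      have h2 : ∀ τ : Conf D L, ∑ s : Outcome D L, ρ σ τ * ∏ j, eigenProj (s j) (τ j) (σ j) =
          if τ = σ then 3 ^ Fintype.card (Site D L) * ρ σ σ else 0 := by
        intro τ
        rw [← Finset.mul_sum]
        have h3 := Finset.prod_univ_sum (fun _ : Site D L => (Finset.univ : Finset (Fin 3 × Fin 2)))
          (fun j s => eigenProj s (τ j) (σ j))
        rw [Fintype.piFinset_univ] at h3
        rw [← h3]
        simp_rw [sum_eigenProj_apply]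
        split_ifs with h
        · subst h; simp [mul_comm]
        · obtain ⟨j, hj⟩ := Function.ne_iff.1 h
          rw [Finset.prod_eq_zero (Finset.mem_univ j) (if_neg hj), mul_zero]
      simp_rw [h2]
      simp
    simp_rw [h1]
    rw [← Finset.mul_sum, ← mul_assoc, ← mul_pow]
    have h4 : ∑ σ, ρ σ σ = 1 := hρ.2
    rw [h4]; norm_num
  exact_mod_cast h

/-- The classical shadow is an unbiased estimator. -/
lemma sum_outcomeProb_mul_trace {ρ : Matrix (Conf D L) (Conf D L) ℂ} (hρ : ρ.PosSemidef)
    (O : Matrix (Conf D L) (Conf D L) ℂ) :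
    ∑ s, (outcomeProb ρ s : ℂ) * (O * shadow s).trace = (O * ρ).trace := by
  have h0 : ∀ s : Outcome D L, (O * shadow s).trace = ∑ σ, ∑ τ, O σ τ *
      ∏ j, ((3 : ℂ) • eigenProj (s j) - 1) (τ j) (σ j) := fun s => trace_mul_tensor O _
  simp_rw [(outcomeProb_nonneg hρ _).2, h0, trace_mul_tensor]
  have h1 : ∀ σ τ μ ν : Conf D L, ∑ s : Outcome D L, (1 / 3 : ℂ) ^ Fintype.card (Site D L) *
      ((∏ j, eigenProj (s j) (τ j) (σ j)) * ∏ j, ((3 : ℂ) • eigenProj (s j) - 1) (ν j) (μ j)) =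
      if τ = μ ∧ σ = ν then 1 else 0 := by
    intro σ τ μ ν
    have h2 := Finset.prod_univ_sum (fun _ : Site D L => (Finset.univ : Finset (Fin 3 × Fin 2)))
      (fun j s => (1 / 3 : ℂ) *
        (eigenProj s (τ j) (σ j) * ((3 : ℂ) • eigenProj s - 1) (ν j) (μ j)))
    rw [Fintype.piFinset_univ] at h2
    simp_rw [Finset.prod_mul_distrib, Finset.prod_const, Finset.card_univ,
      sum_eigenProj_mul_shadow] at h2
    rw [← h2]
    split_ifs with h
    · obtain ⟨rfl, rfl⟩ := h; simp
    · have : ∃ j, ¬ (τ j = μ j ∧ σ j = ν j) := by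
        by_contra hc
        push Not at hc
        exact h ⟨funext fun j => (hc j).1, funext fun j => (hc j).2⟩
      obtain ⟨j, hj⟩ := this
      exact Finset.prod_eq_zero (Finset.mem_univ j) (if_neg hj)
  calc _ = ∑ s : Outcome D L, ∑ σ, ∑ τ, ∑ μ, ∑ ν, ρ σ τ * O μ ν *
      ((1 / 3 : ℂ) ^ Fintype.card (Site D L) * ((∏ j, eigenProj (s j) (τ j) (σ j)) *
        ∏ j, ((3 : ℂ) • eigenProj (s j) - 1) (ν j) (μ j))) := by
        refine Finset.sum_congr rfl fun s _ => ?_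
        rw [mul_assoc, Finset.sum_mul, Finset.mul_sum]
        refine Finset.sum_congr rfl fun σ _ => ?_
        rw [Finset.sum_mul, Finset.mul_sum]
        refine Finset.sum_congr rfl fun τ _ => ?_
        rw [Finset.mul_sum, Finset.mul_sum]
        refine Finset.sum_congr rfl fun μ _ => ?_
        rw [Finset.mul_sum, Finset.mul_sum]
        refine Finset.sum_congr rfl fun ν _ => ?_
        ring
    _ = ∑ σ, ∑ τ, ∑ μ, ∑ ν, ρ σ τ * O μ ν * (if τ = μ ∧ σ = ν then 1 else 0) := by
        rw [Finset.sum_comm]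
        refine Finset.sum_congr rfl fun σ _ => ?_
        rw [Finset.sum_comm]
        refine Finset.sum_congr rfl fun τ _ => ?_
        rw [Finset.sum_comm]
        refine Finset.sum_congr rfl fun μ _ => ?_
        rw [Finset.sum_comm]
        refine Finset.sum_congr rfl fun ν _ => ?_
        rw [← Finset.mul_sum, h1]
    _ = ∑ σ, ∑ τ, ρ σ τ * O τ σ := by
        refine Finset.sum_congr rfl fun σ _ => Finset.sum_congr rfl fun τ _ => ?_
        rw [Finset.sum_eq_single τ, Finset.sum_eq_single σ]
        · simp
        · intro ν _ hν; simp [hν.symm]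
        · simp
        · intro μ _ hμ; simp [hμ.symm]
        · simp
    _ = (O * ρ).trace := by
        rw [Matrix.trace_mul_comm]
        simp [Matrix.trace, Matrix.mul_apply]

lemma trace_mul_shadow_eq_re {O : Matrix (Conf D L) (Conf D L) ℂ} (hO : O.IsHermitian)
    (s : Outcome D L) : (O * shadow s).trace = ((O * shadow s).trace.re : ℂ) := by
  have hs : (shadow s).conjTranspose = shadow s := by
    unfold shadow
    rw [tensor_conjTranspose]
    simp only [Matrix.conjTranspose_sub, Matrix.conjTranspose_smul, eigenProj_conjTranspose,
      Matrix.conjTranspose_one]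
    simp
  have h : star (O * shadow s).trace = (O * shadow s).trace := by
    rw [← Matrix.trace_conjTranspose, Matrix.conjTranspose_mul, hs, hO.eq, Matrix.trace_mul_comm]
  exact (Complex.conj_eq_iff_re.1 h).symm

lemma trace_mul_eq_re {O ρ : Matrix (Conf D L) (Conf D L) ℂ} (hO : O.IsHermitian)
    (hρ : ρ.IsHermitian) : (O * ρ).trace = ((O * ρ).trace.re : ℂ) := by
  have h : star (O * ρ).trace = (O * ρ).trace := by
    rw [← Matrix.trace_conjTranspose, Matrix.conjTranspose_mul, hρ.eq, hO.eq,
      Matrix.trace_mul_comm]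
  exact (Complex.conj_eq_iff_re.1 h).symm

/-- Estimators of local observables are bounded. -/
lemma norm_trace_mul_shadow_le {S : Set (Site D L)} {O : Matrix (Conf D L) (Conf D L) ℂ}
    (hO : QubitSupportedOn S O) (s : Outcome D L) :
    ‖(O * shadow s).trace‖ ≤ 8 ^ S.ncard * opNorm O := by
  classical
  set B : Site D L → Matrix (Fin 2) (Fin 2) ℂ := fun j => (3 : ℂ) • eigenProj (s j) - 1
  let e := Equiv.piEquivPiSubtypeProd (fun j : Site D L => j ∈ S) (fun _ => Fin 2)
  have hS : ∀ (a : {j // j ∈ S} → Fin 2) (c : {j // j ∉ S} → Fin 2) (j : Site D L) (hj : j ∈ S),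
      e.symm (a, c) j = a ⟨j, hj⟩ := fun a c j hj => by
    simp [e, Equiv.piEquivPiSubtypeProd, hj]
  have hS' : ∀ (a : {j // j ∈ S} → Fin 2) (c : {j // j ∉ S} → Fin 2) (j : Site D L) (hj : j ∉ S),
      e.symm (a, c) j = c ⟨j, hj⟩ := fun a c j hj => by
    simp [e, Equiv.piEquivPiSubtypeProd, hj]
  have h1 : (O * shadow s).trace = ∑ a, ∑ b, O (e.symm (a, 0)) (e.symm (b, 0)) *
      ∏ j : {j // j ∈ S}, B j (b j) (a j) := by
    have h2 : (O * shadow s).trace = ∑ σ, ∑ τ, O σ τ * ∏ j, B j (τ j) (σ j) :=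
      trace_mul_tensor O B
    rw [h2, ← e.symm.sum_comp, Fintype.sum_prod_type]
    refine Finset.sum_congr rfl fun a _ => ?_
    have h3 : ∀ c, ∑ τ, O (e.symm (a, c)) τ * ∏ j, B j (τ j) (e.symm (a, c) j) =
        ∑ b, O (e.symm (a, 0)) (e.symm (b, 0)) * (∏ j : {j // j ∈ S}, B j (b j) (a j)) *
          ∏ j : {j // j ∉ S}, B j (c j) (c j) := by
      intro c
      rw [← e.symm.sum_comp, Fintype.sum_prod_type]
      refine Finset.sum_congr rfl fun b _ => ?_
      rw [Finset.sum_eq_single c]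
      · rw [← Fintype.prod_subtype_mul_prod_subtype (fun j => j ∈ S), mul_assoc]
        congr 1
        · exact hO.2 _ _ _ _ (fun v hv => (hS _ _ v hv).trans (hS _ _ v hv).symm)
            (fun v hv => (hS _ _ v hv).trans (hS _ _ v hv).symm)
            (fun v hv => (hS' _ _ v hv).trans (hS' _ _ v hv).symm)
            (fun v hv => (hS' _ _ v hv).trans (hS' _ _ v hv).symm)
        · congr 1
          · refine Finset.prod_congr rfl fun j _ => ?_
            rw [hS _ _ _ j.2, hS _ _ _ j.2]
          · refine Finset.prod_congr rfl fun j _ => ?_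
            rw [hS' _ _ _ j.2, hS' _ _ _ j.2]
      · intro d _ hd
        obtain ⟨j, hj⟩ := Function.ne_iff.1 hd
        have hne : e.symm (a, c) j ≠ e.symm (b, d) j := by
          rw [hS' _ _ _ j.2, hS' _ _ _ j.2]; exact hj.symm
        rw [hO.1 _ _ ⟨j, j.2, hne⟩, zero_mul]
      · simp
    simp_rw [h3]
    rw [Finset.sum_comm]
    refine Finset.sum_congr rfl fun b _ => ?_
    rw [← Finset.mul_sum]
    have h4 := Finset.prod_univ_sum (fun _ : {j // j ∉ S} => (Finset.univ : Finset (Fin 2)))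
      (fun j p => B j p p)
    rw [Fintype.piFinset_univ] at h4
    rw [← h4]
    have h5 : ∀ j : {j // j ∉ S}, ∑ p, B j p p = 1 := fun j => trace_shadow_site (s j)
    simp_rw [h5]
    simp
  -- After the sites outside `S` have been traced out with factor `1`, there remain `2 ^ |S| · 2 ^
  -- |S|` pairs of local basis vectors, and the shadow has entries of size at most `2 ^ |S|`.
  have h6 : ∑ a : {j // j ∈ S} → Fin 2, ∑ b : {j // j ∈ S} → Fin 2,
      opNorm O * ∏ j : {j // j ∈ S}, (2 : ℝ) = 8 ^ S.ncard * opNorm O := by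
    simp only [Finset.sum_const, Finset.prod_const, Finset.card_univ, Fintype.card_fun,
      Fintype.card_fin, nsmul_eq_mul]
    have : Fintype.card {j // j ∈ S} = S.ncard := by
      rw [Set.ncard_eq_toFinset_card', Set.toFinset_card]
    rw [this]
    push_cast
    have h8 : (8 : ℝ) = 2 * (2 * 2) := by norm_num
    rw [h8, mul_pow, mul_pow]; ring
  rw [h1, ← h6]
  refine (norm_sum_le _ _).trans (Finset.sum_le_sum fun a _ => (norm_sum_le _ _).trans
    (Finset.sum_le_sum fun b _ => ?_))
  rw [norm_mul, norm_prod]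
  refine mul_le_mul (norm_entry_le_opNorm _ _ _) (Finset.prod_le_prod (fun _ _ => norm_nonneg _)
    fun j _ => norm_shadow_site_le _ _ _) (Finset.prod_nonneg fun _ _ => norm_nonneg _)
    (opNorm_nonneg O)

lemma norm_trace_mul_le_of_isDensity {I : Type*} [Fintype I] [DecidableEq I] (O : Matrix I I ℂ)
    {ρ : Matrix I I ℂ} (hρ : IsDensity ρ) : ‖(O * ρ).trace‖ ≤ opNorm O :=
  (norm_trace_mul_le O ρ).trans
    (mul_le_of_le_one_right (opNorm_nonneg O) (traceNorm_le_one_of_isDensity hρ))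

end Shadow

/-! ### A Chernoff bound -/

section Chernoff

open MeasureTheory

/-- A Chernoff bound for sums of independent copies of a variable with negative mean. -/
lemma pi_sum_nonneg_le {Ω : Type*} [MeasurableSpace Ω] (ν : Measure Ω) [IsProbabilityMeasure ν]
    {W : Ω → ℝ} (hW : Measurable W) {B e v l : ℝ} (hB : ∀ ω, |W ω| ≤ B) (hl : 0 ≤ l)
    (hlB : l * B ≤ 1) (he : ∫ ω, W ω ∂ν ≤ -e) (hv : ∫ ω, W ω ^ 2 ∂ν ≤ v) (N : ℕ) :
    Measure.pi (fun _ : Fin N => ν) {ω | 0 ≤ ∑ k, W (ω k)} ≤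
      ENNReal.ofReal (Real.exp (-(N * (l * e - l ^ 2 * v)))) := by
  have hlW : ∀ ω, |l * W ω| ≤ 1 := fun ω => by
    rw [abs_mul, abs_of_nonneg hl]
    exact (mul_le_mul_of_nonneg_left (hB ω) hl).trans hlB
  have hbd : ∀ {f : Ω → ℝ}, Measurable f → (∃ K, ∀ ω, ‖f ω‖ ≤ K) → Integrable f ν :=
    fun hf ⟨K, hK⟩ => Integrable.of_bound hf.aestronglyMeasurable K (Filter.Eventually.of_forall hK)
  have hiW : Integrable W ν := hbd hW ⟨B, hB⟩
  have hiW2 : Integrable (fun ω => W ω ^ 2) ν := hbd (hW.pow_const 2) ⟨B ^ 2, fun ω => by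
    rw [Real.norm_eq_abs, abs_pow]; exact pow_le_pow_left₀ (abs_nonneg _) (hB ω) 2⟩
  have hie : Integrable (fun ω => Real.exp (l * W ω)) ν :=
    hbd (hW.const_mul l).exp ⟨Real.exp 1, fun ω => by
      rw [Real.norm_eq_abs, abs_of_pos (Real.exp_pos _)]
      exact Real.exp_le_exp.2 (le_of_abs_le (hlW ω))⟩
  have h1 : ∫ ω, Real.exp (l * W ω) ∂ν ≤ Real.exp (-(l * e - l ^ 2 * v)) := by
    calc ∫ ω, Real.exp (l * W ω) ∂ν ≤ ∫ ω, (1 + l * W ω + l ^ 2 * W ω ^ 2) ∂ν := by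
          refine integral_mono hie (((integrable_const _).add (hiW.const_mul l)).add
            (hiW2.const_mul _)) fun ω => ?_
          -- The inequality `exp y ≤ 1 + y + y²`, valid for `|y| ≤ 1`; this is where `l B ≤ 1`
          -- enters.
          have := (abs_le.1 (Real.abs_exp_sub_one_sub_id_le (hlW ω))).2
          simp only
          nlinarith
      _ = 1 + l * ∫ ω, W ω ∂ν + l ^ 2 * ∫ ω, W ω ^ 2 ∂ν := by
          have h : Integrable (fun ω => 1 + l * W ω) ν :=
            (integrable_const _).add (hiW.const_mul l)
          rw [integral_add h (hiW2.const_mul _),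
            integral_add (integrable_const _) (hiW.const_mul l), integral_const_mul,
            integral_const_mul]
          simp
      _ ≤ 1 + l * (-e) + l ^ 2 * v := by gcongr
      _ ≤ Real.exp (-(l * e - l ^ 2 * v)) := by
          have := Real.add_one_le_exp (-(l * e - l ^ 2 * v)); linarith
  have h2 : ∫ ω, ∏ k, Real.exp (l * W (ω k)) ∂(Measure.pi fun _ : Fin N => ν) ≤
      Real.exp (-(N * (l * e - l ^ 2 * v))) := by
    rw [integral_fintype_prod_eq_pow (fun ω => Real.exp (l * W ω)), Fintype.card_fin,
      neg_mul_eq_mul_neg, Real.exp_nat_mul]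
    exact pow_le_pow_left₀ (integral_nonneg fun _ => (Real.exp_pos _).le) h1 N
  have hm : Measurable fun ω : Fin N → Ω => ∏ k, Real.exp (l * W (ω k)) :=
    Finset.measurable_prod _ fun k _ => ((hW.comp (measurable_pi_apply k)).const_mul l).exp
  have hi : Integrable (fun ω : Fin N → Ω => ∏ k, Real.exp (l * W (ω k)))
      (Measure.pi fun _ : Fin N => ν) := by
    refine Integrable.of_bound hm.aestronglyMeasurable (∏ _k : Fin N, Real.exp 1)
      (Filter.Eventually.of_forall fun ω => ?_)
    rw [norm_prod]
    refine Finset.prod_le_prod (fun _ _ => norm_nonneg _) fun k _ => ?_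
    rw [Real.norm_eq_abs, abs_of_pos (Real.exp_pos _)]
    exact Real.exp_le_exp.2 (le_of_abs_le (hlW _))
  calc Measure.pi (fun _ : Fin N => ν) {ω | 0 ≤ ∑ k, W (ω k)}
      = ∫⁻ _ω in {ω | 0 ≤ ∑ k, W (ω k)}, 1 ∂(Measure.pi fun _ : Fin N => ν) := by simp
    _ ≤ ∫⁻ ω in {ω | 0 ≤ ∑ k, W (ω k)}, ENNReal.ofReal (∏ k, Real.exp (l * W (ω k)))
          ∂(Measure.pi fun _ : Fin N => ν) := by
        refine setLIntegral_mono (ENNReal.measurable_ofReal.comp hm) fun ω hω => ?_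
        rw [← Real.exp_sum, ← Finset.mul_sum, ← ENNReal.ofReal_one]
        exact ENNReal.ofReal_le_ofReal (Real.one_le_exp (mul_nonneg hl hω))
    _ ≤ ∫⁻ ω, ENNReal.ofReal (∏ k, Real.exp (l * W (ω k))) ∂(Measure.pi fun _ : Fin N => ν) :=
        setLIntegral_le_lintegral _ _
    _ = ENNReal.ofReal (∫ ω, ∏ k, Real.exp (l * W (ω k)) ∂(Measure.pi fun _ : Fin N => ν)) :=
        (ofReal_integral_eq_lintegral_ofReal hi (Filter.Eventually.of_forall fun ω =>
          Finset.prod_nonneg fun _ _ => (Real.exp_pos _).le)).symm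
    _ ≤ _ := ENNReal.ofReal_le_ofReal h2

end Chernoff

/-! ### Mass of boxes under the uniform distribution -/

section Boxes

open MeasureTheory

variable {D L ℓ : ℕ}

/-- The uniform distribution on the cube of parameters. -/
abbrev unifCube (D L ℓ : ℕ) : Measure (Param D L ℓ) :=
  ProbabilityTheory.cond volume (cube D L ℓ)

lemma measurableSet_cube : MeasurableSet (cube D L ℓ) := measurableSet_Icc

lemma cube_eq_pi : cube D L ℓ =
    Set.univ.pi fun _ => Set.univ.pi fun _ => Set.Icc (-1 : ℝ) 1 := by
  ext y
  simp only [cube, Set.mem_Icc, Pi.le_def, Set.mem_pi, Set.mem_univ, true_imp_iff]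
  exact ⟨fun h j i => ⟨h.1 j i, h.2 j i⟩, fun h => ⟨fun j i => (h j i).1, fun j i => (h j i).2⟩⟩

lemma volume_cube : (volume : Measure (Param D L ℓ)) (cube D L ℓ) =
    ∏ _j : Site D L, ∏ _i : Fin ℓ, ENNReal.ofReal 2 := by
  rw [cube_eq_pi, volume_pi_pi]
  refine Finset.prod_congr rfl fun j _ => ?_
  rw [volume_pi_pi]
  refine Finset.prod_congr rfl fun i _ => ?_
  rw [Real.volume_Icc]; norm_num

instance : IsProbabilityMeasure (unifCube D L ℓ) := by
  refine ProbabilityTheory.cond_isProbabilityMeasure_of_finite ?_ ?_ <;> rw [volume_cube]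
  · exact Finset.prod_ne_zero_iff.2 fun _ _ => Finset.prod_ne_zero_iff.2 fun _ _ => by simp
  · exact ENNReal.prod_ne_top fun _ _ => ENNReal.prod_ne_top fun _ _ => by simp

lemma ae_mem_cube : ∀ᵐ y ∂(unifCube D L ℓ), y ∈ cube D L ℓ :=
  ProbabilityTheory.ae_cond_mem measurableSet_cube

/-- The parameters close to `c` on the sites of `R`. -/
def paramBox (R : Set (Site D L)) (c : Param D L ℓ) (u : ℝ) : Set (Param D L ℓ) :=
  {y | ∀ j ∈ R, ∀ i, |c j i - y j i| ≤ u}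

lemma paramBox_mono {R : Set (Site D L)} {c : Param D L ℓ} {u u' : ℝ} (h : u ≤ u') :
    paramBox R c u ⊆ paramBox R c u' := fun _ hy j hj i => (hy j hj i).trans h

open Classical in
lemma cube_inter_paramBox (R : Set (Site D L)) (c : Param D L ℓ) (u : ℝ) :
    cube D L ℓ ∩ paramBox R c u = Set.univ.pi fun j => Set.univ.pi fun i =>
      if j ∈ R then Set.Icc (max (-1) (c j i - u)) (min 1 (c j i + u)) else Set.Icc (-1 : ℝ) 1 := by
  ext y
  rw [cube_eq_pi]
  simp only [paramBox, Set.mem_inter_iff, Set.mem_pi, Set.mem_univ, true_imp_iff, Set.mem_ofPred_eq]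
  constructor
  · rintro ⟨h1, h2⟩ j i
    split_ifs with hj
    · have := abs_le.1 (h2 j hj i)
      exact ⟨max_le (h1 j i).1 (by linarith), le_min (h1 j i).2 (by linarith)⟩
    · exact h1 j i
  · intro h
    refine ⟨fun j i => ?_, fun j hj i => ?_⟩
    · have := h j i
      split_ifs at this with hj
      · exact ⟨(le_max_left _ _).trans this.1, this.2.trans (min_le_left _ _)⟩
      · exact this
    · have := h j i
      rw [if_pos hj] at this
      rw [abs_le]
      have h1 := (le_max_right _ _).trans this.1
      have h2 := this.2.trans (min_le_right _ _)
      constructor <;> linarith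

lemma measurableSet_paramBox (R : Set (Site D L)) (c : Param D L ℓ) (u : ℝ) :
    MeasurableSet (paramBox R c u) := by
  have : paramBox R c u = ⋂ j, ⋂ (_ : j ∈ R), ⋂ i, {y : Param D L ℓ | |c j i - y j i| ≤ u} := by
    ext y; simp [paramBox]
  rw [this]
  refine MeasurableSet.iInter fun j => MeasurableSet.iInter fun _ => MeasurableSet.iInter fun i => ?_
  refine measurableSet_le (Measurable.abs (measurable_const.sub ?_)) measurable_const
  exact (measurable_pi_apply i).comp (measurable_pi_apply j)

/-- Half the length of the part of `[-1, 1]` at distance at most `u` from `c`. -/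
def segFrac (c u : ℝ) : ℝ := (min (1 - c) u + min (1 + c) u) / 2

open Classical in
lemma unifCube_paramBox (R : Set (Site D L)) {c : Param D L ℓ} (hc : c ∈ cube D L ℓ) {u : ℝ}
    (hu : 0 ≤ u) : (unifCube D L ℓ).real (paramBox R c u) =
      ∏ j, ∏ i, if j ∈ R then segFrac (c j i) u else 1 := by
  have h1 : (volume : Measure (Param D L ℓ)) (cube D L ℓ ∩ paramBox R c u) =
      ENNReal.ofReal (∏ j, ∏ i, 2 * if j ∈ R then segFrac (c j i) u else 1) := by
    have hcc : ∀ j i, -1 ≤ c j i ∧ c j i ≤ 1 := fun j i => ⟨hc.1 j i, hc.2 j i⟩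
    have hnn : ∀ j i, 0 ≤ 2 * if j ∈ R then segFrac (c j i) u else 1 := fun j i => by
      split_ifs
      · unfold segFrac
        have h1 : 0 ≤ min (1 - c j i) u := le_min (by linarith [(hcc j i).2]) hu
        have h2 : 0 ≤ min (1 + c j i) u := le_min (by linarith [(hcc j i).1]) hu
        linarith
      · norm_num
    rw [cube_inter_paramBox, volume_pi_pi, ENNReal.ofReal_prod_of_nonneg
      fun j _ => Finset.prod_nonneg fun i _ => hnn j i]
    refine Finset.prod_congr rfl fun j _ => ?_
    rw [volume_pi_pi, ENNReal.ofReal_prod_of_nonneg fun i _ => hnn j i]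
    refine Finset.prod_congr rfl fun i _ => ?_
    split_ifs with hj
    · rw [Real.volume_Icc]
      congr 1
      unfold segFrac
      rcases le_total (1 - c j i) u with h | h <;> rcases le_total (1 + c j i) u with h' | h' <;>
        simp only [min_eq_left h, min_eq_right h, min_eq_left h', min_eq_right h']
      · rw [min_eq_left (by linarith), max_eq_left (by linarith)]; ring
      · rw [min_eq_left (by linarith), max_eq_right (by linarith)]; ring
      · rw [min_eq_right (by linarith), max_eq_left (by linarith)]; ring
      · rw [min_eq_right (by linarith), max_eq_right (by linarith)]; ring
    · rw [Real.volume_Icc]; norm_num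
  rw [measureReal_def, ProbabilityTheory.cond_apply measurableSet_cube, h1, volume_cube]
  simp_rw [Finset.prod_mul_distrib]
  rw [ENNReal.toReal_mul, ENNReal.toReal_inv, ENNReal.toReal_ofReal (mul_nonneg (by positivity)
    (Finset.prod_nonneg fun j _ => Finset.prod_nonneg fun i _ => ?_))]
  · rw [ENNReal.toReal_prod]
    simp_rw [ENNReal.toReal_prod]
    simp only [ENNReal.toReal_ofReal (zero_le_two : (0 : ℝ) ≤ 2)]
    rw [← mul_assoc, inv_mul_cancel₀, one_mul]
    positivity
  · split_ifs
    · unfold segFrac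
      have h1 : 0 ≤ min (1 - c j i) u := le_min (by linarith [show c j i ≤ 1 from hc.2 j i]) hu
      have h2 : 0 ≤ min (1 + c j i) u := le_min (by linarith [show -1 ≤ c j i from hc.1 j i]) hu
      linarith
    · norm_num

open Classical in
lemma prod_ite_mem_const (R : Set (Site D L)) (t : ℝ) :
    ∏ j : Site D L, ∏ _i : Fin ℓ, (if j ∈ R then t else 1) = t ^ (R.ncard * ℓ) := by
  have h : ∀ j : Site D L, ∏ _i : Fin ℓ, (if j ∈ R then t else 1) =
      if j ∈ R then t ^ ℓ else 1 := fun j => by split_ifs <;> simp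
  simp_rw [h]
  rw [Finset.prod_ite, Finset.prod_const, Finset.prod_const_one, mul_one, ← pow_mul, mul_comm ℓ,
    Set.ncard_eq_toFinset_card']
  congr 3
  ext; simp

/-- On each axis at least one side of `c` has room for a segment of length `u ≤ 1`, so that even at
the boundary of the cube the box keeps a fraction `u / 2`. -/
lemma le_unifCube_paramBox (R : Set (Site D L)) {c : Param D L ℓ} (hc : c ∈ cube D L ℓ) {u : ℝ}
    (hu : 0 ≤ u) (hu1 : u ≤ 1) :
    (u / 2) ^ (R.ncard * ℓ) ≤ (unifCube D L ℓ).real (paramBox R c u) := by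
  classical
  rw [unifCube_paramBox R hc hu, ← prod_ite_mem_const]
  have h0 : ∀ j : Site D L, 0 ≤ if j ∈ R then u / 2 else 1 := fun j => by
    split_ifs <;> positivity
  refine Finset.prod_le_prod (fun j _ => Finset.prod_nonneg fun i _ => h0 j) fun j _ =>
    Finset.prod_le_prod (fun i _ => h0 j) fun i _ => ?_
  split_ifs
  · have h1 : -1 ≤ c j i := hc.1 j i
    have h2 : c j i ≤ 1 := hc.2 j i
    unfold segFrac
    have h3 : 0 ≤ min (1 - c j i) u := le_min (by linarith) hu
    have h4 : 0 ≤ min (1 + c j i) u := le_min (by linarith) hu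
    rcases le_total 0 (c j i) with h | h
    · rw [min_eq_right (by linarith : u ≤ 1 + c j i)]; linarith
    · rw [min_eq_right (by linarith : u ≤ 1 - c j i)]; linarith
  · exact le_rfl

/-- Cutting off at the boundary of the cube only lowers the ratio of the masses: `min d u' ≤ (u' /
u) min d u` for `d ≥ 0`, used on both sides of `c`. -/
lemma unifCube_paramBox_le (R : Set (Site D L)) {c : Param D L ℓ} (hc : c ∈ cube D L ℓ) {u u' : ℝ}
    (hu : 0 < u) (huu : u ≤ u') : (unifCube D L ℓ).real (paramBox R c u') ≤
      (u' / u) ^ (R.ncard * ℓ) * (unifCube D L ℓ).real (paramBox R c u) := by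
  classical
  have hu' : 0 < u' := hu.trans_le huu
  rw [unifCube_paramBox R hc hu.le, unifCube_paramBox R hc hu'.le, ← prod_ite_mem_const,
    ← Finset.prod_mul_distrib]
  have hcc : ∀ j i, -1 ≤ c j i ∧ c j i ≤ 1 := fun j i => ⟨hc.1 j i, hc.2 j i⟩
  have hmin : ∀ d : ℝ, 0 ≤ d → min d u' ≤ u' / u * min d u := by
    intro d hd
    rw [div_mul_eq_mul_div, le_div_iff₀ hu, mul_min_of_nonneg _ _ hu'.le]
    refine le_min ?_ ?_
    · calc min d u' * u ≤ d * u' := mul_le_mul (min_le_left _ _) huu hu.le hd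
        _ = u' * d := mul_comm _ _
    · exact mul_le_mul_of_nonneg_right (min_le_right _ _) hu.le
  have h0 : ∀ j i, 0 ≤ if j ∈ R then segFrac (c j i) u' else 1 := fun j i => by
    split_ifs
    · unfold segFrac
      have h1 : 0 ≤ min (1 - c j i) u' := le_min (by linarith [(hcc j i).2]) hu'.le
      have h2 : 0 ≤ min (1 + c j i) u' := le_min (by linarith [(hcc j i).1]) hu'.le
      linarith
    · norm_num
  refine Finset.prod_le_prod (fun j _ => Finset.prod_nonneg fun i _ => h0 j i) fun j _ => ?_
  rw [← Finset.prod_mul_distrib]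
  refine Finset.prod_le_prod (fun i _ => h0 j i) fun i _ => ?_
  split_ifs
  · unfold segFrac
    have h1 := hmin (1 - c j i) (by linarith [(hcc j i).2])
    have h2 := hmin (1 + c j i) (by linarith [(hcc j i).1])
    linarith
  · norm_num

end Boxes

/-! ### Integration against the law of a sample -/

section Law

open MeasureTheory

variable {D L ℓ : ℕ} {ρ : Param D L ℓ → Matrix (Conf D L) (Conf D L) ℂ}

lemma isProbabilityMeasure_sampleLaw (hρ : ∀ y ∈ cube D L ℓ, IsDensity (ρ y))
    (hm : ∀ s, AEMeasurable (fun y => outcomeProb (ρ y) s) (unifCube D L ℓ)) :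
    IsProbabilityMeasure (sampleLaw ρ) := by
  constructor
  have h1 : ∀ s : Outcome D L, Measurable fun y : Param D L ℓ => (y, s) :=
    fun s => measurable_prodMk_right
  have h2 : ∑ s : Outcome D L, ∫⁻ y, ENNReal.ofReal (outcomeProb (ρ y) s) ∂(unifCube D L ℓ) =
      ∫⁻ _y, 1 ∂(unifCube D L ℓ) := by
    rw [← lintegral_finsetSum' _ fun s _ => (hm s).ennreal_ofReal]
    refine lintegral_congr_ae (ae_mem_cube.mono fun y hy => ?_)
    simp only
    rw [← ENNReal.ofReal_sum_of_nonneg fun s _ => (outcomeProb_nonneg (hρ y hy).1 s).1,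
      sum_outcomeProb (hρ y hy), ENNReal.ofReal_one]
  have h3 : sampleLaw ρ Set.univ =
      ∑ s : Outcome D L, ∫⁻ y, ENNReal.ofReal (outcomeProb (ρ y) s) ∂(unifCube D L ℓ) := by
    unfold sampleLaw
    rw [Measure.finsetSum_apply]
    refine Finset.sum_congr rfl fun s _ => ?_
    rw [Measure.map_apply (h1 s) MeasurableSet.univ, Set.preimage_univ,
      withDensity_apply _ MeasurableSet.univ, Measure.restrict_univ]
  rw [h3, h2]
  simp

lemma integrable_outcomeProb_mul (hρ : ∀ y ∈ cube D L ℓ, IsDensity (ρ y))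
    (hm : ∀ s, AEMeasurable (fun y => outcomeProb (ρ y) s) (unifCube D L ℓ))
    {f : Param D L ℓ × Outcome D L → ℝ} (hf : Measurable f) {B : ℝ} (hB : ∀ z, |f z| ≤ B)
    (s : Outcome D L) :
    Integrable (fun y => outcomeProb (ρ y) s * f (y, s)) (unifCube D L ℓ) := by
  refine Integrable.of_bound ((hm s).mul
    (hf.comp measurable_prodMk_right).aemeasurable).aestronglyMeasurable B
    (ae_mem_cube.mono fun y hy => ?_)
  have h0 := fun s => (outcomeProb_nonneg (hρ y hy).1 s).1
  have h1 : outcomeProb (ρ y) s ≤ 1 := by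
    rw [← sum_outcomeProb (hρ y hy)]
    exact Finset.single_le_sum (fun s _ => h0 s) (Finset.mem_univ s)
  rw [norm_mul, Real.norm_eq_abs, Real.norm_eq_abs, abs_of_nonneg (h0 s)]
  exact (mul_le_of_le_one_left (abs_nonneg _) h1).trans (hB _)

lemma integral_sampleLaw (hρ : ∀ y ∈ cube D L ℓ, IsDensity (ρ y))
    (hm : ∀ s, AEMeasurable (fun y => outcomeProb (ρ y) s) (unifCube D L ℓ))
    {f : Param D L ℓ × Outcome D L → ℝ} (hf : Measurable f) {B : ℝ} (hB : ∀ z, |f z| ≤ B) :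
    ∫ z, f z ∂(sampleLaw ρ) =
      ∫ y, ∑ s, outcomeProb (ρ y) s * f (y, s) ∂(unifCube D L ℓ) := by
  have h1 : ∀ s : Outcome D L, Measurable fun y : Param D L ℓ => (y, s) :=
    fun s => measurable_prodMk_right
  have hint := integrable_outcomeProb_mul hρ hm hf hB
  have hfin : IsProbabilityMeasure (sampleLaw ρ) := isProbabilityMeasure_sampleLaw hρ hm
  have hintf : Integrable f (sampleLaw ρ) :=
    Integrable.of_bound hf.aestronglyMeasurable B (Filter.Eventually.of_forall hB)
  rw [integral_finsetSum _ fun s _ => hint s]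
  have hle : ∀ s : Outcome D L, ((unifCube D L ℓ).withDensity
      fun y => ENNReal.ofReal (outcomeProb (ρ y) s)).map (fun y => (y, s)) ≤ sampleLaw ρ := by
    intro s
    unfold sampleLaw
    intro A
    rw [Measure.finsetSum_apply]
    exact Finset.single_le_sum (f := fun s : Outcome D L => (((unifCube D L ℓ).withDensity
      fun y => ENNReal.ofReal (outcomeProb (ρ y) s)).map (fun y => (y, s))) A)
      (fun _ _ => zero_le) (Finset.mem_univ s)
  have hsum : ∫ z, f z ∂(sampleLaw ρ) = ∑ s : Outcome D L, ∫ z, f z ∂(((unifCube D L ℓ).withDensity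
      fun y => ENNReal.ofReal (outcomeProb (ρ y) s)).map fun y => (y, s)) := by
    conv_lhs => rw [sampleLaw]
    exact integral_finsetSum_measure fun s _ => hintf.mono_measure (hle s)
  rw [hsum]
  refine Finset.sum_congr rfl fun s _ => ?_
  rw [integral_map (h1 s).aemeasurable hf.aestronglyMeasurable,
    integral_withDensity_eq_integral_toReal_smul₀ (hm s).ennreal_ofReal
      (Filter.Eventually.of_forall fun y => ENNReal.ofReal_lt_top)]
  refine integral_congr_ae (ae_mem_cube.mono fun y hy => ?_)
  simp only [smul_eq_mul]
  rw [ENNReal.toReal_ofReal (outcomeProb_nonneg (hρ y hy).1 s).1]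

lemma integral_sampleLaw_le (hρ : ∀ y ∈ cube D L ℓ, IsDensity (ρ y))
    (hm : ∀ s, AEMeasurable (fun y => outcomeProb (ρ y) s) (unifCube D L ℓ))
    {f : Param D L ℓ × Outcome D L → ℝ} (hf : Measurable f) {B : ℝ} (hB : ∀ z, |f z| ≤ B)
    {h : Param D L ℓ → ℝ} (hh : Integrable h (unifCube D L ℓ))
    (hle : ∀ y ∈ cube D L ℓ, ∑ s, outcomeProb (ρ y) s * f (y, s) ≤ h y) :
    ∫ z, f z ∂(sampleLaw ρ) ≤ ∫ y, h y ∂(unifCube D L ℓ) := by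
  rw [integral_sampleLaw hρ hm hf hB]
  exact integral_mono_ae (integrable_finsetSum _ fun s _ =>
    integrable_outcomeProb_mul hρ hm hf hB s) hh (ae_mem_cube.mono hle)

end Law

/-! ### Concentration of averages over selected samples -/

section Deviation

open MeasureTheory

variable {D L ℓ : ℕ}

/-- The contribution of a sample to the excess over `F + τ` of an average of `v` over the samples
with parameters in some set between `A` and `A'`; samples in `A' \ A` count with the maximal
possible excess. -/
def excess (A A' : Set (Param D L ℓ)) (v : Outcome D L → ℝ) (F τ V : ℝ)
    (z : Param D L ℓ × Outcome D L) : ℝ :=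
  A.indicator (fun _ => v z.2 - F - τ) z.1 + (A' \ A).indicator (fun _ => 2 * V) z.1

variable {A A' : Set (Param D L ℓ)} {v : Outcome D L → ℝ} {F τ V : ℝ}

lemma excess_of_mem {z : Param D L ℓ × Outcome D L} (hz : z.1 ∈ A) :
    excess A A' v F τ V z = v z.2 - F - τ := by
  rw [excess, Set.indicator_of_mem hz, Set.indicator_of_notMem fun h => h.2 hz, add_zero]

lemma excess_of_notMem {z : Param D L ℓ × Outcome D L} (hz : z.1 ∉ A) :
    excess A A' v F τ V z = (A' \ A).indicator (fun _ => 2 * V) z.1 := by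
  rw [excess, Set.indicator_of_notMem hz, zero_add]

lemma measurable_excess (hA : MeasurableSet A) (hA' : MeasurableSet A') :
    Measurable (excess A A' v F τ V) := by
  have hv : Measurable fun z : Param D L ℓ × Outcome D L => v z.2 :=
    (measurable_of_countable v).comp measurable_snd
  exact (((hv.sub measurable_const).sub measurable_const).indicator (measurable_fst hA)).add
    (measurable_const.indicator (measurable_fst (hA'.diff hA)))

lemma abs_excess_le (hv : ∀ s, |v s| ≤ V) (hF : |F| ≤ V) (hτ : 0 < τ) (hτV : τ ≤ V)
    (z : Param D L ℓ × Outcome D L) : |excess A A' v F τ V z| ≤ 3 * V := by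
  have h1 := abs_le.1 (hv z.2)
  have h2 := abs_le.1 hF
  by_cases hz : z.1 ∈ A
  · rw [excess_of_mem hz, abs_le]
    constructor <;> linarith
  · classical
    rw [excess_of_notMem hz, Set.indicator_apply]
    split_ifs
    · rw [abs_le]; constructor <;> linarith
    · rw [abs_zero]; linarith

/-- The average over a set of samples is close to `F` if the excess is negative in both
directions. -/
lemma abs_average_sub_le {N : ℕ} {ω : Fin N → Param D L ℓ × Outcome D L} {Γ : Finset (Fin N)}
    (hv : ∀ s, |v s| ≤ V) (hF : |F| ≤ V) (hτ : 0 < τ)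
    (hA : ∀ k, (ω k).1 ∈ A → k ∈ Γ) (hA' : ∀ k ∈ Γ, (ω k).1 ∈ A')
    (h1 : ∑ k, excess A A' v F τ V (ω k) < 0)
    (h2 : ∑ k, excess A A' (fun s => -v s) (-F) τ V (ω k) < 0) :
    |(Γ.card : ℝ)⁻¹ * ∑ k ∈ Γ, v (ω k).2 - F| ≤ τ := by
  have key : ∀ (v : Outcome D L → ℝ) (F : ℝ), (∀ s, |v s| ≤ V) → |F| ≤ V →
      ∑ k, excess A A' v F τ V (ω k) < 0 → ∑ k ∈ Γ, (v (ω k).2 - F - τ) < 0 := by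
    intro v F hv hF h
    refine lt_of_le_of_lt ?_ h
    rw [← Finset.sum_filter_add_sum_filter_not Finset.univ (fun k => k ∈ Γ)
      (fun k => excess A A' v F τ V (ω k)), Finset.filter_mem_eq_inter, Finset.univ_inter]
    refine (Finset.sum_le_sum fun k hk => ?_).trans (le_add_of_nonneg_right
      (Finset.sum_nonneg fun k hk => ?_))
    · have h1 := abs_le.1 (hv (ω k).2)
      have h2 := abs_le.1 hF
      by_cases hz : (ω k).1 ∈ A
      · rw [excess_of_mem hz]
      · rw [excess_of_notMem hz, Set.indicator_of_mem (show (ω k).1 ∈ A' \ A from ⟨hA' k hk, hz⟩)]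
        linarith
    · have hz : (ω k).1 ∉ A := fun hz => (Finset.mem_filter.1 hk).2 (hA k hz)
      rw [excess_of_notMem hz]
      have := (abs_nonneg F).trans hF
      exact Set.indicator_nonneg (fun _ _ => by linarith) _
  have k1 := key v F hv hF h1
  have k2 := key (fun s => -v s) (-F) (fun s => by rw [abs_neg]; exact hv s)
    (by rw [abs_neg]; exact hF) h2
  -- For empty `Γ` the sum would be `0`, not negative: the strict bound on the excess also
  -- guarantees that some sample is selected.
  have hne : Γ.Nonempty := by
    rw [Finset.nonempty_iff_ne_empty]
    rintro rfl
    simp at k1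
  have hc : (0 : ℝ) < Γ.card := by exact_mod_cast hne.card_pos
  simp only [Finset.sum_sub_distrib, Finset.sum_neg_distrib, Finset.sum_const, nsmul_eq_mul]
    at k1 k2
  have h3 : (Γ.card : ℝ)⁻¹ * ∑ k ∈ Γ, v (ω k).2 - F =
      (Γ.card : ℝ)⁻¹ * (∑ k ∈ Γ, v (ω k).2 - Γ.card * F) := by
    field_simp
  rw [h3, abs_mul, abs_of_pos (inv_pos.2 hc), inv_mul_le_iff₀ hc, abs_le]
  constructor <;> linarith

/-- Concentration of the average of the estimators over the samples near a point. -/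
lemma pi_sum_excess_nonneg_le {ρ : Param D L ℓ → Matrix (Conf D L) (Conf D L) ℂ}
    (hρ : ∀ y ∈ cube D L ℓ, IsDensity (ρ y))
    (hm : ∀ s, AEMeasurable (fun y => outcomeProb (ρ y) s) (unifCube D L ℓ))
    (hA : MeasurableSet A) (hA' : MeasurableSet A') (hAA : A ⊆ A')
    (hv : ∀ s, |v s| ≤ V) (hF : |F| ≤ V) (hτ : 0 < τ) (hτV : τ ≤ V)
    (hf : ∀ y ∈ cube D L ℓ, y ∈ A → ∑ s, outcomeProb (ρ y) s * v s ≤ F + τ / 2)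
    (hp : (unifCube D L ℓ).real A' ≤ (1 + τ / (8 * V)) * (unifCube D L ℓ).real A) (N : ℕ) :
    Measure.pi (fun _ : Fin N => sampleLaw ρ) {ω | 0 ≤ ∑ k, excess A A' v F τ V (ω k)} ≤
      ENNReal.ofReal (Real.exp (-(N * ((unifCube D L ℓ).real A * τ ^ 2 / (832 * V ^ 2))))) := by
  have hV : 0 < V := hτ.trans_le hτV
  have : IsProbabilityMeasure (sampleLaw ρ) := isProbabilityMeasure_sampleLaw hρ hm
  set p := (unifCube D L ℓ).real A with hp_def
  set p' := (unifCube D L ℓ).real A' with hp'_def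
  have hp0 : 0 ≤ p := measureReal_nonneg
  have hint : ∀ c d : ℝ, Integrable (fun y => A.indicator (fun _ => c) y +
      (A' \ A).indicator (fun _ => d) y) (unifCube D L ℓ) := fun c d =>
    ((integrable_const c).indicator hA).add ((integrable_const d).indicator (hA'.diff hA))
  have hic : ∀ c d : ℝ, ∫ y, (A.indicator (fun _ => c) y + (A' \ A).indicator (fun _ => d) y)
      ∂(unifCube D L ℓ) = c * p + d * (p' - p) := by
    intro c d
    rw [integral_add ((integrable_const c).indicator hA)
      ((integrable_const d).indicator (hA'.diff hA)), integral_indicator_const _ hA,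
      integral_indicator_const _ (hA'.diff hA), measureReal_sdiff hAA hA, smul_eq_mul,
      smul_eq_mul, mul_comm c, mul_comm d]
  have hdp : p' - p ≤ τ / (8 * V) * p := by linarith
  have hW := measurable_excess (v := v) (F := F) (τ := τ) (V := V) hA hA'
  have hB := abs_excess_le (A := A) (A' := A') hv hF hτ hτV
  have h01 : ∀ y ∈ cube D L ℓ, ∀ c, ∑ s, outcomeProb (ρ y) s * c = c := fun y hy c => by
    rw [← Finset.sum_mul, sum_outcomeProb (hρ y hy), one_mul]
  have hmean : ∫ z, excess A A' v F τ V z ∂(sampleLaw ρ) ≤ -(τ / 4 * p) := by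
    refine (integral_sampleLaw_le hρ hm hW hB (hint (-(τ / 2)) (2 * V)) fun y hy => ?_).trans ?_
    · by_cases hyA : y ∈ A
      · have := hf y hy hyA
        simp only [excess_of_mem (z := (y, _)) hyA, mul_sub, Finset.sum_sub_distrib, h01 y hy,
          Set.indicator_of_mem hyA, Set.indicator_of_notMem fun h : y ∈ A' \ A => h.2 hyA]
        linarith
      · simp only [excess_of_notMem (z := (y, _)) hyA, Set.indicator_of_notMem hyA, h01 y hy,
          zero_add, le_refl]
    · rw [hic]
      -- On `A` the mean excess is at most `τ / 2 - τ`. The shell has mass at most `τ p / (8 V)` and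
      -- costs `2 V` per sample, which takes back half of the gain.
      calc _ ≤ -(τ / 2) * p + 2 * V * (τ / (8 * V) * p) := by gcongr
        _ = -(τ / 4 * p) := by field_simp; ring
  -- The `13` is `3 ^ 2` from `A` plus `2 ^ 2` from the shell, whose mass is at most `p`.
  have hsq : ∫ z, excess A A' v F τ V z ^ 2 ∂(sampleLaw ρ) ≤ 13 * V ^ 2 * p := by
    refine (integral_sampleLaw_le hρ hm (hW.pow_const 2) (B := (3 * V) ^ 2) (fun z => by
      rw [abs_pow]; exact pow_le_pow_left₀ (abs_nonneg _) (hB z) 2)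
      (hint ((3 * V) ^ 2) ((2 * V) ^ 2)) fun y hy => ?_).trans ?_
    · by_cases hyA : y ∈ A
      · rw [Set.indicator_of_mem hyA, Set.indicator_of_notMem fun h : y ∈ A' \ A => h.2 hyA,
          add_zero, ← h01 y hy ((3 * V) ^ 2)]
        refine Finset.sum_le_sum fun s _ => mul_le_mul_of_nonneg_left ?_
          (outcomeProb_nonneg (hρ y hy).1 s).1
        rw [← sq_abs]
        exact pow_le_pow_left₀ (abs_nonneg _) (hB _) 2
      · simp only [excess_of_notMem (z := (y, _)) hyA, Set.indicator_of_notMem hyA, h01 y hy,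
          zero_add]
        by_cases hyA' : y ∈ A' \ A
        · simp only [Set.indicator_of_mem hyA', le_refl]
        · simp [Set.indicator_of_notMem hyA']
    · rw [hic]
      have h1 : τ / (8 * V) * p ≤ p := mul_le_of_le_one_left hp0 (by
        rw [div_le_one (by positivity)]; linarith)
      nlinarith [mul_le_mul_of_nonneg_left (hdp.trans h1) (sq_nonneg (2 * V))]
  -- The optimal `l = e / (2 v)` for `e = τ p / 4` and `v = 13 V² p`; the exponent is then `e² / (4
  -- v) = p τ² / (832 V²)`.
  refine (pi_sum_nonneg_le (sampleLaw ρ) hW (l := τ / (104 * V ^ 2)) hB (by positivity) ?_ hmean hsq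
    N).trans (le_of_eq ?_)
  · rw [div_mul_eq_mul_div, div_le_one (by positivity)]
    nlinarith
  · congr 4
    field_simp
    ring

end Deviation

/-! ### Continuity of the steady state in the parameters -/

section Measurability

open MeasureTheory

variable {D L ℓ : ℕ}

lemma qubitSupportedOn_univ (O : Matrix (Conf D L) (Conf D L) ℂ) :
    QubitSupportedOn Set.univ O :=
  ⟨fun _ _ ⟨v, hv, _⟩ => absurd (Set.mem_univ v) hv, fun σ τ σ' τ' h1 h2 _ _ => by
    obtain rfl : σ = σ' := funext fun v => h1 v (Set.mem_univ v)
    obtain rfl : τ = τ' := funext fun v => h2 v (Set.mem_univ v)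
    rfl⟩

/-- The stability estimate, applied with the whole lattice as support and `r → ∞`, is a Lipschitz
bound. Its constant depends on `L`, which is harmless: the continuity only serves to make outcome
probabilities measurable. -/
lemma Family.IsSteadyStatePhase.continuousOn_trace {P : Family D L ℓ} {r₀ κ : ℕ} {J a g : ℝ}
    (hP : P.IsSteadyStatePhase r₀ J a κ g) (hJ : 0 < J) (hg : 0 < g)
    (O : Matrix (Conf D L) (Conf D L) ℂ) :
    ContinuousOn (fun y => (O * P.steady y).trace) (cube D L ℓ) := by
  obtain ⟨C, hC, η, hη, hη1, h⟩ :=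
    Family.exists_local_stability D r₀ (2 * L + 1) ℓ κ (a := a) hJ hg
  have hlip : ∀ x ∈ cube D L ℓ, ∀ y ∈ cube D L ℓ,
      ‖(O * P.steady x).trace - (O * P.steady y).trace‖ ≤ C * opNorm O * ‖x - y‖ := by
    intro x hx y hy
    have h1 : ∀ r : ℕ, ‖(O * P.steady x).trace - (O * P.steady y).trace‖ ≤
        C * (‖x - y‖ + η ^ r) * opNorm O := fun r =>
      h L P hP Set.univ (fitsInCube_univ P.per) O (qubitSupportedOn_univ O) r ‖x - y‖
        (norm_nonneg _) x hx y hy fun j _ i =>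
          (norm_le_pi_norm ((x - y) j) i).trans (norm_le_pi_norm (x - y) j)
    have h2 : Filter.Tendsto (fun r : ℕ => C * (‖x - y‖ + η ^ r) * opNorm O) Filter.atTop
        (𝓝 (C * (‖x - y‖ + 0) * opNorm O)) :=
      ((tendsto_const_nhds.add (tendsto_pow_atTop_nhds_zero_of_lt_one hη.le hη1)).const_mul
        C).mul_const _
    refine (ge_of_tendsto' h2 h1).trans (le_of_eq (by ring))
  have h3 : LipschitzOnWith ⟨C * opNorm O, mul_nonneg hC.le (opNorm_nonneg O)⟩
      (fun y => (O * P.steady y).trace) (cube D L ℓ) :=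
    LipschitzOnWith.of_dist_le_mul fun x hx y hy => by
      rw [dist_eq_norm, dist_eq_norm]; exact hlip x hx y hy
  exact h3.continuousOn

lemma Family.IsSteadyStatePhase.aemeasurable_outcomeProb {P : Family D L ℓ} {r₀ κ : ℕ}
    {J a g : ℝ} (hP : P.IsSteadyStatePhase r₀ J a κ g) (hJ : 0 < J) (hg : 0 < g)
    (s : Outcome D L) :
    AEMeasurable (fun y => outcomeProb (P.steady y) s) (unifCube D L ℓ) := by
  have h : ContinuousOn (fun y => outcomeProb (P.steady y) s) (cube D L ℓ) := by
    unfold outcomeProb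
    simp_rw [Matrix.trace_mul_comm (P.steady _)]
    exact continuousOn_const.mul
      (Complex.continuous_re.comp_continuousOn (hP.continuousOn_trace hJ hg _))
  exact (h.aemeasurable measurableSet_cube).smul_measure _

end Measurability

/-! ### A grid of parameters -/

section Grid

variable {D L ℓ : ℕ}

/-- The midpoints of the division of `[-1, 1]` into `K` segments. -/
def gridPoint (K : ℕ) (t : Fin K) : ℝ := -1 + (2 * (t : ℝ) + 1) / K

lemma gridPoint_mem {K : ℕ} (t : Fin K) : -1 ≤ gridPoint K t ∧ gridPoint K t ≤ 1 := by
  have hK : (0 : ℝ) < K := by exact_mod_cast t.pos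
  have ht : (t : ℝ) + 1 ≤ K := by exact_mod_cast t.2
  have h1 : 0 ≤ (2 * (t : ℝ) + 1) / K := by positivity
  have h2 : (2 * (t : ℝ) + 1) / K ≤ 2 := by rw [div_le_iff₀ hK]; linarith
  unfold gridPoint
  constructor <;> linarith

lemma exists_gridPoint {K : ℕ} (hK : 0 < K) {x : ℝ} (h1 : -1 ≤ x) (h2 : x ≤ 1) :
    ∃ t : Fin K, |x - gridPoint K t| ≤ 1 / K := by
  have hK' : (0 : ℝ) < K := by exact_mod_cast hK
  have key : ∀ t : Fin K, (t : ℝ) ≤ (x + 1) * K / 2 → (x + 1) * K / 2 ≤ t + 1 →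
      |x - gridPoint K t| ≤ 1 / K := by
    intro t ht1 ht2
    have : x - gridPoint K t = (2 * ((x + 1) * K / 2 - t) - 1) / K := by
      unfold gridPoint; field_simp; ring
    rw [this, abs_div, abs_of_pos hK']
    gcongr
    rw [abs_le]; constructor <;> linarith
  have hy : 0 ≤ (x + 1) * K / 2 := by
    have : 0 ≤ x + 1 := by linarith
    positivity
  by_cases hx : ⌊(x + 1) * K / 2⌋₊ < K
  · exact ⟨⟨_, hx⟩, key _ (Nat.floor_le hy) (Nat.lt_floor_add_one _).le⟩
  · push Not at hx
    have h3 : (K : ℝ) ≤ (x + 1) * K / 2 := (Nat.cast_le.2 hx).trans (Nat.floor_le hy)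
    have h4 : (x + 1) * K / 2 ≤ K := by nlinarith
    have h5 : ((K - 1 : ℕ) : ℝ) = K - 1 := by push_cast [Nat.one_le_iff_ne_zero.2 hK.ne']; ring
    -- Only the right endpoint `x = 1` has floor `K`; it belongs to the last segment.
    refine ⟨⟨K - 1, by omega⟩, key _ ?_ ?_⟩ <;> simp only [h5] <;> linarith

open Classical in
/-- Parameters on a grid for the sites of `R`, and `0` elsewhere. -/
def gridParam (R : Set (Site D L)) (K : ℕ) (t : {j // j ∈ R} → Fin ℓ → Fin K) : Param D L ℓ :=
  fun j i => if h : j ∈ R then gridPoint K (t ⟨j, h⟩ i) else 0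

lemma gridParam_mem_cube (R : Set (Site D L)) (K : ℕ) (t : {j // j ∈ R} → Fin ℓ → Fin K) :
    gridParam R K t ∈ cube D L ℓ := by
  have : ∀ j i, -1 ≤ gridParam R K t j i ∧ gridParam R K t j i ≤ 1 := fun j i => by
    unfold gridParam
    split_ifs
    · exact gridPoint_mem _
    · norm_num
  exact ⟨fun j i => (this j i).1, fun j i => (this j i).2⟩

lemma exists_gridParam (R : Set (Site D L)) {K : ℕ} (hK : 0 < K) {x : Param D L ℓ}
    (hx : x ∈ cube D L ℓ) : ∃ t : {j // j ∈ R} → Fin ℓ → Fin K,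
      ∀ j ∈ R, ∀ i, |x j i - gridParam R K t j i| ≤ 1 / K := by
  have h : ∀ (j : {j // j ∈ R}) (i : Fin ℓ), ∃ t : Fin K, |x j i - gridPoint K t| ≤ 1 / K :=
    fun j i => exists_gridPoint hK (hx.1 j i) (hx.2 j i)
  choose t ht using h
  refine ⟨t, fun j hj i => ?_⟩
  simp only [gridParam, hj, dif_pos]
  exact ht ⟨j, hj⟩ i

lemma card_gridParam (R : Set (Site D L)) (K : ℕ) [Fintype {j // j ∈ R}] :
    Fintype.card ({j // j ∈ R} → Fin ℓ → Fin K) = K ^ (R.ncard * ℓ) := by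
  classical
  simp only [Fintype.card_fun, Fintype.card_fin]
  rw [← pow_mul, mul_comm, Set.ncard_eq_toFinset_card', Set.toFinset_card]

end Grid

/-! ### The margin `h` between the boxes -/

section Numeric

/-- Each of the at most `m` coordinates is stretched by a factor of at most `1 + t / (2 (m + 1))`,
so the product stays below `exp (t / 2) ≤ 1 + t`. -/
lemma ratio_pow_le {γ t : ℝ} (hγ : 0 < γ) (ht : 0 < t) (ht1 : t ≤ 1) {d m : ℕ} (hd : d ≤ m)
    {h : ℝ} (hh : h = γ * t / (8 * (m + 1))) : ((γ + h) / (γ - h)) ^ d ≤ 1 + t := by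
  have hm : (0 : ℝ) < m + 1 := by positivity
  have hdm : (d : ℝ) ≤ m := by exact_mod_cast hd
  have h0 : 0 < h := by rw [hh]; positivity
  have h1 : h ≤ γ / 2 := by
    rw [hh, div_le_div_iff₀ (by positivity) (by norm_num)]
    have : (0 : ℝ) ≤ m := by positivity
    nlinarith [mul_le_mul_of_nonneg_left ht1 hγ.le, mul_nonneg hγ.le this]
  have h2 : (γ + h) / (γ - h) ≤ 1 + t / (2 * (m + 1)) := by
    have h3 : t / (2 * (m + 1)) = 4 * h / γ := by rw [hh]; field_simp; ring
    rw [h3, div_le_iff₀ (by linarith)]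
    have : (1 + 4 * h / γ) * (γ - h) = γ + 3 * h - 4 * h * (h / γ) := by field_simp; ring
    rw [this]
    have h4 : h / γ ≤ 1 / 2 := by rw [div_le_iff₀ hγ]; linarith
    nlinarith
  calc ((γ + h) / (γ - h)) ^ d ≤ (Real.exp (t / (2 * (m + 1)))) ^ d := by
        refine pow_le_pow_left₀ (div_nonneg (by linarith) (by linarith)) (h2.trans ?_) d
        rw [add_comm]; exact Real.add_one_le_exp _
    _ = Real.exp (d * (t / (2 * (m + 1)))) := (Real.exp_nat_mul _ _).symm
    _ ≤ Real.exp (t / 2) := by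
        refine Real.exp_le_exp.2 ?_
        rw [mul_div_assoc', div_le_div_iff₀ (by positivity) (by norm_num)]
        nlinarith
    _ ≤ 1 + t := by
        have h5 := Real.one_sub_le_exp_neg (t / 2)
        have h6 : Real.exp (t / 2) * Real.exp (-(t / 2)) = 1 := by rw [← Real.exp_add]; simp
        have h7 := Real.exp_pos (t / 2)
        have h8 : Real.exp (t / 2) * (1 - t / 2) ≤ 1 :=
          (mul_le_mul_of_nonneg_left h5 h7.le).trans h6.le
        have h9 : 1 ≤ (1 + t) * (1 - t / 2) := by nlinarith
        have h10 : 0 < 1 - t / 2 := by linarith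
        exact le_of_mul_le_mul_right (h8.trans h9) h10

/-- Bernoulli's inequality: shrinking `m` factors by relative amounts of at most `1 / (8 (m + 1))`
loses less than one half. -/
lemma half_pow_le {γ t : ℝ} (hγ : 0 < γ) (ht1 : t ≤ 1) (m : ℕ)
    {h : ℝ} (hh : h = γ * t / (8 * (m + 1))) : (γ / 2) ^ m / 2 ≤ ((γ - h) / 2) ^ m := by
  have hm : (0 : ℝ) < m + 1 := by positivity
  have h1 : (γ - h) / 2 = γ / 2 * (1 + -(t / (8 * (m + 1)))) := by rw [hh]; field_simp; ring
  have h2 : t / (8 * (m + 1)) ≤ 1 / (8 * (m + 1)) := by gcongr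
  have h3 : (m : ℝ) * (1 / (8 * (m + 1))) ≤ 1 / 2 := by
    rw [mul_one_div, div_le_div_iff₀ (by positivity) (by norm_num)]; nlinarith
  have h4 : 1 / (8 * ((m : ℝ) + 1)) ≤ 2 := by
    rw [div_le_iff₀ (by positivity)]; nlinarith [(Nat.cast_nonneg m : (0 : ℝ) ≤ m)]
  rw [h1, mul_pow, div_eq_mul_inv]
  refine mul_le_mul_of_nonneg_left ?_ (by positivity)
  have h5 := one_add_mul_le_pow (a := -(t / (8 * ((m : ℝ) + 1)))) (by linarith) m
  refine le_trans ?_ h5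
  have : (m : ℝ) * (t / (8 * (m + 1))) ≤ m * (1 / (8 * (m + 1))) := by gcongr
  norm_num
  linarith

end Numeric

/-! ### Uniform accuracy of the estimator -/

section Learning

open MeasureTheory

variable {D L ℓ : ℕ}

lemma localEstimate_eq_ofReal {N : ℕ} (per : Bool) (r₀ r : ℕ) (γ : ℝ) (S : Set (Site D L))
    {O : Matrix (Conf D L) (Conf D L) ℂ} (hO : O.IsHermitian)
    (data : Fin N → Param D L ℓ × Outcome D L) (x : Param D L ℓ) :
    localEstimate per r₀ r γ S O data x =
      (((selected per r₀ r γ S data x).card : ℝ)⁻¹ *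
        ∑ k ∈ selected per r₀ r γ S data x, (O * shadow (data k).2).trace.re : ℝ) := by
  unfold localEstimate
  push_cast
  congr 1
  exact Finset.sum_congr rfl fun k _ => trace_mul_shadow_eq_re hO _

/-- The estimator of one local observable is accurate for all parameters, with high probability. -/
lemma exists_good_event_of_local {ρ : Param D L ℓ → Matrix (Conf D L) (Conf D L) ℂ}
    (hρ : ∀ y ∈ cube D L ℓ, IsDensity (ρ y))
    (hm : ∀ s, AEMeasurable (fun y => outcomeProb (ρ y) s) (unifCube D L ℓ))
    (per : Bool) (r₀ r : ℕ) (S : Set (Site D L)) {O : Matrix (Conf D L) (Conf D L) ℂ}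
    (hO : O.IsHermitian) {V γ ε h : ℝ} {m K : ℕ} (hγ : 0 < γ) (hγ1 : γ ≤ 1) (hε : 0 < ε)
    (hε1 : ε < 1) (hV : 1 ≤ V) (hOV : ∀ s, ‖(O * shadow s).trace‖ ≤ V * opNorm O)
    (hmd : (relevantSites per r₀ r S).ncard * ℓ ≤ m)
    (hh : h = γ * (ε / (16 * V)) / (8 * (m + 1))) (hK : 1 / h ≤ K)
    (hstab : ∀ x ∈ cube D L ℓ, ∀ x' ∈ cube D L ℓ,
      (∀ j ∈ relevantSites per r₀ r S, ∀ i, |x j i - x' j i| ≤ γ) →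
      ‖(O * ρ x).trace - (O * ρ x').trace‖ ≤ ε / 4 * opNorm O) (N : ℕ) :
    ∃ B : Set (Fin N → Param D L ℓ × Outcome D L), MeasurableSet B ∧
      Measure.pi (fun _ : Fin N => sampleLaw ρ) B ≤ ENNReal.ofReal
        ((K : ℝ) ^ m * (2 * Real.exp (-(N * ((γ / 2) ^ m * ε ^ 2 / (6656 * V ^ 2)))))) ∧
      ∀ data ∉ B, ∀ x ∈ cube D L ℓ,
        ‖(O * ρ x).trace - localEstimate per r₀ r γ S O data x‖ ≤ ε * opNorm O := by
  classical
  -- A vanishing observable is treated apart, because the threshold `τ` below must be positive.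
  rcases (opNorm_nonneg O).eq_or_lt with h0 | h0
  · refine ⟨∅, MeasurableSet.empty, by simp, fun data _ x hx => ?_⟩
    have h1 : ∀ s, (O * shadow s).trace = 0 := fun s => by
      have := hOV s; rw [← h0, mul_zero] at this; exact norm_le_zero_iff.1 this
    have h2 : (O * ρ x).trace = 0 := by
      have := norm_trace_mul_le_of_isDensity O (hρ x hx); rw [← h0] at this
      exact norm_le_zero_iff.1 this
    simp [localEstimate, h1, h2, ← h0]
  set R := relevantSites per r₀ r S
  have hV0 : 0 < V := by linarith
  have ht : 0 < ε / (16 * V) := by positivity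
  have ht1 : ε / (16 * V) ≤ 1 := by rw [div_le_one (by positivity)]; linarith
  have hh0 : 0 < h := by rw [hh]; positivity
  have hhγ : h ≤ γ / 2 := by
    rw [hh, div_le_div_iff₀ (by positivity) (by norm_num)]
    have : (0 : ℝ) ≤ m := by positivity
    nlinarith [mul_le_mul_of_nonneg_left ht1 hγ.le, mul_nonneg hγ.le this]
  have hK0 : 0 < K := by
    have : (0 : ℝ) < K := (by positivity : 0 < 1 / h).trans_le hK
    exact_mod_cast this
  have hKh : 1 / (K : ℝ) ≤ h := by
    rw [div_le_iff₀ (by exact_mod_cast hK0)]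
    rw [div_le_iff₀ hh0] at hK
    linarith
  set v : Outcome D L → ℝ := fun s => (O * shadow s).trace.re with hv_def
  set f : Param D L ℓ → ℝ := fun y => (O * ρ y).trace.re with hf_def
  have hv : ∀ s, |v s| ≤ V * opNorm O := fun s => (Complex.abs_re_le_norm _).trans (hOV s)
  have hfV : ∀ y ∈ cube D L ℓ, |f y| ≤ V * opNorm O := fun y hy =>
    (Complex.abs_re_le_norm _).trans ((norm_trace_mul_le_of_isDensity O (hρ y hy)).trans
      (le_mul_of_one_le_left h0.le hV))
  have hvf : ∀ y ∈ cube D L ℓ, ∑ s, outcomeProb (ρ y) s * v s = f y := by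
    intro y hy
    have := congrArg Complex.re (sum_outcomeProb_mul_trace (hρ y hy).1 O)
    rw [Complex.re_sum] at this
    simpa only [Complex.re_ofReal_mul] using this
  have hfs : ∀ x ∈ cube D L ℓ, ∀ x' ∈ cube D L ℓ, (∀ j ∈ R, ∀ i, |x j i - x' j i| ≤ γ) →
      |f x - f x'| ≤ ε / 4 * opNorm O := fun x hx x' hx' hxx => by
    have := (Complex.abs_re_le_norm _).trans (hstab x hx x' hx' hxx)
    rwa [Complex.sub_re] at this
  -- Error budget in units of `‖O‖`: `ε / 4` for moving `x` to a grid point and `τ = ε / 2` for the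
  -- average there, of which `τ / 2` covers the bias of the samples in the inner box.
  set τ : ℝ := ε / 2 * opNorm O with hτ_def
  have hτ : 0 < τ := by positivity
  have hτV : τ ≤ V * opNorm O := mul_le_mul_of_nonneg_right (by linarith) h0.le
  let c := gridParam R K (ℓ := ℓ)
  have hc : ∀ t, c t ∈ cube D L ℓ := gridParam_mem_cube R K
  -- For every `x` within `h` of the grid point, the selection box lies between these two boxes, so
  -- finitely many events control all `x`. Stability is used only in the inner box; between `γ` and
  -- `γ + h` it would not be available.
  let A : _ → Set (Param D L ℓ) := fun t => paramBox R (c t) (γ - h)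
  let A' : _ → Set (Param D L ℓ) := fun t => paramBox R (c t) (γ + h)
  have hA : ∀ t, MeasurableSet (A t) := fun t => measurableSet_paramBox _ _ _
  have hA' : ∀ t, MeasurableSet (A' t) := fun t => measurableSet_paramBox _ _ _
  let B₁ : _ → Set (Fin N → Param D L ℓ × Outcome D L) := fun t =>
    {ω | 0 ≤ ∑ k, excess (A t) (A' t) v (f (c t)) τ (V * opNorm O) (ω k)}
  let B₂ : _ → Set (Fin N → Param D L ℓ × Outcome D L) := fun t =>
    {ω | 0 ≤ ∑ k, excess (A t) (A' t) (fun s => -v s) (-f (c t)) τ (V * opNorm O) (ω k)}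
  have hAA : ∀ t, A t ⊆ A' t := fun t => paramBox_mono (by linarith)
  have hp1 : ∀ t, (γ / 2) ^ m / 2 ≤ (unifCube D L ℓ).real (A t) := fun t =>
    (half_pow_le hγ ht1 m hh).trans ((pow_le_pow_of_le_one (by linarith) (by linarith) hmd).trans
      (le_unifCube_paramBox R (hc t) (by linarith) (by linarith)))
  have hp2 : ∀ t, (unifCube D L ℓ).real (A' t) ≤
      (1 + τ / (8 * (V * opNorm O))) * (unifCube D L ℓ).real (A t) := fun t => by
    have h1 : τ / (8 * (V * opNorm O)) = ε / (16 * V) := by rw [hτ_def]; field_simp; ring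
    rw [h1]
    exact (unifCube_paramBox_le R (hc t) (by linarith) (by linarith)).trans
      (mul_le_mul_of_nonneg_right (ratio_pow_le hγ ht ht1 hmd hh) measureReal_nonneg)
  have hexp : ∀ t, ENNReal.ofReal (Real.exp (-(N * ((unifCube D L ℓ).real (A t) * τ ^ 2 /
      (832 * (V * opNorm O) ^ 2))))) ≤
      ENNReal.ofReal (Real.exp (-(N * ((γ / 2) ^ m * ε ^ 2 / (6656 * V ^ 2))))) := fun t => by
    refine ENNReal.ofReal_le_ofReal (Real.exp_le_exp.2 (neg_le_neg
      (mul_le_mul_of_nonneg_left ?_ (Nat.cast_nonneg N))))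
    have h1 : (unifCube D L ℓ).real (A t) * τ ^ 2 / (832 * (V * opNorm O) ^ 2) =
        (unifCube D L ℓ).real (A t) * (ε ^ 2 / (3328 * V ^ 2)) := by
      rw [hτ_def]; field_simp; ring
    have h2 : (γ / 2) ^ m * ε ^ 2 / (6656 * V ^ 2) =
        (γ / 2) ^ m / 2 * (ε ^ 2 / (3328 * V ^ 2)) := by field_simp; ring
    rw [h1, h2]
    exact mul_le_mul_of_nonneg_right (hp1 t) (by positivity)
  have hmem : ∀ t, ∀ y ∈ cube D L ℓ, y ∈ A t → |f (c t) - f y| ≤ τ / 2 := fun t y hy hyA => by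
    have := hfs (c t) (hc t) y hy fun j hj i => (hyA j hj i).trans (by linarith)
    rw [hτ_def]; linarith
  have hB₁ : ∀ t, Measure.pi (fun _ : Fin N => sampleLaw ρ) (B₁ t) ≤
      ENNReal.ofReal (Real.exp (-(N * ((γ / 2) ^ m * ε ^ 2 / (6656 * V ^ 2))))) := fun t => by
    refine (pi_sum_excess_nonneg_le hρ hm (hA t) (hA' t) (hAA t) hv (hfV _ (hc t)) hτ hτV
      (fun y hy hyA => ?_) (hp2 t) N).trans (hexp t)
    rw [hvf y hy]
    linarith [(abs_le.1 (hmem t y hy hyA)).1]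
  have hB₂ : ∀ t, Measure.pi (fun _ : Fin N => sampleLaw ρ) (B₂ t) ≤
      ENNReal.ofReal (Real.exp (-(N * ((γ / 2) ^ m * ε ^ 2 / (6656 * V ^ 2))))) := fun t => by
    refine (pi_sum_excess_nonneg_le hρ hm (hA t) (hA' t) (hAA t)
      (fun s => by rw [abs_neg]; exact hv s) (by rw [abs_neg]; exact hfV _ (hc t)) hτ hτV
      (fun y hy hyA => ?_) (hp2 t) N).trans (hexp t)
    simp only [mul_neg, Finset.sum_neg_distrib]
    rw [hvf y hy]
    linarith [(abs_le.1 (hmem t y hy hyA)).2]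
  have hmB : ∀ {w : Outcome D L → ℝ} {F : ℝ} (t), MeasurableSet {ω : Fin N → _ |
      0 ≤ ∑ k, excess (A t) (A' t) w F τ (V * opNorm O) (ω k)} := fun t =>
    measurableSet_le measurable_const (Finset.measurable_sum _ fun k _ =>
      (measurable_excess (hA t) (hA' t)).comp (measurable_pi_apply k))
  refine ⟨⋃ t, B₁ t ∪ B₂ t, MeasurableSet.iUnion fun t => (hmB t).union (hmB t), ?_, ?_⟩
  · set q := Real.exp (-(N * ((γ / 2) ^ m * ε ^ 2 / (6656 * V ^ 2)))) with hq
    calc Measure.pi (fun _ : Fin N => sampleLaw ρ) (⋃ t, B₁ t ∪ B₂ t)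
        ≤ ∑ t, Measure.pi (fun _ : Fin N => sampleLaw ρ) (B₁ t ∪ B₂ t) :=
          measure_iUnion_fintype_le _ _
      _ ≤ ∑ _t : {j // j ∈ R} → Fin ℓ → Fin K, ENNReal.ofReal (2 * q) := by
          refine Finset.sum_le_sum fun t _ => (measure_union_le _ _).trans
            ((add_le_add (hB₁ t) (hB₂ t)).trans (le_of_eq ?_))
          rw [← ENNReal.ofReal_add (Real.exp_pos _).le (Real.exp_pos _).le, two_mul]
      _ = ENNReal.ofReal ((K : ℝ) ^ (R.ncard * ℓ) * (2 * q)) := by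
          rw [Finset.sum_const, Finset.card_univ, card_gridParam, nsmul_eq_mul, ← Nat.cast_pow,
            ENNReal.ofReal_mul (Nat.cast_nonneg _), ENNReal.ofReal_natCast]
      _ ≤ ENNReal.ofReal ((K : ℝ) ^ m * (2 * q)) := by
          refine ENNReal.ofReal_le_ofReal (mul_le_mul_of_nonneg_right
            (pow_le_pow_right₀ ?_ hmd) (by positivity))
          exact_mod_cast hK0
  · intro data hdata x hx
    obtain ⟨t, ht⟩ := exists_gridParam R hK0 hx
    have hdata' : data ∉ B₁ t ∪ B₂ t := fun hmem => hdata (Set.mem_iUnion.2 ⟨t, hmem⟩)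
    have h1 : ∑ k, excess (A t) (A' t) v (f (c t)) τ (V * opNorm O) (data k) < 0 :=
      not_le.1 fun hle => hdata' (Or.inl hle)
    have h2 : ∑ k, excess (A t) (A' t) (fun s => -v s) (-f (c t)) τ (V * opNorm O) (data k) < 0 :=
      not_le.1 fun hle => hdata' (Or.inr hle)
    have hxc : ∀ j ∈ R, ∀ i, |x j i - c t j i| ≤ h := fun j hj i => (ht j hj i).trans hKh
    have h3 := abs_average_sub_le (Γ := selected per r₀ r γ S data x) hv (hfV _ (hc t)) hτ
      (fun k hk => ?_) (fun k hk => ?_) h1 h2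
    · have h4 := hfs x hx (c t) (hc t) fun j hj i => (hxc j hj i).trans (by linarith)
      rw [localEstimate_eq_ofReal per r₀ r γ S hO, trace_mul_eq_re hO (hρ x hx).1.isHermitian,
        ← Complex.ofReal_sub, Complex.norm_real, Real.norm_eq_abs]
      have h5 := abs_sub_le (f x) (f (c t)) (((selected per r₀ r γ S data x).card : ℝ)⁻¹ *
        ∑ k ∈ selected per r₀ r γ S data x, v (data k).2)
      rw [abs_sub_comm (f (c t))] at h5
      have h6 : 0 < ε * opNorm O := by positivity
      refine h5.trans ((add_le_add h4 h3).trans ?_)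
      rw [hτ_def]; linarith
    · refine Finset.mem_filter.2 ⟨Finset.mem_univ k, fun j hj i => ?_⟩
      have h4 : |c t j i - (data k).1 j i| ≤ γ - h := hk j hj i
      have h5 := abs_sub_le (x j i) (c t j i) ((data k).1 j i)
      linarith [hxc j hj i]
    · intro j hj i
      have h4 := (Finset.mem_filter.1 hk).2 j hj i
      have h5 := abs_sub_le (c t j i) (x j i) ((data k).1 j i)
      have h6 := hxc j hj i
      rw [abs_sub_comm] at h6
      exact h5.trans (by linarith)

/-- The estimators of a list of local observables are accurate for all parameters, with high
probability. -/
theorem Family.IsSteadyStatePhase.exists_good_event {P : Family D L ℓ} {r₀ κ : ℕ} {J a g : ℝ}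
    (hP : P.IsSteadyStatePhase r₀ J a κ g) (hJ : 0 < J) (hg : 0 < g) {k₀ M : ℕ}
    {S : Fin M → Set (Site D L)} {O : Fin M → Matrix (Conf D L) (Conf D L) ℂ}
    (hS : ∀ i, FitsInCube P.per k₀ (S i)) (hOS : ∀ i, QubitSupportedOn (S i) (O i))
    (hO : ∀ i, (O i).IsHermitian) {r : ℕ} {V γ ε h δ : ℝ} {m K N : ℕ}
    (hγ : 0 < γ) (hγ1 : γ ≤ 1) (hε : 0 < ε) (hε1 : ε < 1) (hV : V = 8 ^ k₀ ^ D)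
    (hmd : (2 * (r₀ + r) + k₀) ^ D * ℓ ≤ m)
    (hh : h = γ * (ε / (16 * V)) / (8 * (m + 1))) (hK : 1 / h ≤ K)
    (hstab : ∀ S : Set (Site D L), FitsInCube P.per k₀ S →
      ∀ O : Matrix (Conf D L) (Conf D L) ℂ, QubitSupportedOn S O →
      ∀ x ∈ cube D L ℓ, ∀ x' ∈ cube D L ℓ,
      (∀ j ∈ relevantSites P.per r₀ r S, ∀ i, |x j i - x' j i| ≤ γ) →
      ‖(O * P.steady x).trace - (O * P.steady x').trace‖ ≤ ε / 4 * opNorm O)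
    (hδ : M * ((K : ℝ) ^ m *
      (2 * Real.exp (-(N * ((γ / 2) ^ m * ε ^ 2 / (6656 * V ^ 2)))))) ≤ δ) :
    ∃ G : Set (Fin N → Param D L ℓ × Outcome D L), MeasurableSet G ∧
      ENNReal.ofReal (1 - δ) ≤ Measure.pi (fun _ : Fin N => sampleLaw P.steady) G ∧
      ∀ data ∈ G, ∀ x ∈ cube D L ℓ,
        ‖((∑ i, O i) * P.steady x).trace - ∑ i, localEstimate P.per r₀ r γ (S i) (O i) data x‖ ≤
          ε * ∑ i, opNorm (O i) := by
  have hρ : ∀ y ∈ cube D L ℓ, IsDensity (P.steady y) := fun y hy => (hP.density_lim _ y hy).1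
  have hm := fun s => hP.aemeasurable_outcomeProb hJ hg s
  have hprob : IsProbabilityMeasure (sampleLaw P.steady) := isProbabilityMeasure_sampleLaw hρ hm
  have hV1 : 1 ≤ V := by rw [hV]; exact one_le_pow₀ (by norm_num)
  have key : ∀ i, _ := fun i => exists_good_event_of_local hρ hm P.per r₀ r (S i) (hO i) hγ hγ1 hε
    hε1 hV1 (fun s => (norm_trace_mul_shadow_le (hOS i) s).trans
      (mul_le_mul_of_nonneg_right (by
        rw [hV]; exact pow_le_pow_right₀ (by norm_num) (hS i).ncard_le) (opNorm_nonneg _)))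
    (m := m) ((Nat.mul_le_mul_right ℓ ((Set.ncard_le_ncard (relevantSites_subset r₀ r (S i))
      (Set.toFinite _)).trans ((hS i).ncard_enlarge_le (r₀ + r)))).trans hmd) hh hK
    (hstab (S i) (hS i) (O i) (hOS i)) N
  choose B hB hBp hBx using key
  refine ⟨(⋃ i, B i)ᶜ, (MeasurableSet.iUnion hB).compl, ?_, ?_⟩
  · have h1 : Measure.pi (fun _ : Fin N => sampleLaw P.steady) (⋃ i, B i) ≤ ENNReal.ofReal δ := by
      refine (measure_iUnion_fintype_le _ _).trans ((Finset.sum_le_sum fun i _ => hBp i).trans ?_)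
      rw [Finset.sum_const, Finset.card_univ, Fintype.card_fin, nsmul_eq_mul,
        ← ENNReal.ofReal_natCast, ← ENNReal.ofReal_mul (Nat.cast_nonneg M)]
      exact ENNReal.ofReal_le_ofReal hδ
    have hδ0 : 0 ≤ δ := le_trans (by positivity) hδ
    rw [prob_compl_eq_one_sub (MeasurableSet.iUnion hB), ENNReal.ofReal_sub _ hδ0,
      ENNReal.ofReal_one]
    exact tsub_le_tsub_left h1 1
  · intro data hdata x hx
    rw [Finset.sum_mul, Matrix.trace_sum, ← Finset.sum_sub_distrib, Finset.mul_sum]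
    refine (norm_sum_le _ _).trans (Finset.sum_le_sum fun i _ => hBx i data (fun hmem =>
      hdata (Set.mem_iUnion.2 ⟨i, hmem⟩)) x hx)

end Learning

/-! ### Size of the stated sample count -/

section Parameters

/-- The constant multiplying `c' / ε` inside the logarithm of `radius`. -/
def radiusConst (D k₀ : ℕ) (J ξ : ℝ) : ℝ :=
  4 * (k₀ : ℝ) ^ D * J * ((D - 1).factorial : ℝ) * (2 * ξ) ^ (D - 1) * (D : ℝ) ^ (D - 1) /
    (Real.exp (1 / (2 * ξ)) * (1 - Real.exp (-(1 / (2 * ξ)))))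

lemma radiusConst_pos {D k₀ : ℕ} {J ξ : ℝ} (hD : 1 ≤ D) (hk₀ : 1 ≤ k₀) (hJ : 0 < J) (hξ : 0 < ξ) :
    0 < radiusConst D k₀ J ξ := by
  have h1 : Real.exp (-(1 / (2 * ξ))) < 1 := by
    rw [Real.exp_lt_one_iff, neg_lt_zero]; positivity
  have hk : (0 : ℝ) < k₀ := by exact_mod_cast hk₀
  have hD' : (0 : ℝ) < D := by exact_mod_cast hD
  have h2 : 0 < 1 - Real.exp (-(1 / (2 * ξ))) := by linarith
  have h3 : (0 : ℝ) < (D - 1).factorial := by exact_mod_cast Nat.factorial_pos _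
  unfold radiusConst
  positivity

lemma radius_eq (D k₀ : ℕ) (J ξ c' ε : ℝ) :
    radius D k₀ J ξ c' ε = ⌈2 * ξ * Real.log (c' * radiusConst D k₀ J ξ / ε)⌉₊ := by
  unfold radius radiusConst
  rw [mul_div_assoc', div_div]
  congr 4 <;> ring

lemma sampleCount_eq (D n k₀ r₀ ℓ M : ℕ) (J ξ c' ε δ δ' : ℝ) {r m : ℕ} {G : ℝ}
    (hr : radius D k₀ J ξ c' ε = r) (hm : (2 * (r + r₀ + k₀)) ^ D * ℓ = m)
    (hG : 2 / resolution D k₀ ℓ r J ε = G) :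
    sampleCount D n k₀ r₀ ℓ M J ξ c' ε δ δ' =
      shadowCount n k₀ ε δ' * G ^ m * (Real.log (M / δ) + m * Real.log G) := by
  have h : ((resolution D k₀ ℓ r J ε / 2) ^ m)⁻¹ = G ^ m := by rw [← inv_pow, inv_div, hG]
  unfold sampleCount
  simp only [hr, hm, hG, h, Real.log_pow]
  ring

lemma two_div_resolution {D k₀ ℓ r : ℕ} {J ε : ℝ} :
    2 / resolution D k₀ ℓ r J ε = 4 * (2 * ((r : ℝ) + k₀)) ^ D * J * ℓ / ε := by
  unfold resolution
  rw [div_div_eq_mul_div]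
  ring

/-- The logarithm is at least `log 4 > 1`, and `8 · 12 / 3 = 32`. The guarantee needs nothing more
of `q`. -/
lemma shadowCount_ge {n k₀ : ℕ} (hn : 1 ≤ n) (hk₀ : 1 ≤ k₀) {ε δ' : ℝ} (hε : 0 < ε)
    (hδ' : 0 < δ') (hδ'1 : δ' ≤ 1) : 32 / ε ^ 2 ≤ shadowCount n k₀ ε δ' := by
  have hn' : (1 : ℝ) ≤ n := by exact_mod_cast hn
  have h1 : (4 : ℝ) ≤ (n : ℝ) ^ k₀ * 2 ^ (k₀ + 1) / δ' := by
    rw [le_div_iff₀ hδ']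
    have h2 : (1 : ℝ) ≤ (n : ℝ) ^ k₀ := one_le_pow₀ hn'
    have h3 : (2 : ℝ) ^ 2 ≤ 2 ^ (k₀ + 1) := pow_le_pow_right₀ (by norm_num) (by omega)
    nlinarith
  have h2 : 1 ≤ Real.log ((n : ℝ) ^ k₀ * 2 ^ (k₀ + 1) / δ') := by
    rw [Real.le_log_iff_exp_le (by linarith)]
    linarith [Real.exp_one_lt_d9]
  have h3 : (12 : ℝ) ≤ 12 ^ k₀ := le_self_pow₀ (by norm_num) (by omega)
  have h4 : 32 / ε ^ 2 ≤ 8 * 12 ^ k₀ / (3 * ε ^ 2) := by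
    rw [div_le_div_iff₀ (by positivity) (by positivity)]
    nlinarith [sq_nonneg ε]
  exact h4.trans (le_mul_of_one_le_right (by positivity) h2)

/-- With the stated number of samples, the union bound over the grid is at most `δ`. -/
lemma union_bound_le {M m m' K N : ℕ} {V G q ε δ h : ℝ} (hε : 0 < ε) (hδ : 0 < δ)
    (hδ1 : δ < 1) (hV : 1 ≤ V) (hm : m' + 1 ≤ m) (hG : 2 ≤ G) (hGV : 832 * V ^ 2 ≤ G)
    (hGm : 128 * V * (m' + 1) / ε ≤ G ^ 2)
    (hh : h = 2 / G * (ε / (16 * V)) / (8 * (m' + 1))) (hh1 : h ≤ 1) (hK : K = ⌈1 / h⌉₊)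
    (hq : 32 / ε ^ 2 ≤ q) (hN : q * G ^ m * (Real.log (M / δ) + m * Real.log G) ≤ N) :
    M * ((K : ℝ) ^ m' *
      (2 * Real.exp (-(N * ((2 / G / 2) ^ m' * ε ^ 2 / (6656 * V ^ 2)))))) ≤ δ := by
  rcases Nat.eq_zero_or_pos M with hM | hM
  · rw [hM]; simp [hδ.le]
  have hM1 : (1 : ℝ) ≤ M := by exact_mod_cast hM
  have hM0 : (0 : ℝ) < M := by linarith
  have hG0 : 0 < G := by linarith
  have hG1 : 1 ≤ G := by linarith
  have hm0 : (0 : ℝ) < m' + 1 := by positivity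
  have hh0 : 0 < h := by rw [hh]; positivity
  have hlog : 0 ≤ Real.log (M / δ) := Real.log_nonneg (by rw [le_div_iff₀ hδ]; linarith)
  have hlogG : 0 ≤ Real.log G := Real.log_nonneg hG1
  set Λ := Real.log (M / δ) + m * Real.log G with hΛ
  have hΛ0 : 0 ≤ Λ := by positivity
  -- Here `1 / h = 64 V (m' + 1) G / ε`, and rounding up at most doubles it.
  have hKG : (K : ℝ) ≤ G ^ 3 := by
    have h1 : (1 : ℝ) ≤ 1 / h := by rw [le_div_iff₀ hh0]; linarith
    have h2 : 1 / h = 64 * V * (m' + 1) / ε * G := by rw [hh]; field_simp; ring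
    have h3 : (K : ℝ) ≤ 1 / h + 1 := by rw [hK]; exact (Nat.ceil_lt_add_one (by linarith)).le
    calc (K : ℝ) ≤ 2 * (1 / h) := by linarith
      _ = 128 * V * (m' + 1) / ε * G := by rw [h2]; ring
      _ ≤ G ^ 2 * G := by gcongr
      _ = G ^ 3 := by ring
  -- Since `m ≥ m' + 1`, a factor `G` survives the cancellation of `G ^ m'`. It absorbs the squared
  -- shadow bound through `832 V² ≤ G`, and `32 · 832 / 6656 = 4`.
  have hexp : 4 * Λ ≤ N * ((2 / G / 2) ^ m' * ε ^ 2 / (6656 * V ^ 2)) := by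
    have h1 : (2 / G / 2) ^ m' = (G ^ m')⁻¹ := by rw [← inv_pow]; congr 1; field_simp
    have h2 : G ^ (m' + 1) ≤ G ^ m := pow_le_pow_right₀ hG1 hm
    have hGm' : 0 < G ^ m' := by positivity
    have h3 : 32 / ε ^ 2 * (G ^ m' * G) * Λ ≤ N := by
      refine le_trans ?_ hN
      rw [← pow_succ]
      have : 0 ≤ q := le_trans (by positivity) hq
      gcongr
    calc 4 * Λ ≤ 32 * G * Λ / (6656 * V ^ 2) := by
          rw [le_div_iff₀ (by positivity)]
          nlinarith [mul_le_mul_of_nonneg_right hGV hΛ0]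
      _ = (32 / ε ^ 2 * (G ^ m' * G) * Λ) * ((G ^ m')⁻¹ * ε ^ 2 / (6656 * V ^ 2)) := by
          field_simp
      _ ≤ _ := by rw [h1]; gcongr
  -- Of the `4 Λ`, one `log (M / δ)` pays for the number of observables and for `δ`, while `4 m log
  -- G` outweighs the grid, of size at most `G ^ (3 m')`, and the factor `2` from the two signs.
  have h4 : Real.exp (-(N * ((2 / G / 2) ^ m' * ε ^ 2 / (6656 * V ^ 2)))) ≤
      δ / M * (G ^ (4 * m))⁻¹ := by
    calc _ ≤ Real.exp (-(Real.log (M / δ)) + -((4 * m : ℕ) * Real.log G)) := by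
          refine Real.exp_le_exp.2 ?_
          push_cast
          nlinarith
      _ = δ / M * (G ^ (4 * m))⁻¹ := by
          rw [Real.exp_add, Real.exp_neg, Real.exp_neg, Real.exp_log (by positivity),
            Real.exp_nat_mul, Real.exp_log hG0, inv_div]
  have h5 : (K : ℝ) ^ m' * 2 ≤ G ^ (4 * m) := by
    calc (K : ℝ) ^ m' * 2 ≤ (G ^ 3) ^ m' * G := by gcongr
      _ = G ^ (3 * m' + 1) := by rw [← pow_mul, pow_succ]
      _ ≤ G ^ (4 * m) := pow_le_pow_right₀ hG1 (by omega)
  calc _ = M * ((K : ℝ) ^ m' * 2 * _) := by rw [← mul_assoc ((K : ℝ) ^ m')]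
    _ ≤ M * (G ^ (4 * m) * (δ / M * (G ^ (4 * m))⁻¹)) := by gcongr
    _ = δ := by field_simp

/-- As `δ' ≤ 1 / 2`, the quotient `n / δ'` dominates each of `n`, `2` and `1 / δ'`. -/
lemma log_shadow_le {n k₀ : ℕ} (hn : 1 ≤ n) {δ' : ℝ} (hδ' : 0 < δ') (hδ'1 : δ' ≤ 1 / 2) :
    Real.log ((n : ℝ) ^ k₀ * 2 ^ (k₀ + 1) / δ') ≤ (2 * k₀ + 2) * Real.log (n / δ') := by
  have hn' : (1 : ℝ) ≤ n := by exact_mod_cast hn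
  have h1 : (n : ℝ) ≤ n / δ' := by rw [le_div_iff₀ hδ']; nlinarith
  have h2 : 2 ≤ n / δ' := by rw [le_div_iff₀ hδ']; linarith
  have h3 : 1 / δ' ≤ n / δ' := by gcongr
  have h4 : (2 * (k₀ : ℝ) + 2) = ((2 * k₀ + 2 : ℕ) : ℝ) := by push_cast; ring
  rw [h4, ← Real.log_pow]
  refine Real.log_le_log (by positivity) ?_
  calc (n : ℝ) ^ k₀ * 2 ^ (k₀ + 1) / δ' = (n : ℝ) ^ k₀ * 2 ^ (k₀ + 1) * (1 / δ') := by ring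
    _ ≤ (n / δ') ^ k₀ * (n / δ') ^ (k₀ + 1) * (n / δ') := by gcongr
    _ = (n / δ') ^ (2 * k₀ + 2) := by ring

set_option maxHeartbeats 800000 in
/-- The sample count is polylogarithmic. -/
lemma exists_sampleCount_le (D k₀ r₀ ℓ : ℕ) {J ξ c' C₁ : ℝ} (hJ : 0 ≤ J) (hC₁ : 0 ≤ C₁)
    (hr : ∀ ε : ℝ, 0 < ε → ε < 1 → (radius D k₀ J ξ c' ε : ℝ) ≤ C₁ * (1 + Real.log (1 / ε)))
    (hG : ∀ ε : ℝ, 0 < ε → ε < 1 →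
      1 ≤ 2 / resolution D k₀ ℓ (radius D k₀ J ξ c' ε) J ε) :
    ∃ (C : ℝ) (p : ℕ), ∀ (n M : ℕ) (ε δ δ' : ℝ), 1 ≤ n → 1 ≤ M → 0 < ε → ε < 1 →
      0 < δ → δ ≤ 1 / 2 → 0 < δ' → δ' ≤ 1 / 2 →
      sampleCount D n k₀ r₀ ℓ M J ξ c' ε δ δ' ≤
        C * Real.log ((n : ℝ) / δ') * Real.log (M / δ) *
          Real.exp (C * (1 + Real.log (1 / ε)) ^ p) := by
  set C₂ : ℝ := (2 * (C₁ + r₀ + k₀)) ^ D * ℓ with hC₂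
  set C₃ : ℝ := 4 * (2 * (C₁ + k₀)) ^ D * J * ℓ with hC₃
  have hC₂0 : 0 ≤ C₂ := by positivity
  have hC₃0 : 0 ≤ C₃ := by positivity
  set C₄ : ℝ := C₃ + D + 1 with hC₄
  set Q : ℝ := 8 * 12 ^ k₀ / 3 * (2 * k₀ + 2) with hQ
  have hQ0 : 0 ≤ Q := by positivity
  -- Here `m` is of order `(1 + l) ^ D` and `log G` of order `1 + l`, with `l = log (1/ε)`, hence
  -- the power `D + 1`. The `2` is from `1 / ε²` in `q`; of the `3`, one is from `G ^ m` and two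
  -- from making a product of the last factor.
  refine ⟨Q + (2 + 3 * (C₂ * C₄)), D + 1, fun n M ε δ δ' hn hM hε hε1 hδ hδ1 hδ' hδ'1 => ?_⟩
  have hn' : (1 : ℝ) ≤ n := by exact_mod_cast hn
  have hM' : (1 : ℝ) ≤ M := by exact_mod_cast hM
  set l := Real.log (1 / ε) with hl
  have hl0 : 0 ≤ l := Real.log_nonneg (by rw [le_div_iff₀ hε]; linarith)
  have hexpl : Real.exp l = 1 / ε := Real.exp_log (by positivity)
  set r := radius D k₀ J ξ c' ε with hr_def
  set m := (2 * (r + r₀ + k₀)) ^ D * ℓ with hm_def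
  set G := 2 / resolution D k₀ ℓ r J ε with hG_def
  have hG1 : 1 ≤ G := hG ε hε hε1
  have hrl : (r : ℝ) ≤ C₁ * (1 + l) := hr ε hε hε1
  have hm : (m : ℝ) ≤ C₂ * (1 + l) ^ D := by
    rw [hm_def, hC₂]
    push_cast
    have h1 : 2 * ((r : ℝ) + r₀ + k₀) ≤ 2 * (C₁ + r₀ + k₀) * (1 + l) := by
      linarith [mul_nonneg (Nat.cast_nonneg r₀ : (0 : ℝ) ≤ r₀) hl0,
        mul_nonneg (Nat.cast_nonneg k₀ : (0 : ℝ) ≤ k₀) hl0]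
    calc (2 * ((r : ℝ) + r₀ + k₀)) ^ D * ℓ ≤ (2 * (C₁ + r₀ + k₀) * (1 + l)) ^ D * ℓ := by
          gcongr
      _ = _ := by rw [mul_pow]; ring
  have hGexp : G ≤ Real.exp (C₄ * (1 + l)) := by
    have h1 : G ≤ C₃ * (1 + l) ^ D * Real.exp l := by
      rw [hG_def, two_div_resolution, hexpl, mul_one_div, hC₃]
      refine div_le_div_of_nonneg_right ?_ hε.le
      have h1 : 2 * ((r : ℝ) + k₀) ≤ 2 * (C₁ + k₀) * (1 + l) := by
        linarith [mul_nonneg (Nat.cast_nonneg k₀ : (0 : ℝ) ≤ k₀) hl0]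
      calc 4 * (2 * ((r : ℝ) + k₀)) ^ D * J * ℓ ≤
          4 * (2 * (C₁ + k₀) * (1 + l)) ^ D * J * ℓ := by gcongr
        _ = _ := by rw [mul_pow]; ring
    have h2 : C₃ ≤ Real.exp C₃ := by linarith [Real.add_one_le_exp C₃]
    have h3 : 1 + l ≤ Real.exp l := by linarith [Real.add_one_le_exp l]
    calc G ≤ C₃ * (1 + l) ^ D * Real.exp l := h1
      _ ≤ Real.exp C₃ * (Real.exp l) ^ D * Real.exp l := by gcongr
      _ = Real.exp (C₃ + D * l + l) := by rw [Real.exp_add, Real.exp_add, Real.exp_nat_mul]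
      _ ≤ Real.exp (C₄ * (1 + l)) := by
          refine Real.exp_le_exp.2 ?_
          rw [hC₄]
          nlinarith [mul_nonneg hC₃0 hl0, (Nat.cast_nonneg D : (0 : ℝ) ≤ D)]
  have hlogG0 : 0 ≤ Real.log G := Real.log_nonneg hG1
  have hlogG : Real.log G ≤ C₄ * (1 + l) := (Real.log_le_iff_le_exp (by linarith)).2 hGexp
  have hmG : m * Real.log G ≤ C₂ * C₄ * (1 + l) ^ (D + 1) := by
    calc m * Real.log G ≤ C₂ * (1 + l) ^ D * (C₄ * (1 + l)) := by gcongr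
      _ = _ := by ring
  have hmG0 : 0 ≤ m * Real.log G := by positivity
  have hlogM : 1 / 2 ≤ Real.log (M / δ) := by
    have h1 : (2 : ℝ) ≤ M / δ := by rw [le_div_iff₀ hδ]; linarith
    have := Real.log_le_log (by norm_num) h1
    linarith [Real.log_two_gt_d9]
  have hlogn : 0 ≤ Real.log (n / δ') := Real.log_nonneg (by rw [le_div_iff₀ hδ']; linarith)
  have hsh : shadowCount n k₀ ε δ' ≤ Q * Real.log (n / δ') * Real.exp (2 * l) := by
    have h1 : Real.exp (2 * l) = 1 / ε ^ 2 := by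
      rw [two_mul, Real.exp_add, hexpl]; field_simp
    unfold shadowCount
    calc 8 * 12 ^ k₀ / (3 * ε ^ 2) * Real.log ((n : ℝ) ^ k₀ * 2 ^ (k₀ + 1) / δ')
        ≤ 8 * 12 ^ k₀ / (3 * ε ^ 2) * ((2 * k₀ + 2) * Real.log (n / δ')) :=
          mul_le_mul_of_nonneg_left (log_shadow_le hn hδ' hδ'1) (by positivity)
      _ = Q * Real.log (n / δ') * Real.exp (2 * l) := by rw [h1, hQ]; field_simp
  -- As `log (M / δ) ≥ 1 / 2`, the sum is at most `log (M / δ) (1 + 2 m log G)`.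
  have hsum : Real.log (M / δ) + m * Real.log G ≤
      Real.log (M / δ) * Real.exp (2 * (m * Real.log G)) := by
    have h1 := mul_le_mul_of_nonneg_left (Real.add_one_le_exp (2 * (m * Real.log G)))
      (by linarith : 0 ≤ Real.log (M / δ))
    have h2 := mul_le_mul_of_nonneg_right hlogM hmG0
    linarith
  have hpow : G ^ m = Real.exp (m * Real.log G) := by
    rw [Real.exp_nat_mul, Real.exp_log (by linarith)]
  have h1l : 1 ≤ (1 + l) ^ D := one_le_pow₀ (by linarith)
  have h2l : 2 * l ≤ 2 * (1 + l) ^ (D + 1) := by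
    rw [pow_succ]; nlinarith
  rw [sampleCount_eq D n k₀ r₀ ℓ M J ξ c' ε δ δ' hr_def.symm hm_def.symm hG_def.symm]
  calc shadowCount n k₀ ε δ' * G ^ m * (Real.log (M / δ) + m * Real.log G)
      ≤ Q * Real.log (n / δ') * Real.exp (2 * l) * Real.exp (m * Real.log G) *
        (Real.log (M / δ) * Real.exp (2 * (m * Real.log G))) := by
        rw [hpow]
        gcongr
    _ = Q * Real.log (n / δ') * Real.log (M / δ) *
        Real.exp (2 * l + 3 * (m * Real.log G)) := by
        rw [Real.exp_add, show 3 * (m * Real.log G) = m * Real.log G + 2 * (m * Real.log G) by ring,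
          Real.exp_add]
        ring
    _ ≤ _ := by
        have hC0 : 0 ≤ C₂ * C₄ := by positivity
        have hP : 0 ≤ Q * (1 + l) ^ (D + 1) := by positivity
        gcongr
        · linarith
        · have h3 : 2 * l + 3 * (m * Real.log G) ≤
              (2 + 3 * (C₂ * C₄)) * (1 + l) ^ (D + 1) := by linarith
          rw [add_mul]
          linarith

end Parameters

/-! ### The guarantee for a sufficiently large radius -/

section Guarantee

set_option maxHeartbeats 800000 in
/-- The learning guarantee, for constants `ξ` and `c'` that make the radius large enough compared
to the constants `C` and `η` of the local stability estimate. -/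
theorem Family.IsSteadyStatePhase.learning_guarantee {D L r₀ k₀ ℓ : ℕ} (hD : 1 ≤ D) (hk₀ : 1 ≤ k₀)
    (hℓ : 1 ≤ ℓ) {J a g : ℝ} {κ : ℕ} (hJ : 0 < J) (hg : 0 < g) {C η ξ c' : ℝ} (hC : 0 < C)
    {P : Family D L ℓ} (hP : P.IsSteadyStatePhase r₀ J a κ g)
    (hstab : ∀ S : Set (Site D L), FitsInCube P.per k₀ S →
      ∀ O : Matrix (Conf D L) (Conf D L) ℂ, QubitSupportedOn S O →
      ∀ (r : ℕ) (γ : ℝ), 0 ≤ γ → ∀ x ∈ cube D L ℓ, ∀ x' ∈ cube D L ℓ,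
        (∀ j ∈ relevantSites P.per r₀ r S, ∀ i, |x j i - x' j i| ≤ γ) →
        ‖(O * P.steady x).trace - (O * P.steady x').trace‖ ≤ C * (γ + η ^ r) * opNorm O)
    {M : ℕ} {S : Fin M → Set (Site D L)} {O : Fin M → Matrix (Conf D L) (Conf D L) ℂ}
    (hS : ∀ i, FitsInCube P.per k₀ (S i)) (hOS : ∀ i, QubitSupportedOn (S i) (O i))
    (hO : ∀ i, (O i).IsHermitian) {ε δ δ' : ℝ} (hε : 0 < ε) (hε1 : ε < 1) (hδ : 0 < δ)
    (hδ1 : δ < 1) (hδ' : 0 < δ') (hδ'1 : δ' < 1)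
    (hη : C * η ^ radius D k₀ J ξ c' ε ≤ ε / 8)
    (hr : 2 + 832 * (8 ^ k₀ ^ D) ^ 2 + 64 * 8 ^ k₀ ^ D * (1 + r₀) ^ D / J + 4 * C ≤
      radius D k₀ J ξ c' ε * J) {N : ℕ}
    (hN : sampleCount D (Fintype.card (Site D L)) k₀ r₀ ℓ M J ξ c' ε δ δ' ≤ N) :
    ∃ G : Set (Fin N → Param D L ℓ × Outcome D L), MeasurableSet G ∧
      ENNReal.ofReal ((1 - δ) * (1 - δ')) ≤
        MeasureTheory.Measure.pi (fun _ : Fin N => sampleLaw P.steady) G ∧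
      ∀ data ∈ G, ∀ x ∈ cube D L ℓ,
        ‖((∑ i, O i) * P.steady x).trace -
          ∑ i, localEstimate P.per r₀ (radius D k₀ J ξ c' ε)
            (resolution D k₀ ℓ (radius D k₀ J ξ c' ε) J ε) (S i) (O i) data x‖ ≤
          ε * ∑ i, opNorm (O i) := by
  set r := radius D k₀ J ξ c' ε with hr_def
  set γ := resolution D k₀ ℓ r J ε with hγ_def
  set V : ℝ := 8 ^ k₀ ^ D with hV_def
  have hV1 : 1 ≤ V := one_le_pow₀ (by norm_num)
  set A : ℝ := (2 * ((r : ℝ) + k₀)) ^ D with hA_def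
  set G : ℝ := 2 / γ with hG_def
  set m := (2 * (r + r₀ + k₀)) ^ D * ℓ with hm_def
  set m' := (2 * (r₀ + r) + k₀) ^ D * ℓ with hm'_def
  set T : ℝ := 64 * V * (1 + r₀) ^ D / J with hT_def
  have hT0 : 0 ≤ T := by positivity
  have hk : (1 : ℝ) ≤ k₀ := by exact_mod_cast hk₀
  have hl : (1 : ℝ) ≤ ℓ := by exact_mod_cast hℓ
  have hr0 : (0 : ℝ) ≤ r := Nat.cast_nonneg r
  have hA : (r : ℝ) ≤ A := by
    refine le_trans (by linarith) (le_self_pow₀ (a := 2 * ((r : ℝ) + k₀)) (by linarith) (by omega))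
  have hA0 : 0 < A := by positivity
  have hrA : (r : ℝ) * J ≤ A * J * ℓ := by
    calc (r : ℝ) * J ≤ A * J := by gcongr
      _ ≤ A * J * ℓ := le_mul_of_one_le_right (by positivity) hl
  have hGA : G = 4 * A * J * ℓ / ε := two_div_resolution
  have hrG : (r : ℝ) * J ≤ G := by
    rw [hGA, le_div_iff₀ hε]
    have : 0 ≤ (r : ℝ) * J := by positivity
    nlinarith
  have hV2 : 0 ≤ 832 * V ^ 2 := by positivity
  have hG2 : 2 ≤ G := by linarith
  have hGV : 832 * V ^ 2 ≤ G := by linarith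
  have hGT : T ≤ G := by linarith
  have hγ0 : 0 < γ := by
    rw [hγ_def]; unfold resolution; positivity
  have hγG : γ = 2 / G := by rw [hG_def]; field_simp
  have hγ1 : γ ≤ 1 := by rw [hγG, div_le_one (by linarith)]; exact hG2
  -- By definition `γ = ε / (2 A J ℓ)`, and `A J ℓ ≥ r J ≥ 4 C`.
  have hCγ : C * γ ≤ ε / 8 := by
    have h1 : γ = ε / (2 * A * J * ℓ) := rfl
    have h2 : 8 * C ≤ 2 * A * J * ℓ := by linarith
    rw [h1, mul_div_assoc', div_le_div_iff₀ (by positivity) (by norm_num)]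
    nlinarith
  -- The relevant sites fit into a cube of side `2 (r₀ + r) + k₀`, strictly less than the stated `2
  -- (r + r₀ + k₀)` because `k₀ ≥ 1`. This is the source of the spare factor `G`.
  have hmm : m' + 1 ≤ m := by
    have h1 : (2 * (r₀ + r) + k₀) ^ D < (2 * (r + r₀ + k₀)) ^ D :=
      Nat.pow_lt_pow_left (by omega) (by omega)
    exact Nat.succ_le_of_lt (Nat.mul_lt_mul_of_pos_right h1 (by omega))
  have hm'A : (m' : ℝ) + 1 ≤ (1 + r₀) ^ D * A * ℓ := by
    have h1 : m ≤ (1 + r₀) ^ D * (2 * (r + k₀)) ^ D * ℓ := by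
      rw [hm_def, ← mul_pow]
      refine Nat.mul_le_mul_right ℓ (Nat.pow_le_pow_left ?_ D)
      nlinarith [Nat.zero_le (r₀ * r), Nat.mul_le_mul_left r₀ hk₀]
    calc (m' : ℝ) + 1 ≤ m := by exact_mod_cast hmm
      _ ≤ (((1 + r₀) ^ D * (2 * (r + k₀)) ^ D * ℓ : ℕ) : ℝ) := by exact_mod_cast h1
      _ = _ := by push_cast; rfl
  have hGm : 128 * V * (m' + 1) / ε ≤ G ^ 2 := by
    calc 128 * V * (m' + 1) / ε ≤ 256 * V * ((1 + r₀) ^ D * A * ℓ) / ε := by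
          gcongr; norm_num
      _ = T * G := by rw [hT_def, hGA]; field_simp; ring
      _ ≤ G * G := by gcongr
      _ = G ^ 2 := (sq G).symm
  set h := γ * (ε / (16 * V)) / (8 * ((m' : ℝ) + 1)) with hh
  have hh1 : h ≤ 1 := by
    rw [hh, div_le_one (by positivity)]
    have h1 : ε / (16 * V) ≤ 1 := by rw [div_le_one (by positivity)]; linarith
    have h2 : γ * (ε / (16 * V)) ≤ 1 := mul_le_one₀ hγ1 (by positivity) h1
    have h3 : (0 : ℝ) ≤ m' := Nat.cast_nonneg m'
    linarith
  have hn : 1 ≤ Fintype.card (Site D L) := Fintype.card_pos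
  rw [sampleCount_eq D _ k₀ r₀ ℓ M J ξ c' ε δ δ' hr_def.symm hm_def.symm hG_def.symm] at hN
  have hub := union_bound_le (h := h) hε hδ hδ1 hV1 hmm hG2 hGV hGm (by rw [hh, hγG]) hh1 rfl
    (shadowCount_ge hn hk₀ hε hδ' hδ'1.le) hN
  obtain ⟨E, hE, hEp, hEx⟩ := hP.exists_good_event hJ hg hS hOS hO (r := r) (δ := δ)
    (N := N) hγ0 hγ1 hε hε1 hV_def (le_refl m') hh (Nat.le_ceil (1 / h)) (fun S hS O hO x hx x' hx' hxx =>
      (hstab S hS O hO r γ hγ0.le x hx x' hx' hxx).trans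
        (mul_le_mul_of_nonneg_right (by linarith) (opNorm_nonneg O))) (by rw [hγG]; exact hub)
  refine ⟨E, hE, le_trans (ENNReal.ofReal_le_ofReal ?_) hEp, hEx⟩
  nlinarith

end Guarantee

end SteadyPhase

end

/-! ### Choice of the constants -/

theorem mainTheorem2
    (D r₀ k₀ ℓ : ℕ) (hD : 1 ≤ D) (hk₀ : 1 ≤ k₀) (hℓ : 1 ≤ ℓ)
    (J a g : ℝ) (κ : ℕ) (hJ : 0 < J) (hg : 0 < g) :
    ∃ ξ : ℝ, 0 < ξ ∧ ∃ c' : ℝ, 0 < c' ∧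
      -- learning guarantee, with constants independent of the system and of the accuracy
      (∀ (L : ℕ) (P : SteadyPhase.Family D L ℓ), P.IsSteadyStatePhase r₀ J a κ g →
        ∀ (M : ℕ) (S : Fin M → Set (SteadyPhase.Site D L))
          (O : Fin M → Matrix (SteadyPhase.Conf D L) (SteadyPhase.Conf D L) ℂ),
          (∀ i, SteadyPhase.FitsInCube P.per k₀ (S i)) →
          (∀ i, SteadyPhase.QubitSupportedOn (S i) (O i)) →
          (∀ i, (O i).IsHermitian) →
        ∀ ε δ δ' : ℝ, 0 < ε → ε < 1 → 0 < δ → δ < 1 → 0 < δ' → δ' < 1 →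
        ∀ N : ℕ,
          SteadyPhase.sampleCount D (Fintype.card (SteadyPhase.Site D L)) k₀ r₀ ℓ M J ξ c' ε δ δ'
            ≤ (N : ℝ) →
          ∃ G : Set (Fin N → SteadyPhase.Param D L ℓ × SteadyPhase.Outcome D L),
            MeasurableSet G ∧
            ENNReal.ofReal ((1 - δ) * (1 - δ')) ≤
              MeasureTheory.Measure.pi (fun _ : Fin N => SteadyPhase.sampleLaw P.steady) G ∧
            ∀ data ∈ G, ∀ x ∈ SteadyPhase.cube D L ℓ,
              ‖Matrix.trace ((∑ i, O i) * P.steady x) -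
                  ∑ i, SteadyPhase.localEstimate P.per r₀ (SteadyPhase.radius D k₀ J ξ c' ε)
                    (SteadyPhase.resolution D k₀ ℓ (SteadyPhase.radius D k₀ J ξ c' ε) J ε)
                    (S i) (O i) data x‖ ≤
                ε * ∑ i, SteadyPhase.opNorm (O i)) ∧
      -- the sample count is `O(log(n/δ') log(M/δ) e^{polylog(1/ε)})`
      (∃ (C : ℝ) (p : ℕ), ∀ (L M : ℕ) (ε δ δ' : ℝ), 1 ≤ M → 0 < ε → ε < 1 →
        0 < δ → δ ≤ 1 / 2 → 0 < δ' → δ' ≤ 1 / 2 →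
        SteadyPhase.sampleCount D (Fintype.card (SteadyPhase.Site D L)) k₀ r₀ ℓ M J ξ c' ε δ δ' ≤
          C * Real.log ((Fintype.card (SteadyPhase.Site D L) : ℝ) / δ') * Real.log (M / δ) *
            Real.exp (C * (1 + Real.log (1 / ε)) ^ p)) := by
  obtain ⟨C, hC, η, hη, hη1, hstab⟩ :=
    SteadyPhase.Family.exists_local_stability D r₀ k₀ ℓ κ (a := a) hJ hg
  have hlogη : 0 < -Real.log η := neg_pos.2 (Real.log_neg hη hη1)
  -- The threshold for `r J`. It makes `2 / γ` exceed `2`, `832 V²` and the constant of the grid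
  -- size, with `V = 8 ^ k₀ ^ D`, and makes `C γ ≤ ε / 8`.
  obtain ⟨T, hT⟩ : ∃ T : ℝ, T = 2 + 832 * (8 ^ k₀ ^ D) ^ 2 +
    64 * 8 ^ k₀ ^ D * (1 + (r₀ : ℝ)) ^ D / J + 4 * C := ⟨_, rfl⟩
  have hT2 : 2 ≤ T := by
    have h1 : (0 : ℝ) ≤ 832 * (8 ^ k₀ ^ D) ^ 2 := by positivity
    have h2 : (0 : ℝ) ≤ 64 * 8 ^ k₀ ^ D * (1 + (r₀ : ℝ)) ^ D / J := by positivity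
    linarith
  -- Chosen so that `exp (-r / (2 ξ)) = η ^ r`.
  obtain ⟨ξ, hξ_def⟩ : ∃ ξ : ℝ, ξ = 1 / (2 * -Real.log η) := ⟨_, rfl⟩
  have hξ : 0 < ξ := by rw [hξ_def]; positivity
  have hξη : 2 * ξ * -Real.log η = 1 := by
    have hne : Real.log η ≠ 0 := (neg_pos.1 hlogη).ne
    rw [hξ_def]; field_simp
  -- With `c' = X / radiusConst` the logarithm in the radius is `log (X / ε)`. The first factor of
  -- `X` forces `r J ≥ T` for every `ε < 1`, and the second gives `C η ^ r ≤ C ε / X ≤ ε / 8`.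
  obtain ⟨X, hX⟩ : ∃ X : ℝ, X = Real.exp (T / J / (2 * ξ)) * (1 + 8 * C) := ⟨_, rfl⟩
  have hexp1 : 1 ≤ Real.exp (T / J / (2 * ξ)) := Real.one_le_exp (by positivity)
  have hXexp : Real.exp (T / J / (2 * ξ)) ≤ X := by
    rw [hX]; exact le_mul_of_one_le_right (Real.exp_pos _).le (by linarith)
  have hXC : 8 * C ≤ X := by
    rw [hX]; nlinarith
  have hX1 : 1 ≤ X := hexp1.trans hXexp
  have hκ := SteadyPhase.radiusConst_pos hD hk₀ hJ hξ
  have hrad : ∀ ε, SteadyPhase.radius D k₀ J ξ (X / SteadyPhase.radiusConst D k₀ J ξ) ε =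
      ⌈2 * ξ * Real.log (X / ε)⌉₊ := fun ε => by
    rw [SteadyPhase.radius_eq, div_mul_cancel₀ _ hκ.ne']
  have hlogX : ∀ ε : ℝ, 0 < ε → ε < 1 → Real.log (X / ε) = Real.log X + Real.log (1 / ε) ∧
      0 ≤ Real.log X ∧ 0 ≤ Real.log (1 / ε) := fun ε hε hε1 =>
    ⟨by rw [← Real.log_mul (by linarith) (by positivity), mul_one_div], Real.log_nonneg hX1,
      Real.log_nonneg (by rw [le_div_iff₀ hε]; linarith)⟩
  have hradT : ∀ ε : ℝ, 0 < ε → ε < 1 →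
      T ≤ SteadyPhase.radius D k₀ J ξ (X / SteadyPhase.radiusConst D k₀ J ξ) ε * J := by
    intro ε hε hε1
    obtain ⟨h1, -, h3⟩ := hlogX ε hε hε1
    have h4 : T / J / (2 * ξ) ≤ Real.log X := (Real.le_log_iff_exp_le (by linarith)).2 hXexp
    rw [div_le_iff₀ (by positivity), div_le_iff₀ hJ] at h4
    rw [hrad]
    refine h4.trans (mul_le_mul_of_nonneg_right ((le_trans ?_ (Nat.le_ceil _))) hJ.le)
    rw [h1]
    nlinarith
  refine ⟨ξ, hξ, X / SteadyPhase.radiusConst D k₀ J ξ, by positivity, ?_, ?_⟩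
  · intro L P hP M S O hS hOS hO ε δ δ' hε hε1 hδ hδ1 hδ' hδ'1 N hN
    refine hP.learning_guarantee hD hk₀ hℓ hJ hg hC (hstab L P hP) hS hOS hO hε hε1 hδ hδ1 hδ' hδ'1
      ?_ (hT ▸ hradT ε hε hε1) hN
    have h1 : Real.log (X / ε) ≤
        SteadyPhase.radius D k₀ J ξ (X / SteadyPhase.radiusConst D k₀ J ξ) ε * -Real.log η := by
      rw [hrad]
      calc Real.log (X / ε) = 2 * ξ * Real.log (X / ε) * -Real.log η := by
            linear_combination -Real.log (X / ε) * hξη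
        _ ≤ _ := mul_le_mul_of_nonneg_right (Nat.le_ceil _) hlogη.le
    have h2 : η ^ SteadyPhase.radius D k₀ J ξ (X / SteadyPhase.radiusConst D k₀ J ξ) ε ≤ ε / X := by
      rw [← Real.exp_log hη, ← Real.exp_nat_mul, ← inv_div X ε,
        ← Real.exp_log (show 0 < X / ε by positivity), ← Real.exp_neg]
      exact Real.exp_le_exp.2 (by linarith)
    calc _ ≤ C * (ε / X) := mul_le_mul_of_nonneg_left h2 hC.le
      _ ≤ ε / 8 := by
        rw [mul_div_assoc', div_le_div_iff₀ (by linarith) (by norm_num)]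
        nlinarith
  · have hradle : ∀ ε : ℝ, 0 < ε → ε < 1 →
        (SteadyPhase.radius D k₀ J ξ (X / SteadyPhase.radiusConst D k₀ J ξ) ε : ℝ) ≤
          (2 * ξ * Real.log X + 2 * ξ + 1) * (1 + Real.log (1 / ε)) := by
      intro ε hε hε1
      obtain ⟨h1, h2, h3⟩ := hlogX ε hε hε1
      rw [hrad, h1]
      refine (Nat.ceil_lt_add_one (by positivity)).le.trans ?_
      have h4 : 0 ≤ 2 * ξ * Real.log X * Real.log (1 / ε) := by positivity
      nlinarith
    have hres : ∀ ε : ℝ, 0 < ε → ε < 1 → 1 ≤ 2 / SteadyPhase.resolution D k₀ ℓ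
        (SteadyPhase.radius D k₀ J ξ (X / SteadyPhase.radiusConst D k₀ J ξ) ε) J ε := by
      intro ε hε hε1
      rw [SteadyPhase.two_div_resolution, le_div_iff₀ hε]
      have h1 := hradT ε hε hε1
      set r := SteadyPhase.radius D k₀ J ξ (X / SteadyPhase.radiusConst D k₀ J ξ) ε
      have hk : (1 : ℝ) ≤ k₀ := by exact_mod_cast hk₀
      have hr0 : (0 : ℝ) ≤ r := Nat.cast_nonneg r
      have h2 : (r : ℝ) ≤ (2 * ((r : ℝ) + k₀)) ^ D := le_trans (by linarith)
        (le_self_pow₀ (a := 2 * ((r : ℝ) + k₀)) (by linarith) (by omega))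
      have hl : (1 : ℝ) ≤ ℓ := by exact_mod_cast hℓ
      have h3 : (r : ℝ) * J ≤ (2 * ((r : ℝ) + k₀)) ^ D * J * ℓ :=
        (mul_le_mul_of_nonneg_right h2 hJ.le).trans (le_mul_of_one_le_right (by positivity) hl)
      linarith
    have hlogX0 : 0 ≤ Real.log X := Real.log_nonneg hX1
    obtain ⟨C', p, h⟩ := SteadyPhase.exists_sampleCount_le D k₀ r₀ ℓ hJ.le (by positivity) hradle
      hres
    exact ⟨C', p, fun L M ε δ δ' hM hε hε1 hδ hδ1 hδ' hδ'1 =>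
      h _ M ε δ δ' Fintype.card_pos hM hε hε1 hδ hδ1 hδ' hδ'1⟩
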